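/- Let $p=(p_k)_{k\ge1}$ be a probability distribution on $\{1,2,\dots\}$ with $\sum_k k^{1+\varepsilon}p_k<\infty$ for some $\varepsilon>0$. **Notation.** For $x=(x_0,x_1,\dots)$ with $x_k\ge 0$ for $k\ge1$ put $r(x)=x_0^+ +\sum_{k\ge1}kx_k$, $r_0(x)=x_0^+/r(x)$ and $r_k(x)=kx_k/r(x)$ $(k\ge1)$ if $0<r(x)<\infty$, and $r_k(x)=0$ for all $k\ge 0$ otherwise. Let $\ell(u)=u\log u-u+1$ for $u\ge 0$, and $\Gamma(\psi)(t)=\psi(t)-\big(\inf_{0\le s\le t}\psi(s)\big)\wedge 0$. Conventions: $0\log 0=0$, $0\log(u/0)=0$ for $u\ge0$, $u\log(u/0)=\infty$ for $u>0$; the infimum over the empty set is $\infty$. For $T\ge0$ let $\mathcal C_T$ be the set of pairs of continuous functions $\zeta=(\zeta_k)_{k\ge0}:[0,T]\to\mathbb R^\infty$, $\psi:[0,T]\to\mathbb R$ such that $\psi$ is absolutely continuous with $\psi(0)=0$, $\zeta_0=\Gamma(\psi)$, and for each $k\ge1$ the function $\zeta_k$ is nonnegative, non-increasing and absolutely continuous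 with $\zeta_k(0)=p_k$. For $(\zeta,\psi)\in\mathcal C_T$ let $\mathcal S_T(\zeta,\psi)$ be the set of sequences $\varphi=(\varphi_k)_{k\ge0}$ of measurable functions $\varphi_k:[0,T]\times[0,1]\to[0,\infty)$ such that for all $t\in[0,T]$ $$\psi(t)=\sum_{k\ge0}(k-2)\int_{[0,t]\times[0,1]}1_{[0,r_k(\zeta(s)))}(y)\,\varphi_k(s,y)\,ds\,dy,\qquad \zeta_k(t)=p_k-\int_{[0,t]\times[0,1]}1_{[0,r_k(\zeta(s)))}(y)\,\varphi_k(s,y)\,ds\,dy\quad(k\ge1).$$ For $0\le t_1\le t_2$ and $(\zeta,\psi)\in\mathcal C_{t_2}$ put $$I_{t_1,t_2}(\zeta,\psi)=\inf_{\varphi\in\mathcal S_{t_2}(\zeta,\psi)}\ \sum_{k\ge0}\int_{[t_1,t_2]\times[0,1]}\ell(\varphi_k(s,y))\,ds\,dy .$$ Let $\mathcal J^0_{t_1,t_2}(x,x')$ be the set of $(\zeta,\psi)\in\mathcal C_{t_2}$ with $\zeta(t_1)=x$ and $\zeta(t_2)=x'$; let $\mathcal J^2_{t_1,t_2}(x,x')$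 be the set of those $(\zeta,\psi)\in\mathcal J^0_{t_1,t_2}(x,x')$ for which also $\psi(t)\ge\psi(t_1)-x_0$ for all $t\in(t_1,t_2)$ and $\frac{d}{dt}r(\zeta(t))=-2$ for a.e. $t\in(t_1,t_2)$; and let $I^2_{t_1,t_2}(x,x')=\inf_{(\zeta,\psi)\in\mathcal J^2_{t_1,t_2}(x,x')}I_{t_1,t_2}(\zeta,\psi)$. For $x\in\mathbb R_+^\infty$ and $b=(b_k)_{k\ge0}$ with $b_k\le0$ for $k\ge1$ let $$L(x,b)=\sum_{k\ge0}\nu(k|b)\log\frac{\nu(k|b)}{\mu(k|x)}\ \text{ if }\ \sum_{k\ge1}b_k\ge-1,\qquad L(x,b)=\infty\ \text{ otherwise},$$ where $\nu(0|b)=1+\sum_{k\ge1}b_k$, $\nu(k|b)=-b_k$ for $k\ge1$, $\mu(k|x)=r_k(x)$ if $x\ne0$, and $\mu(k|0)=1_{\{k=0\}}$. **Setting.** Let $x^{(i)}=(x^{(i)}_0,p^{(i)})$, $i=1,2$, with $x_0^{(i)}\ge0$ and $0\le p^{(2)}\le p^{(1)}\le p$ coordinatewise; put $z=x^{(1)}-x^{(2)}$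 and $\varsigma=\frac12\big(r(x^{(1)})-r(x^{(2)})\big)$. Suppose that $\varsigma\ge0$ and $\sum_{k\ge1}kz_k+z_0>2\sum_{k\ge1}z_k$. Let $t_1\ge0$ and let $(\zeta^*,\psi^*)\in\mathcal J^0_{0,t_1}\big((0,p),x^{(1)}\big)$ with $I_{0,t_1}(\zeta^*,\psi^*)<\infty$. **Claim.** Let $\beta=0$ if $x_0^{(2)}=0$ and $z_1=0$. If $x_0^{(2)}>0$ or $z_1>0$, then there is a unique $\beta\in(0,1)$ with $$\sum_{k\ge1}kz_k=(1-\beta^2)\sum_{k\ge1}\frac{kz_k}{1-\beta^k}+x_0^{(2)}-\beta^2x_0^{(1)},$$ and $\beta$ denotes this number. Put $\tilde\varsigma=\varsigma/(1-\beta^2)$ and $\tilde z_k=z_k/(1-\beta^k)$ for $k\ge 1$. Define $(\tilde\zeta,\tilde\psi)=(\zeta^*,\psi^*)$ on $[0,t_1]$ and, for $t\in[t_1,t_1+\varsigma]$, $$\tilde\zeta_k(t)=p^{(1)}_k-\tilde z_k\Big[1-\Big(1-\frac{t-t_1}{\tilde\varsigma}\Big)^{k/2}\Big]\quad(k\ge1),$$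 $$\tilde\zeta_0(t)=x^{(1)}_0+\sum_{k\ge1}k\big(p^{(1)}_k-\tilde\zeta_k(t)\big)-2(t-t_1),\qquad \tilde\psi(t)=\psi^*(t_1)+\sum_{k\ge1}k\big(p^{(1)}_k-\tilde\zeta_k(t)\big)-2(t-t_1).$$ Then $(\tilde\zeta,\tilde\psi)\in\mathcal J^2_{t_1,t_1+\varsigma}(x^{(1)},x^{(2)})$ and $$I^2_{t_1,t_1+\varsigma}(x^{(1)},x^{(2)})=\inf_{(\zeta,\psi)\in\mathcal J^2_{t_1,t_1+\varsigma}(x^{(1)},x^{(2)})}\int_{t_1}^{t_1+\varsigma}L(\zeta(s),\zeta'(s))\,ds=\int_{t_1}^{t_1+\varsigma}L(\tilde\zeta(s),\tilde\zeta'(s))\,ds .$$ -/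

import Mathlib

open Set MeasureTheory
open scoped NNReal ENNReal

noncomputable section

namespace ConfigModel

/-- States are sequences `x = (x₀, x₁, x₂, …)`. This is `r(x) = x₀⁺ + ∑_{k ≥ 1} k x_k`
(the `k = 0` term of the series vanishes). -/
def r (x : ℕ → ℝ) : ℝ := max (x 0) 0 + ∑' k : ℕ, (k : ℝ) * x k

open Classical in
/-- `r₀(x) = x₀⁺ / r(x)` and `r_k(x) = k x_k / r(x)` for `k ≥ 1` if `0 < r(x) < ∞`,
and `0` otherwise. -/
def rk (x : ℕ → ℝ) (k : ℕ) : ℝ :=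
  if Summable (fun j : ℕ => (j : ℝ) * x j) ∧ 0 < r x then
    (if k = 0 then max (x 0) 0 else (k : ℝ) * x k) / r x
  else 0

/-- The one-dimensional Skorokhod map `Γ(ψ)(t) = ψ(t) - (inf_{0 ≤ s ≤ t} ψ(s)) ∧ 0`. -/
def skorokhod (ψ : ℝ → ℝ) (t : ℝ) : ℝ := ψ t - min (sInf (ψ '' Icc 0 t)) 0

/-- The set `𝒞_T` of admissible pairs `(ζ, ψ)` on `[0, T]`. The values of the functions outside
`[0, T]` are irrelevant. -/
structure Admissible (p : ℕ → ℝ) (T : ℝ) (ζ : ℝ → ℕ → ℝ) (ψ : ℝ → ℝ) : Prop where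
  cont_ζ : ContinuousOn ζ (Icc 0 T)
  cont_ψ : ContinuousOn ψ (Icc 0 T)
  ψ_zero : ψ 0 = 0
  ψ_ac : AbsolutelyContinuousOnInterval ψ 0 T
  ζ_refl : ∀ t ∈ Icc 0 T, ζ t 0 = skorokhod ψ t
  ζ_init : ∀ k : ℕ, 1 ≤ k → ζ 0 k = p k
  ζ_anti : ∀ k : ℕ, 1 ≤ k → AntitoneOn (fun t => ζ t k) (Icc 0 T)
  ζ_ac : ∀ k : ℕ, 1 ≤ k → AbsolutelyContinuousOnInterval (fun t => ζ t k) 0 T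
  ζ_nonneg : ∀ k : ℕ, 1 ≤ k → ∀ t ∈ Icc 0 T, 0 ≤ ζ t k

/-- `∫_{[0,t] × [0,1]} 1_{[0, r_k(ζ(s)))}(y) φ_k(s, y) ds dy`. -/
def flow (ζ : ℝ → ℕ → ℝ) (φ : ℕ → ℝ × ℝ → ℝ≥0) (k : ℕ) (t : ℝ) : ℝ≥0∞ :=
  ∫⁻ q in Icc (0 : ℝ) t ×ˢ Icc (0 : ℝ) 1,
    {q : ℝ × ℝ | q.2 < rk (ζ q.1) k}.indicator (fun q => (φ k q : ℝ≥0∞)) q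

/-- The set `𝒮_T(ζ, ψ)` of controls `φ = (φ_k)_{k ≥ 0}` that drive the pair `(ζ, ψ)` on
`[0, T]`. -/
structure IsControl (p : ℕ → ℝ) (T : ℝ) (ζ : ℝ → ℕ → ℝ) (ψ : ℝ → ℝ)
    (φ : ℕ → ℝ × ℝ → ℝ≥0) : Prop where
  meas : ∀ k, Measurable (φ k)
  finite : ∀ k, ∀ t ∈ Icc 0 T, flow ζ φ k t ≠ ⊤
  eq_ψ : ∀ t ∈ Icc 0 T, HasSum (fun k : ℕ => ((k : ℝ) - 2) * (flow ζ φ k t).toReal) (ψ t)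
  eq_ζ : ∀ k : ℕ, 1 ≤ k → ∀ t ∈ Icc 0 T, ζ t k = p k - (flow ζ φ k t).toReal

/-- `ℓ(x) = x log x - x + 1`, with `0 log 0 = 0`. -/
def ell (x : ℝ) : ℝ := x * Real.log x - x + 1

/-- `∑_{k ≥ 0} ∫_{[t₁,t₂] × [0,1]} ℓ(φ_k(s, y)) ds dy`; note that `ℓ ≥ 0` on `[0, ∞)`. -/
def controlCost (t₁ t₂ : ℝ) (φ : ℕ → ℝ × ℝ → ℝ≥0) : ℝ≥0∞ :=
  ∑' k : ℕ, ∫⁻ q in Icc t₁ t₂ ×ˢ Icc (0 : ℝ) 1, ENNReal.ofReal (ell (φ k q))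

/-- `I_{t₁,t₂}(ζ, ψ)`, the infimum of the cost over `𝒮_{t₂}(ζ, ψ)` (`∞` if that set is empty). -/
def pathCost (p : ℕ → ℝ) (t₁ t₂ : ℝ) (ζ : ℝ → ℕ → ℝ) (ψ : ℝ → ℝ) : ℝ≥0∞ :=
  ⨅ (φ : ℕ → ℝ × ℝ → ℝ≥0) (_ : IsControl p t₂ ζ ψ φ), controlCost t₁ t₂ φ

/-- `𝒥⁰_{t₁,t₂}(x₁, x₂)`. -/
def J0 (p : ℕ → ℝ) (t₁ t₂ : ℝ) (x₁ x₂ : ℕ → ℝ) : Set ((ℝ → ℕ → ℝ) × (ℝ → ℝ)) :=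
  {w | Admissible p t₂ w.1 w.2 ∧ w.1 t₁ = x₁ ∧ w.1 t₂ = x₂}

/-- `𝒥¹_{t₁,t₂}(x₁, x₂)`. -/
def J1 (p : ℕ → ℝ) (t₁ t₂ : ℝ) (x₁ x₂ : ℕ → ℝ) : Set ((ℝ → ℕ → ℝ) × (ℝ → ℝ)) :=
  {w | w ∈ J0 p t₁ t₂ x₁ x₂ ∧ ∀ t ∈ Ioo t₁ t₂, w.2 t₁ - x₁ 0 ≤ w.2 t}

/-- `𝒥²_{t₁,t₂}(x₁, x₂)`. -/
def J2 (p : ℕ → ℝ) (t₁ t₂ : ℝ) (x₁ x₂ : ℕ → ℝ) : Set ((ℝ → ℕ → ℝ) × (ℝ → ℝ)) :=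
  {w | w ∈ J1 p t₁ t₂ x₁ x₂ ∧
    ∀ᵐ t : ℝ, t ∈ Ioo t₁ t₂ → HasDerivAt (fun s => r (w.1 s)) (-2) t}

/-- `I²_{t₁,t₂}(x₁, x₂)`. -/
def I2 (p : ℕ → ℝ) (t₁ t₂ : ℝ) (x₁ x₂ : ℕ → ℝ) : ℝ≥0∞ :=
  ⨅ w ∈ J2 p t₁ t₂ x₁ x₂, pathCost p t₁ t₂ w.1 w.2

/-- `a log (a / b)` with the conventions `0 log (0 / b) = 0` and `a log (a / 0) = ∞`, `a > 0`. -/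
def logTerm (a b : ℝ) : EReal :=
  if a = 0 then 0 else if b = 0 then ⊤ else ((a * Real.log (a / b) : ℝ) : EReal)

/-- `ν(0|b) = 1 + ∑_{k ≥ 1} b_k`, `ν(k|b) = -b_k` for `k ≥ 1`. -/
def nu (b : ℕ → ℝ) (k : ℕ) : ℝ := if k = 0 then 1 + ∑' j : ℕ, b (j + 1) else -b k

open Classical in
/-- `μ(·|x) = r_·(x)` for `x ≠ 0`, and the unit mass at `0` for `x = 0`. -/
def mu (x : ℕ → ℝ) (k : ℕ) : ℝ := if x = 0 then (if k = 0 then 1 else 0) else rk x k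

/-- The sum of an extended real series as the sum of the positive parts minus the sum of the
negative parts. -/
def esum (f : ℕ → EReal) : EReal :=
  ((∑' k, (f k).toENNReal : ℝ≥0∞) : EReal) - ((∑' k, (-f k).toENNReal : ℝ≥0∞) : EReal)

/-- The integral over `[a, b]` of an extended real function as the integral of the positive part
minus the integral of the negative part. -/
def eint (a b : ℝ) (f : ℝ → EReal) : EReal :=
  ((∫⁻ s in Icc a b, (f s).toENNReal : ℝ≥0∞) : EReal) -
    ((∫⁻ s in Icc a b, (-f s).toENNReal : ℝ≥0∞) : EReal)

open Classical in
/-- The local cost `L(x, b) = ∑_{k ≥ 0} ν(k|b) log (ν(k|b) / μ(k|x))` if `b_k ≤ 0` for `k ≥ 1`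
and `∑_{k ≥ 1} b_k ≥ -1`, and `∞` otherwise. -/
def L (x b : ℕ → ℝ) : EReal :=
  if (∀ k : ℕ, 1 ≤ k → b k ≤ 0) ∧ Summable (fun k : ℕ => b (k + 1)) ∧
      -1 ≤ ∑' k : ℕ, b (k + 1) then
    esum (fun k => logTerm (nu b k) (mu x k))
  else ⊤

/-- `∫_{t₁}^{t₂} L(ζ(s), ζ'(s)) ds`. -/
def LCost (t₁ t₂ : ℝ) (ζ : ℝ → ℕ → ℝ) : EReal :=
  eint t₁ t₂ (fun s => L (ζ s) (fun k => deriv (fun u => ζ u k) s))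

/-- `ς(x₁, x₂) = (r(x₁) - r(x₂)) / 2`. -/
def varsig (x₁ x₂ : ℕ → ℝ) : ℝ := (r x₁ - r x₂) / 2

/-- `β` is the parameter attached to `(x₁, x₂)`: with `z = x₁ - x₂`, it is `0` if
`x₂(0) = 0` and `z₁ = 0`, and a solution in `(0, 1)` of
`∑ k z_k = (1 - β²) ∑ k z_k / (1 - β^k) + x₂(0) - β² x₁(0)` if `x₂(0) > 0` or `z₁ > 0`. -/
def IsBeta (x₁ x₂ : ℕ → ℝ) (β : ℝ) : Prop :=
  (x₂ 0 = 0 ∧ x₁ 1 - x₂ 1 = 0 ∧ β = 0) ∨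
  ((0 < x₂ 0 ∨ 0 < x₁ 1 - x₂ 1) ∧ β ∈ Ioo (0 : ℝ) 1 ∧
    ∑' k : ℕ, ((k : ℝ) + 1) * (x₁ (k + 1) - x₂ (k + 1)) =
      (1 - β ^ 2) *
          ∑' k : ℕ, ((k : ℝ) + 1) * (x₁ (k + 1) - x₂ (k + 1)) / (1 - β ^ (k + 1))
        + x₂ 0 - β ^ 2 * x₁ 0)

/-- `p_k^{(1)} - z̃_k [1 - (1 - (t - t₁) / ς̃)^{k/2}]` for `k ≥ 1`, where `ς̃ = ς / (1 - β²)` and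
`z̃_k = z_k / (1 - β^k)`. -/
def tildeCoord (t₁ : ℝ) (x₁ x₂ : ℕ → ℝ) (β : ℝ) (t : ℝ) (k : ℕ) : ℝ :=
  x₁ k - (x₁ k - x₂ k) / (1 - β ^ k) *
    (1 - (1 - (t - t₁) / (varsig x₁ x₂ / (1 - β ^ 2))) ^ ((k : ℝ) / 2))

/-- `∑_{k ≥ 1} k (p_k^{(1)} - ζ̃_k(t)) - 2 (t - t₁)`. -/
def tildeIncr (t₁ : ℝ) (x₁ x₂ : ℕ → ℝ) (β : ℝ) (t : ℝ) : ℝ :=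
  (∑' k : ℕ, ((k : ℝ) + 1) * (x₁ (k + 1) - tildeCoord t₁ x₁ x₂ β t (k + 1))) - 2 * (t - t₁)

/-- The candidate path `ζ̃`: it follows `ζs` up to time `t₁` and the explicit formulas after. -/
def tildeζ (t₁ : ℝ) (x₁ x₂ : ℕ → ℝ) (β : ℝ) (ζs : ℝ → ℕ → ℝ) (t : ℝ) (k : ℕ) : ℝ :=
  if t ≤ t₁ then ζs t k
  else if k = 0 then x₁ 0 + tildeIncr t₁ x₁ x₂ β t
  else tildeCoord t₁ x₁ x₂ β t k

/-- The companion `ψ̃` of the candidate path. -/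
def tildeψ (t₁ : ℝ) (x₁ x₂ : ℕ → ℝ) (β : ℝ) (ψs : ℝ → ℝ) (t : ℝ) : ℝ :=
  if t ≤ t₁ then ψs t else ψs t₁ + tildeIncr t₁ x₁ x₂ β t

end ConfigModel

end

open ConfigModel

noncomputable section

namespace ConfigModel

/-! Along a path in `J2` the mass `r(ζ(t))` is absolutely continuous with slope -2, so it equals `r
x₁ - 2 (t - t₁)`, the same function for every competitor. Equivalently, `∑ k (x₁ k - ζ t k) = ζ t 0
- x₁ 0 + 2 (t - t₁)`. This identity forces the total jump rate of any control to be 1. The rates are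
therefore the probability vector `ν(·|ζ')`, and Jensen's inequality bounds the control cost below by
the integral of relative entropies `L` (`LCost_le_pathCost`). For the explicit path the bound is
attained by the control equal to `ν_k / r_k` below height `r_k` and to 1, which costs nothing, above
it (`pathCost_tilde_le`). It remains to minimise `∫ L`.

The minimisation is a calibration argument. Write `w = 1 - (t - t₁)/ς̃` and `κ = r/(2 ς̃ w)`. Each
entropy term satisfies `ν log(ν/r) - ν + r ≥ ν log θ - θ r + r` for every `θ > 0`, with equality at
`θ = ν/r`. For a competitor `ζ` take `θ_0 = κ` and `θ_k = κ w^(k/2) z̃_k / ζ_k`; along the explicit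
path these are its own ratios `ν_k / r_k`. Three things make the sum of the tangent bounds
path-independent up to boundary terms: - `θ_k r_k` for `k ≥ 1` is the rate of the explicit path,
hence does not involve `ζ`; - `ν_k log ζ_k` is an exact differential, with primitive `-(ζ_k log ζ_k
- ζ_k)`; - `∑ (k/2) ν_k log w`, integrated by parts, reduces through the mass identity to the zeroth
coordinate, and the resulting integral of `ζ_0/(2 ς̃ w)` cancels `θ_0 r_0`.

The bounds are integrated only up to `s < t₁ + ς`, because `log w` blows up at the end when `β = 0`.
The two actions then differ by boundary terms at `s` (`hasSum_action_sub`) that tend to 0, since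
both paths end at `x₂`; for `β = 0` the zeroth coordinates are `O(w)` and `w log w → 0`.

The equation for `β` says that the closed form for the zeroth coordinate starts at `x₁ 0`. Divided
by `β`, it becomes a decreasing equation, which gives existence and uniqueness. Admissibility of the
explicit path rests on `expl_zero_nonneg`, a concavity argument in the variable `√w`. -/

/-! ### The equation for `β` -/

/-- The finite geometric sum `1 + x + ⋯ + x ^ (m - 1)`. -/
def geom (m : ℕ) (x : ℝ) : ℝ := ∑ i ∈ Finset.range m, x ^ i

theorem mul_geom (m : ℕ) (x : ℝ) : (1 - x) * geom m x = 1 - x ^ m := mul_neg_geom_sum x m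

theorem one_le_geom_succ (m : ℕ) {x : ℝ} (hx : 0 ≤ x) : 1 ≤ geom (m + 1) x := by
  unfold geom
  rw [Finset.sum_range_succ']
  have : 0 ≤ ∑ i ∈ Finset.range m, x ^ (i + 1) := Finset.sum_nonneg fun i _ => by positivity
  simpa using this

theorem geom_succ_pos (m : ℕ) {x : ℝ} (hx : 0 ≤ x) : 0 < geom (m + 1) x :=
  lt_of_lt_of_le one_pos (one_le_geom_succ m hx)

/-- Pairing the `i`-th power with its mirror image makes the later comparison of ratios hold term by
term. -/
theorem two_mul_geom_succ (m : ℕ) (x : ℝ) :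
    2 * geom (m + 1) x = ∑ i ∈ Finset.range (m + 1), (x ^ i + x ^ (m - i)) := by
  rw [Finset.sum_add_distrib, Finset.sum_range_succ_comm (fun i => x ^ (m - i)), two_mul]
  congr 1
  have := Finset.sum_range_reflect (fun i => x ^ i) (m + 1)
  unfold geom
  rw [← this, Finset.sum_range_succ_comm]
  simp

/-- With `j = m - i`, the right side minus the left is `(b^i - a^i)(1 - (ab)^j) + (b^j - a^j)(1 -
(ab)^i)`. -/
theorem geom_cross_term {a b : ℝ} (ha : 0 ≤ a) (hab : a ≤ b) (hb : b ≤ 1) {m i : ℕ}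
    (hi : i ≤ m) :
    (a ^ i + a ^ (m - i)) * (1 + b ^ m) ≤ (b ^ i + b ^ (m - i)) * (1 + a ^ m) := by
  obtain ⟨j, rfl⟩ := Nat.exists_eq_add_of_le hi
  rw [Nat.add_sub_cancel_left]
  have h1 : a ^ i ≤ b ^ i := by gcongr
  have h2 : a ^ j ≤ b ^ j := by gcongr
  have hab' : a * b ≤ 1 := mul_le_one₀ (hab.trans hb) (ha.trans hab) hb
  have h3 : (a * b) ^ i ≤ 1 := pow_le_one₀ (mul_nonneg ha (ha.trans hab)) hab'
  have h4 : (a * b) ^ j ≤ 1 := pow_le_one₀ (mul_nonneg ha (ha.trans hab)) hab'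
  have := mul_nonneg (sub_nonneg.2 h1) (sub_nonneg.2 h4)
  have := mul_nonneg (sub_nonneg.2 h2) (sub_nonneg.2 h3)
  simp only [mul_pow, pow_add] at *
  nlinarith

theorem geom_cross_term_lt {a b : ℝ} (ha : 0 ≤ a) (hab : a < b) (hb : b < 1) {m : ℕ}
    (hm : 2 ≤ m) :
    (a ^ 1 + a ^ (m - 1)) * (1 + b ^ m) < (b ^ 1 + b ^ (m - 1)) * (1 + a ^ m) := by
  obtain ⟨j, rfl⟩ := Nat.exists_eq_add_of_le (show 1 ≤ m by omega)
  rw [Nat.add_sub_cancel_left]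
  have h2 : a ^ j ≤ b ^ j := by gcongr
  have hab' : a * b < 1 := mul_lt_one_of_nonneg_of_lt_one_left ha (hab.trans hb) hb.le
  have h4 : (a * b) ^ j < 1 := pow_lt_one₀ (mul_nonneg ha (ha.trans hab.le)) hab' (by omega)
  have := mul_pos (sub_pos.2 hab) (sub_pos.2 h4)
  have := mul_nonneg (sub_nonneg.2 h2) (sub_nonneg.2 hab'.le)
  simp only [mul_pow, pow_add, pow_one] at *
  nlinarith

/-- The ratio `(1 + x ^ m) / (1 + x + ⋯ + x ^ m)`. -/
def endRatio (m : ℕ) (x : ℝ) : ℝ := (1 + x ^ m) / geom (m + 1) x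

theorem endRatio_antitone {a b : ℝ} (ha : 0 ≤ a) (hab : a ≤ b) (hb : b ≤ 1) (m : ℕ) :
    endRatio m b ≤ endRatio m a := by
  unfold endRatio
  rw [div_le_div_iff₀ (geom_succ_pos m (ha.trans hab)) (geom_succ_pos m ha)]
  have h := two_mul_geom_succ m a
  have h' := two_mul_geom_succ m b
  have : (2 * geom (m + 1) a) * (1 + b ^ m) ≤ (2 * geom (m + 1) b) * (1 + a ^ m) := by
    rw [h, h', Finset.sum_mul, Finset.sum_mul]
    exact Finset.sum_le_sum fun i hi =>
      geom_cross_term ha hab hb (Nat.lt_succ_iff.1 (Finset.mem_range.1 hi))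
  nlinarith

theorem endRatio_strictAnti {a b : ℝ} (ha : 0 ≤ a) (hab : a < b) (hb : b < 1) {m : ℕ}
    (hm : 2 ≤ m) : endRatio m b < endRatio m a := by
  unfold endRatio
  rw [div_lt_div_iff₀ (geom_succ_pos m (ha.trans hab.le)) (geom_succ_pos m ha)]
  have h := two_mul_geom_succ m a
  have h' := two_mul_geom_succ m b
  have : (2 * geom (m + 1) a) * (1 + b ^ m) < (2 * geom (m + 1) b) * (1 + a ^ m) := by
    rw [h, h', Finset.sum_mul, Finset.sum_mul]
    exact Finset.sum_lt_sum (fun i hi =>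
      geom_cross_term ha hab.le hb.le (Nat.lt_succ_iff.1 (Finset.mem_range.1 hi)))
      ⟨1, Finset.mem_range.2 (by omega), geom_cross_term_lt ha hab hb hm⟩
  nlinarith

theorem endRatio_zero_right (m : ℕ) : endRatio m 0 = if m = 0 then 2 else 1 := by
  have : geom (m + 1) 0 = 1 := by simp [geom, Finset.sum_range_succ']
  unfold endRatio
  rw [this]
  split_ifs with h
  · subst h; norm_num
  · simp [h]

theorem endRatio_one_right (m : ℕ) : endRatio m 1 = 2 / ((m : ℝ) + 1) := by
  simp [endRatio, geom]; norm_num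

theorem continuousOn_endRatio (m : ℕ) : ContinuousOn (endRatio m) (Icc 0 1) := by
  unfold endRatio geom
  refine ContinuousOn.div (by fun_prop) (by fun_prop) fun x hx => ?_
  exact (geom_succ_pos m hx.1).ne'

theorem abs_endRatio_sub_one_le (m : ℕ) {x : ℝ} (hx : x ∈ Icc (0 : ℝ) 1) :
    |endRatio m x - 1| ≤ 1 := by
  have h1 := endRatio_antitone le_rfl hx.1 hx.2 m
  rw [endRatio_zero_right] at h1
  have h0 : 0 ≤ endRatio m x :=
    div_nonneg (add_nonneg zero_le_one (pow_nonneg hx.1 m)) (geom_succ_pos m hx.1).le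
  rw [abs_le]
  split_ifs at h1 <;> constructor <;> linarith

/-- `(1 - x²) / (1 - x^{m+1})` in terms of `endRatio`. -/
theorem one_sub_sq_div {x : ℝ} (hx : x ∈ Ico (0 : ℝ) 1) (m : ℕ) :
    (1 - x ^ 2) / (1 - x ^ (m + 1)) = 1 + x * (endRatio m x - 1) := by
  have hg := geom_succ_pos m hx.1
  have h1 : 0 < 1 - x := sub_pos.2 hx.2
  have h := mul_geom (m + 1) x
  unfold endRatio
  rw [← h, div_eq_iff (by positivity)]
  field_simp
  rw [pow_succ] at h
  nlinarith

/-- The series `∑ (m + 1) a_m (endRatio m x - 1)`. -/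
def betaSeries (a : ℕ → ℝ) (x : ℝ) : ℝ := ∑' m : ℕ, ((m : ℝ) + 1) * a m * (endRatio m x - 1)

section Beta

variable {a : ℕ → ℝ} {X₁ X₂ : ℝ}

theorem summable_betaSeries (ha : ∀ m, 0 ≤ a m) (hs : Summable fun m : ℕ => ((m : ℝ) + 1) * a m)
    {x : ℝ} (hx : x ∈ Icc (0 : ℝ) 1) :
    Summable fun m : ℕ => ((m : ℝ) + 1) * a m * (endRatio m x - 1) := by
  refine hs.of_norm_bounded fun m => ?_
  have h0 : 0 ≤ ((m : ℝ) + 1) * a m := mul_nonneg (by positivity) (ha m)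
  rw [norm_mul, Real.norm_of_nonneg h0, Real.norm_eq_abs]
  exact mul_le_of_le_one_right h0 (abs_endRatio_sub_one_le m hx)

theorem continuousOn_betaSeries (ha : ∀ m, 0 ≤ a m)
    (hs : Summable fun m : ℕ => ((m : ℝ) + 1) * a m) :
    ContinuousOn (betaSeries a) (Icc 0 1) := by
  refine continuousOn_tsum (fun m => ?_) hs fun m x hx => ?_
  · exact continuousOn_const.mul ((continuousOn_endRatio m).sub continuousOn_const)
  · have h0 : 0 ≤ ((m : ℝ) + 1) * a m := mul_nonneg (by positivity) (ha m)
    rw [norm_mul, Real.norm_of_nonneg h0, Real.norm_eq_abs]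
    exact mul_le_of_le_one_right h0 (abs_endRatio_sub_one_le m hx)

theorem betaSeries_zero : betaSeries a 0 = a 0 := by
  unfold betaSeries
  rw [tsum_eq_single 0]
  · rw [endRatio_zero_right]; norm_num
  · intro m hm
    rw [endRatio_zero_right]; simp [hm]

theorem summable_of_summable_mul (ha : ∀ m, 0 ≤ a m)
    (hs : Summable fun m : ℕ => ((m : ℝ) + 1) * a m) : Summable a := by
  refine hs.of_nonneg_of_le ha fun m => ?_
  exact le_mul_of_one_le_left (ha m) (by linarith [Nat.cast_nonneg (α := ℝ) m])

theorem betaSeries_one (ha : ∀ m, 0 ≤ a m) (hs : Summable fun m : ℕ => ((m : ℝ) + 1) * a m) :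
    betaSeries a 1 = 2 * ∑' m, a m - ∑' m : ℕ, ((m : ℝ) + 1) * a m := by
  rw [← tsum_mul_left, ← ((summable_of_summable_mul ha hs).mul_left 2).tsum_sub hs]
  refine tsum_congr fun m => ?_
  rw [endRatio_one_right]
  field_simp

/-- The equation for `β`, rewritten. -/
theorem beta_equation_iff (ha : ∀ m, 0 ≤ a m) (hs : Summable fun m : ℕ => ((m : ℝ) + 1) * a m)
    {x : ℝ} (hx : x ∈ Ico (0 : ℝ) 1) :
    (∑' m : ℕ, ((m : ℝ) + 1) * a m =
      (1 - x ^ 2) * ∑' m : ℕ, ((m : ℝ) + 1) * a m / (1 - x ^ (m + 1)) + X₂ - x ^ 2 * X₁) ↔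
    X₂ + x * betaSeries a x - x ^ 2 * X₁ = 0 := by
  have : (1 - x ^ 2) * ∑' m : ℕ, ((m : ℝ) + 1) * a m / (1 - x ^ (m + 1)) =
      ∑' m : ℕ, ((m : ℝ) + 1) * a m + x * betaSeries a x := by
    unfold betaSeries
    rw [← tsum_mul_left, ← tsum_mul_left,
      ← hs.tsum_add ((summable_betaSeries ha hs ⟨hx.1, hx.2.le⟩).mul_left x)]
    refine tsum_congr fun m => ?_
    rw [mul_div_assoc', mul_comm (1 - x ^ 2), mul_div_assoc, one_sub_sq_div hx]
    ring
  rw [this]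
  constructor <;> intro h <;> linarith

/-- Intermediate values: at 1 the expression is `2 ∑ a - ∑ (m+1) a - (X₁ - X₂)`, negative by
assumption; near 0 it is positive because `X₂ > 0` or `a 0 > 0`. -/
theorem exists_beta (ha : ∀ m, 0 ≤ a m) (hs : Summable fun m : ℕ => ((m : ℝ) + 1) * a m)
    (hX₂ : 0 ≤ X₂) (hlt : 2 * ∑' m, a m < ∑' m : ℕ, ((m : ℝ) + 1) * a m + (X₁ - X₂))
    (hpos : 0 < X₂ ∨ 0 < a 0) :
    ∃ x ∈ Ioo (0 : ℝ) 1, X₂ + x * betaSeries a x - x ^ 2 * X₁ = 0 := by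
  have hc := continuousOn_betaSeries ha hs
  have h1 := betaSeries_one ha hs
  -- For `X₂ = 0` the expression vanishes at 0, so the factor `x` is divided out first; the quotient
  -- has value `a 0 > 0` there.
  rcases hX₂.eq_or_lt with h | h
  · have ha0 : 0 < a 0 := hpos.resolve_left (by simp [← h])
    have hF : ContinuousOn (fun x => betaSeries a x - x * X₁) (Icc 0 1) := by fun_prop
    obtain ⟨x, hx, hx0⟩ := intermediate_value_Ioo' zero_le_one hF
      (show (0 : ℝ) ∈ Ioo _ _ by simp only [betaSeries_zero, h1]; constructor <;> linarith)
    refine ⟨x, hx, ?_⟩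
    simp only at hx0
    rw [← h, show betaSeries a x = x * X₁ by linarith]
    ring
  · have hF : ContinuousOn (fun x => X₂ + x * betaSeries a x - x ^ 2 * X₁) (Icc 0 1) := by
      fun_prop
    obtain ⟨x, hx, hx0⟩ := intermediate_value_Ioo' zero_le_one hF
      (show (0 : ℝ) ∈ Ioo _ _ by simp only [h1]; constructor <;> linarith)
    exact ⟨x, hx, hx0⟩

theorem beta_unique_aux (ha : ∀ m, 0 ≤ a m) (hs : Summable fun m : ℕ => ((m : ℝ) + 1) * a m)
    (hX₁ : 0 ≤ X₁) (hX₂ : 0 ≤ X₂)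
    (hlt : 2 * ∑' m, a m < ∑' m : ℕ, ((m : ℝ) + 1) * a m + (X₁ - X₂))
    {x y : ℝ} (hx : x ∈ Ioo (0 : ℝ) 1) (hy : y ∈ Ioo (0 : ℝ) 1) (hxy : x < y)
    (ex : X₂ + x * betaSeries a x - x ^ 2 * X₁ = 0)
    (ey : X₂ + y * betaSeries a y - y ^ 2 * X₁ = 0) : False := by
  have hsx := summable_betaSeries ha hs (Ioo_subset_Icc_self hx)
  have hsy := summable_betaSeries ha hs (Ioo_subset_Icc_self hy)
  have hterm : ∀ m : ℕ, ((m : ℝ) + 1) * a m * (endRatio m y - 1) ≤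
      ((m : ℝ) + 1) * a m * (endRatio m x - 1) := fun m => by
    have h0 : 0 ≤ ((m : ℝ) + 1) * a m := mul_nonneg (by positivity) (ha m)
    have := endRatio_antitone hx.1.le hxy.le hy.2.le m
    gcongr
  have hle : betaSeries a y ≤ betaSeries a x := hsy.tsum_le_tsum hterm hsx
  -- Eliminating between the two equations leaves three nonnegative terms with sum zero, so each
  -- vanishes.
  have e : (y - x) * X₂ + x * y * (betaSeries a x - betaSeries a y) + x * y * (y - x) * X₁ = 0 := by
    linear_combination y * ex - x * ey
  have p0 : 0 < y - x := sub_pos.2 hxy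
  have p1 : 0 < x * y := mul_pos hx.1 hy.1
  have t1 : 0 ≤ (y - x) * X₂ := mul_nonneg p0.le hX₂
  have t2 : 0 ≤ x * y * (betaSeries a x - betaSeries a y) :=
    mul_nonneg p1.le (sub_nonneg.2 hle)
  have t3 : 0 ≤ x * y * (y - x) * X₁ := mul_nonneg (mul_pos p1 p0).le hX₁
  have e1 : X₁ = 0 := by
    have : x * y * (y - x) * X₁ = 0 := by linarith
    exact (mul_eq_zero.1 this).resolve_left (mul_pos p1 p0).ne'
  have e2 : X₂ = 0 := by
    have : (y - x) * X₂ = 0 := by linarith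
    exact (mul_eq_zero.1 this).resolve_left p0.ne'
  have e3 : betaSeries a x = betaSeries a y := by
    have : x * y * (betaSeries a x - betaSeries a y) = 0 := by linarith
    linarith [(mul_eq_zero.1 this).resolve_left p1.ne']
  -- `endRatio m` is constant for `m = 0, 1` and strictly decreasing for `m ≥ 2`, so only degrees 1
  -- and 2 survive; there `k z_k ≤ 2 z_k`, against the assumption.
  have hz : ∀ m, 2 ≤ m → a m = 0 := by
    intro m hm
    by_contra hne
    have hpos : 0 < a m := lt_of_le_of_ne (ha m) (Ne.symm hne)
    have hlt' : betaSeries a y < betaSeries a x := by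
      refine hsy.tsum_lt_tsum (i := m) hterm ?_ hsx
      have := endRatio_strictAnti hx.1.le hxy hy.2 hm
      have : 0 < ((m : ℝ) + 1) * a m := by positivity
      gcongr
    exact absurd e3 hlt'.ne'
  have : ∑' m : ℕ, ((m : ℝ) + 1) * a m ≤ 2 * ∑' m, a m := by
    rw [← tsum_mul_left]
    refine hs.tsum_le_tsum (fun m => ?_) ((summable_of_summable_mul ha hs).mul_left 2)
    rcases lt_or_ge m 2 with h | h
    · have : (m : ℝ) + 1 ≤ 2 := by exact_mod_cast h
      exact mul_le_mul_of_nonneg_right this (ha m)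
    · simp [hz m h]
  linarith

theorem beta_unique (ha : ∀ m, 0 ≤ a m) (hs : Summable fun m : ℕ => ((m : ℝ) + 1) * a m)
    (hX₁ : 0 ≤ X₁) (hX₂ : 0 ≤ X₂)
    (hlt : 2 * ∑' m, a m < ∑' m : ℕ, ((m : ℝ) + 1) * a m + (X₁ - X₂))
    {x y : ℝ} (hx : x ∈ Ioo (0 : ℝ) 1) (hy : y ∈ Ioo (0 : ℝ) 1)
    (ex : X₂ + x * betaSeries a x - x ^ 2 * X₁ = 0)
    (ey : X₂ + y * betaSeries a y - y ^ 2 * X₁ = 0) : x = y := by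
  rcases lt_trichotomy x y with h | h | h
  · exact (beta_unique_aux ha hs hX₁ hX₂ hlt hx hy h ex ey).elim
  · exact h
  · exact (beta_unique_aux ha hs hX₁ hX₂ hlt hy hx h ey ex).elim

end Beta

theorem existsUnique_isBeta {x₁ x₂ : ℕ → ℝ} (hx₁ : 0 ≤ x₁ 0) (hx₂ : 0 ≤ x₂ 0)
    (hle : ∀ k : ℕ, 1 ≤ k → x₂ k ≤ x₁ k)
    (hs : Summable fun k : ℕ => ((k : ℝ) + 1) * (x₁ (k + 1) - x₂ (k + 1)))
    (hlt : 2 * ∑' k : ℕ, (x₁ (k + 1) - x₂ (k + 1)) <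
      (∑' k : ℕ, ((k : ℝ) + 1) * (x₁ (k + 1) - x₂ (k + 1))) + (x₁ 0 - x₂ 0)) :
    ∃! β : ℝ, IsBeta x₁ x₂ β := by
  have ha : ∀ m : ℕ, 0 ≤ x₁ (m + 1) - x₂ (m + 1) := fun m => sub_nonneg.2 (hle _ (by omega))
  by_cases hpos : 0 < x₂ 0 ∨ 0 < x₁ 1 - x₂ 1
  · obtain ⟨β, hβ, e⟩ := exists_beta ha hs hx₂ hlt hpos
    have key : ∀ y, IsBeta x₁ x₂ y ↔ y ∈ Ioo (0 : ℝ) 1 ∧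
        x₂ 0 + y * betaSeries (fun m => x₁ (m + 1) - x₂ (m + 1)) y - y ^ 2 * x₁ 0 = 0 := by
      intro y
      constructor
      · rintro (⟨h1, h2, -⟩ | ⟨-, hy, h⟩)
        · rcases hpos with h | h <;> linarith
        · exact ⟨hy, (beta_equation_iff ha hs (Ioo_subset_Ico_self hy)).1 h⟩
      · rintro ⟨hy, h⟩
        exact Or.inr ⟨hpos, hy, (beta_equation_iff ha hs (Ioo_subset_Ico_self hy)).2 h⟩
    refine ⟨β, (key β).2 ⟨hβ, e⟩, fun y hy => ?_⟩
    obtain ⟨hy, hy'⟩ := (key y).1 hy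
    exact beta_unique ha hs hx₁ hx₂ hlt hy hβ hy' e
  · push Not at hpos
    have h1 : x₂ 0 = 0 := le_antisymm hpos.1 hx₂
    have h2 : x₁ 1 - x₂ 1 = 0 := le_antisymm hpos.2 (ha 0)
    refine ⟨0, Or.inl ⟨h1, h2, rfl⟩, ?_⟩
    rintro y (⟨-, -, h⟩ | ⟨h, -, -⟩)
    · exact h
    · rcases h with h | h <;> linarith

/-- In both cases of its definition, `β ∈ [0, 1)` solves the equation. -/
theorem IsBeta.equation {x₁ x₂ : ℕ → ℝ} {β : ℝ} (h : IsBeta x₁ x₂ β) :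
    β ∈ Ico (0 : ℝ) 1 ∧ ∑' k : ℕ, ((k : ℝ) + 1) * (x₁ (k + 1) - x₂ (k + 1)) =
      (1 - β ^ 2) *
          ∑' k : ℕ, ((k : ℝ) + 1) * (x₁ (k + 1) - x₂ (k + 1)) / (1 - β ^ (k + 1))
        + x₂ 0 - β ^ 2 * x₁ 0 := by
  rcases h with ⟨h1, -, rfl⟩ | ⟨-, h2, h3⟩
  · refine ⟨by simp, ?_⟩
    simp [h1]
  · exact ⟨Ioo_subset_Ico_self h2, h3⟩

/-! ### Relative entropy -/

/-- `a log (a / b) - a + b` as an extended nonnegative number. -/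
def klTerm (a b : ℝ) : ℝ≥0∞ :=
  if b = 0 then (if a = 0 then 0 else ⊤) else ENNReal.ofReal (a * Real.log (a / b) - a + b)

/-- The logarithm lies below its tangent at 1, applied to `θ b / a`. This family of bounds linear in
`a` and `b`, with a free parameter `θ`, drives both Jensen's inequality and the optimality proof. -/
theorem mul_log_div_tangent {a b θ : ℝ} (ha : 0 ≤ a) (hb : 0 < b) (hθ : 0 < θ) :
    a * Real.log θ - θ * b + b ≤ a * Real.log (a / b) - a + b := by
  rcases ha.eq_or_lt with rfl | ha
  · nlinarith [mul_pos hθ hb]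
  · have h := Real.log_le_sub_one_of_pos (show 0 < θ * b / a by positivity)
    rw [Real.log_div (by positivity) ha.ne', Real.log_mul hθ.ne' hb.ne'] at h
    rw [Real.log_div ha.ne' hb.ne']
    have := mul_le_mul_of_nonneg_left h ha.le
    have e : a * (θ * b / a - 1) = θ * b - a := by field_simp
    rw [e] at this
    linarith

theorem mul_log_div_nonneg {a b : ℝ} (ha : 0 ≤ a) (hb : 0 < b) :
    0 ≤ a * Real.log (a / b) - a + b := by
  have := mul_log_div_tangent ha hb one_pos
  simpa using this

theorem ofReal_tangent_le_klTerm {a b θ : ℝ} (ha : 0 ≤ a) (hb : 0 ≤ b) (hθ : 0 < θ) :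
    ENNReal.ofReal (a * Real.log θ - θ * b + b) ≤ klTerm a b := by
  unfold klTerm
  split_ifs with h1 h2
  · simp [h1, h2]
  · exact le_top
  · exact ENNReal.ofReal_le_ofReal
      (mul_log_div_tangent ha (lt_of_le_of_ne hb (Ne.symm h1)) hθ)

theorem klTerm_mul_left {b θ : ℝ} :
    klTerm (θ * b) b = ENNReal.ofReal (θ * b * Real.log θ - θ * b + b) := by
  unfold klTerm
  split_ifs with h1 h2
  · simp [h1]
  · simp [h1] at h2
  · rw [mul_div_cancel_right₀ _ h1]

theorem klTerm_zero_left {b : ℝ} : klTerm 0 b = ENNReal.ofReal b := by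
  unfold klTerm
  split_ifs with h h'
  · simp [h]
  · exact absurd rfl h'
  · simp

theorem measurable_klTerm : Measurable fun q : ℝ × ℝ => klTerm q.1 q.2 := by
  unfold klTerm
  refine Measurable.ite (measurableSet_eq_fun measurable_snd measurable_const) ?_ ?_
  · exact Measurable.ite (measurableSet_eq_fun measurable_fst measurable_const)
      measurable_const measurable_const
  · fun_prop

theorem logTerm_of_ne {a b : ℝ} (h : b = 0 → a = 0) :
    logTerm a b = ((a * Real.log (a / b) : ℝ) : EReal) := by
  unfold logTerm
  split_ifs with h1 h2
  · simp [h1]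
  · exact absurd (h h2) h1
  · rfl

theorem neg_logTerm_toENNReal_le {a b : ℝ} (ha : 0 ≤ a) (hb : 0 ≤ b) :
    (-logTerm a b).toENNReal ≤ ENNReal.ofReal b := by
  by_cases h : b = 0 → a = 0
  · rw [logTerm_of_ne h, ← EReal.coe_neg, EReal.toENNReal_of_ne_top (EReal.coe_ne_top _),
      EReal.toReal_coe]
    refine ENNReal.ofReal_le_ofReal ?_
    rcases hb.eq_or_lt with h0 | h0
    · simp [h h0.symm, ← h0]
    · linarith [mul_log_div_nonneg ha h0]
  · push Not at h
    simp [logTerm, h.1, h.2]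

/-- The identity `kl = log term - a + b` written without subtraction, so that it can be summed in
`ℝ≥0∞` even when terms are infinite. -/
theorem klTerm_add {a b : ℝ} (ha : 0 ≤ a) (hb : 0 ≤ b) :
    klTerm a b + (-logTerm a b).toENNReal + ENNReal.ofReal a =
      (logTerm a b).toENNReal + ENNReal.ofReal b := by
  by_cases h : b = 0 → a = 0
  · rw [logTerm_of_ne h, ← EReal.coe_neg, EReal.toENNReal_of_ne_top (EReal.coe_ne_top _),
      EReal.toENNReal_of_ne_top (EReal.coe_ne_top _), EReal.toReal_coe, EReal.toReal_coe]
    have hk : klTerm a b = ENNReal.ofReal (a * Real.log (a / b) - a + b) ∧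
        0 ≤ a * Real.log (a / b) - a + b := by
      rcases hb.eq_or_lt with h0 | h0
      · simp [klTerm, h h0.symm, ← h0]
      · exact ⟨by simp [klTerm, h0.ne'], mul_log_div_nonneg ha h0⟩
    rw [hk.1]
    set t := a * Real.log (a / b)
    rcases le_total 0 t with ht | ht
    · rw [ENNReal.ofReal_of_nonpos (neg_nonpos.2 ht), add_zero, ← ENNReal.ofReal_add hk.2 ha,
        ← ENNReal.ofReal_add ht hb]
      congr 1; ring
    · rw [ENNReal.ofReal_of_nonpos ht, zero_add, ← ENNReal.ofReal_add hk.2 (neg_nonneg.2 ht),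
        ← ENNReal.ofReal_add (add_nonneg hk.2 (neg_nonneg.2 ht)) ha]
      congr 1; ring
  · push Not at h
    simp [logTerm, klTerm, h.1, h.2]

/-- The relative entropy of two probability vectors, as a sum of nonnegative terms. -/
theorem esum_logTerm {ν μ : ℕ → ℝ} (hν : ∀ k, 0 ≤ ν k) (hμ : ∀ k, 0 ≤ μ k) (hν1 : HasSum ν 1)
    (hμ1 : HasSum μ 1) :
    esum (fun k => logTerm (ν k) (μ k)) = ((∑' k, klTerm (ν k) (μ k) : ℝ≥0∞) : EReal) := by
  have sν : ∑' k, ENNReal.ofReal (ν k) = 1 := by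
    rw [← ENNReal.ofReal_tsum_of_nonneg hν hν1.summable, hν1.tsum_eq, ENNReal.ofReal_one]
  have sμ : ∑' k, ENNReal.ofReal (μ k) = 1 := by
    rw [← ENNReal.ofReal_tsum_of_nonneg hμ hμ1.summable, hμ1.tsum_eq, ENNReal.ofReal_one]
  -- Both vectors have mass 1, so the corrections `-a + b` cancel after summation.
  have key : ∑' k, klTerm (ν k) (μ k) + ∑' k, (-logTerm (ν k) (μ k)).toENNReal + 1 =
      ∑' k, (logTerm (ν k) (μ k)).toENNReal + 1 := by
    nth_rewrite 1 [← sν]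
    rw [← sμ, ← ENNReal.tsum_add, ← ENNReal.tsum_add, ← ENNReal.tsum_add]
    exact tsum_congr fun k => klTerm_add (hν k) (hμ k)
  have key' := (ENNReal.add_left_inj ENNReal.one_ne_top).1 key
  have hfin : ∑' k, (-logTerm (ν k) (μ k)).toENNReal ≠ ⊤ := by
    refine ne_top_of_le_ne_top ENNReal.one_ne_top ?_
    rw [← sμ]
    exact ENNReal.tsum_le_tsum fun k => neg_logTerm_toENNReal_le (hν k) (hμ k)
  unfold esum
  lift ∑' k, (-logTerm (ν k) (μ k)).toENNReal to ℝ≥0 using hfin with n hn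
  rw [← key', EReal.coe_ennreal_add]
  exact EReal.add_sub_cancel_right (b := (n : ℝ))

/-! ### The local cost -/

theorem r_zero : r 0 = 0 := by simp [r]

theorem rk_eq {x : ℕ → ℝ} (h0 : 0 ≤ x 0) (hs : Summable fun j : ℕ => (j : ℝ) * x j)
    (hr : 0 < r x) (k : ℕ) : rk x k = (if k = 0 then x 0 else (k : ℝ) * x k) / r x := by
  simp [rk, hs, hr, h0]

theorem rk_nonneg {x : ℕ → ℝ} (hx : ∀ k, 1 ≤ k → 0 ≤ x k) (k : ℕ) : 0 ≤ rk x k := by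
  unfold rk
  split_ifs with h h'
  · exact div_nonneg (le_max_right _ _) h.2.le
  · exact div_nonneg (mul_nonneg (Nat.cast_nonneg k) (hx k (by omega))) h.2.le
  · exact le_rfl

theorem hasSum_rk {x : ℕ → ℝ} (hs : Summable fun j : ℕ => (j : ℝ) * x j)
    (hr : 0 < r x) : HasSum (rk x) 1 := by
  have h1 : HasSum (fun k : ℕ => if k = 0 then max (x 0) 0 else (k : ℝ) * x k) (r x) := by
    have := (hasSum_ite_eq (0 : ℕ) (max (x 0) 0)).add hs.hasSum
    refine this.congr_fun ?_
    intro k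
    by_cases hk : k = 0 <;> simp [hk]
  have h2 := h1.div_const (r x)
  rw [div_self hr.ne'] at h2
  refine h2.congr_fun ?_
  intro k
  simp [rk, hs, hr]

/-- The vector `b` is a velocity of finite total mass at most one. -/
def SubVelocity (b : ℕ → ℝ) : Prop := ∀ n, ∑ j ∈ Finset.range n, -b (j + 1) ≤ 1

theorem SubVelocity.summable {b : ℕ → ℝ} (hb : ∀ k : ℕ, 1 ≤ k → b k ≤ 0) (h : SubVelocity b) :
    Summable (fun k : ℕ => b (k + 1)) := by
  have : Summable (fun k : ℕ => -b (k + 1)) :=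
    summable_of_sum_range_le (fun k => neg_nonneg.2 (hb _ (by omega))) h
  simpa using this.neg

theorem SubVelocity.neg_one_le {b : ℕ → ℝ} (hb : ∀ k : ℕ, 1 ≤ k → b k ≤ 0)
    (h : SubVelocity b) : -1 ≤ ∑' k : ℕ, b (k + 1) := by
  have : ∑' k : ℕ, -b (k + 1) ≤ 1 := (h.summable hb).neg.tsum_le_of_sum_range_le h
  rw [tsum_neg] at this
  linarith

theorem subVelocity_of_neg_one_le {b : ℕ → ℝ} (hb : ∀ k : ℕ, 1 ≤ k → b k ≤ 0)
    (hs : Summable (fun k : ℕ => b (k + 1))) (h : -1 ≤ ∑' k : ℕ, b (k + 1)) : SubVelocity b := by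
  intro n
  refine (hs.neg.sum_le_tsum _ fun k _ => neg_nonneg.2 (hb _ (by omega))).trans ?_
  rw [tsum_neg]; linarith

theorem nu_nonneg {b : ℕ → ℝ} (hb : ∀ k : ℕ, 1 ≤ k → b k ≤ 0) (h : SubVelocity b) (k : ℕ) :
    0 ≤ nu b k := by
  unfold nu
  split_ifs with hk
  · linarith [h.neg_one_le hb]
  · exact neg_nonneg.2 (hb k (by omega))

theorem hasSum_nu {b : ℕ → ℝ} (hs : Summable fun k : ℕ => b (k + 1)) : HasSum (nu b) 1 := by
  rw [← hasSum_nat_add_iff' 1]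
  have := hs.hasSum.neg
  convert this using 1
  · ext k; simp [nu]
  · simp [nu]

theorem L_eq_tsum {x b : ℕ → ℝ} (hx : ∀ k, 1 ≤ k → 0 ≤ x k)
    (hs : Summable fun j : ℕ => (j : ℝ) * x j) (hr : 0 < r x)
    (hb : ∀ k : ℕ, 1 ≤ k → b k ≤ 0) (h : SubVelocity b) :
    L x b = ((∑' k, klTerm (nu b k) (rk x k) : ℝ≥0∞) : EReal) := by
  have hmu : mu x = rk x := by
    ext k
    have : x ≠ 0 := by rintro rfl; simp [r_zero] at hr
    simp [mu, this]
  unfold L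
  rw [if_pos ⟨hb, h.summable hb, h.neg_one_le hb⟩, hmu]
  exact esum_logTerm (nu_nonneg hb h) (rk_nonneg hx) (hasSum_nu (h.summable hb))
    (hasSum_rk hs hr)

/-- Bounded partial sums of nonnegative `-b k` encode both summability and the mass condition, so
failure of `SubVelocity` is failure of the condition in `L`. -/
theorem L_eq_top {x b : ℕ → ℝ} (h : ¬ SubVelocity b) : L x b = ⊤ := by
  unfold L
  refine if_neg fun h' => h ?_
  exact subVelocity_of_neg_one_le h'.1 h'.2.1 h'.2.2

/-! ### Absolutely continuous functions -/

section AbsolutelyContinuous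

open Filter Topology AbsolutelyContinuousOnInterval

theorem ac_congr {f g : ℝ → ℝ} {a b : ℝ} (hf : AbsolutelyContinuousOnInterval f a b)
    (h : EqOn f g (uIcc a b)) : AbsolutelyContinuousOnInterval g a b := by
  refine Tendsto.congr' ?_ hf
  filter_upwards [mem_inf_of_right (mem_principal_self _)] with E hE
  refine Finset.sum_congr rfl fun i hi => ?_
  rw [h (hE.1 i hi).1, h (hE.1 i hi).2]

theorem ac_comp_lipschitz {f F : ℝ → ℝ} {a b : ℝ} {s : Set ℝ} {K : ℝ≥0}
    (hf : AbsolutelyContinuousOnInterval f a b) (hF : LipschitzOnWith K F s)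
    (hs : MapsTo f (uIcc a b) s) : AbsolutelyContinuousOnInterval (fun t => F (f t)) a b := by
  have h0 : Tendsto (fun E : ℕ × (ℕ → ℝ × ℝ) =>
      (K : ℝ) * ∑ i ∈ Finset.range E.1, dist (f (E.2 i).1) (f (E.2 i).2))
      (totalLengthFilter ⊓ 𝓟 (disjWithin a b)) (𝓝 0) := by
    simpa using Tendsto.const_mul (K : ℝ) hf
  refine squeeze_zero' ?_ ?_ h0
  · exact Eventually.of_forall fun E => Finset.sum_nonneg fun _ _ => dist_nonneg
  · filter_upwards [mem_inf_of_right (mem_principal_self _)] with E hE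
    rw [Finset.mul_sum]
    refine Finset.sum_le_sum fun i hi => ?_
    exact hF.dist_le_mul _ (hs (hE.1 i hi).1) _ (hs (hE.1 i hi).2)

theorem ac_of_integral {f g : ℝ → ℝ} {a b C : ℝ} (hab : a ≤ b)
    (hg : IntervalIntegrable g volume a b) (h : ∀ t ∈ Icc a b, f t = C + ∫ s in a..t, g s) :
    AbsolutelyContinuousOnInterval f a b := by
  have h1 := hg.absolutelyContinuousOnInterval_intervalIntegral (c := a) left_mem_uIcc
  have h2 : AbsolutelyContinuousOnInterval (fun _ : ℝ => C) a b :=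
    (LipschitzWith.const C).lipschitzOnWith (s := uIcc a b) |>.absolutelyContinuousOnInterval
  refine ac_congr (h2.add h1) fun t ht => ?_
  rw [uIcc_of_le hab] at ht
  exact (h t ht).symm

theorem ac_eq_add_integral {f : ℝ → ℝ} {a b t : ℝ} (hf : AbsolutelyContinuousOnInterval f a b)
    (hab : a ≤ b) (ht : t ∈ Icc a b) : f t = f a + ∫ s in a..t, deriv f s := by
  have : AbsolutelyContinuousOnInterval f a t := hf.mono (by
    rw [uIcc_of_le hab, uIcc_of_le ht.1]; exact Icc_subset_Icc_right ht.2)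
  rw [this.integral_deriv_eq_sub]; ring

theorem ac_trans {f : ℝ → ℝ} {a b c : ℝ} (hab : a ≤ b) (hbc : b ≤ c)
    (h1 : AbsolutelyContinuousOnInterval f a b) (h2 : AbsolutelyContinuousOnInterval f b c) :
    AbsolutelyContinuousOnInterval f a c := by
  have i1 := h1.intervalIntegrable_deriv
  have i2 := h2.intervalIntegrable_deriv
  refine ac_of_integral (C := f a) (hab.trans hbc) (i1.trans i2) fun t ht => ?_
  rcases le_total t b with h | h
  · exact ac_eq_add_integral h1 hab ⟨ht.1, h⟩
  · have e1 := ac_eq_add_integral h1 hab (right_mem_Icc.2 hab)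
    have e2 := ac_eq_add_integral h2 hbc ⟨h, ht.2⟩
    have i3 : IntervalIntegrable (deriv f) volume b t := i2.mono_set (by
      rw [uIcc_of_le hbc, uIcc_of_le h]; exact Icc_subset_Icc_right ht.2)
    rw [← intervalIntegral.integral_add_adjacent_intervals i1 i3]
    linarith

theorem ae_hasDerivAt_of_integral {f g : ℝ → ℝ} {a b C : ℝ}
    (hg : IntervalIntegrable g volume a b) (h : ∀ t ∈ Icc a b, f t = C + ∫ s in a..t, g s) :
    ∀ᵐ t, t ∈ Ioo a b → HasDerivAt f (g t) t := by
  filter_upwards [hg.ae_hasDerivAt_integral] with t ht hmem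
  have hab : a ≤ b := (hmem.1.trans hmem.2).le
  have h1 := (ht (by rw [uIcc_of_le hab]; exact Ioo_subset_Icc_self hmem) a left_mem_uIcc).const_add C
  refine h1.congr_of_eventuallyEq ?_
  filter_upwards [Ioo_mem_nhds hmem.1 hmem.2] with s hs
  exact h s (Ioo_subset_Icc_self hs)

theorem deriv_nonneg_of_monotoneOn {f : ℝ → ℝ} {a b t : ℝ} (hf : MonotoneOn f (Icc a b))
    (ht : t ∈ Ioo a b) : 0 ≤ deriv f t := by
  by_cases hd : DifferentiableAt ℝ f t
  · rw [← hd.derivWithin (uniqueDiffOn_Icc (ht.1.trans ht.2) t (Ioo_subset_Icc_self ht))]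
    exact hf.derivWithin_nonneg
  -- The default value 0 of `deriv` makes the sign hold at every interior point, not just almost
  -- everywhere.
  · rw [deriv_zero_of_not_differentiableAt hd]

theorem deriv_nonpos_of_antitoneOn {f : ℝ → ℝ} {a b t : ℝ} (hf : AntitoneOn f (Icc a b))
    (ht : t ∈ Ioo a b) : deriv f t ≤ 0 := by
  have := deriv_nonneg_of_monotoneOn hf.neg ht
  rwa [deriv.fun_neg, neg_nonneg] at this

theorem lintegral_deriv_of_monotoneOn {f : ℝ → ℝ} {a b t : ℝ}
    (hf : AbsolutelyContinuousOnInterval f a b) (hm : MonotoneOn f (Icc a b))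
    (ht : t ∈ Icc a b) :
    ∫⁻ s in Ioc a t, ENNReal.ofReal (deriv f s) = ENNReal.ofReal (f t - f a) := by
  have hab := ht.1.trans ht.2
  have hsub : AbsolutelyContinuousOnInterval f a t := hf.mono (by
    rw [uIcc_of_le hab, uIcc_of_le ht.1]; exact Icc_subset_Icc_right ht.2)
  have hi := hsub.intervalIntegrable_deriv
  rw [intervalIntegrable_iff_integrableOn_Ioc_of_le ht.1] at hi
  rw [← ofReal_integral_eq_lintegral_ofReal hi, ← intervalIntegral.integral_of_le ht.1,
    hsub.integral_deriv_eq_sub]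
  rw [← Measure.restrict_congr_set Ioo_ae_eq_Ioc]
  filter_upwards [ae_restrict_mem measurableSet_Ioo] with s hs
  exact deriv_nonneg_of_monotoneOn hm ⟨hs.1, hs.2.trans_le ht.2⟩

/-- A convergent series of absolutely continuous monotone functions is absolutely continuous. -/
theorem ac_tsum {g : ℕ → ℝ → ℝ} {G : ℝ → ℝ} {a b : ℝ} (hab : a ≤ b)
    (hg : ∀ j, AbsolutelyContinuousOnInterval (g j) a b) (hm : ∀ j, MonotoneOn (g j) (Icc a b))
    (hG : ∀ t ∈ Icc a b, HasSum (fun j => g j t) (G t)) :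
    AbsolutelyContinuousOnInterval G a b := by
  -- Tonelli: the summed nonnegative derivatives integrate to the increment of `G`, so `G` is the
  -- primitive of an integrable function.
  have hl : ∀ t ∈ Icc a b, ∫⁻ s in Ioc a t, ∑' j, ENNReal.ofReal (deriv (g j) s) =
      ENNReal.ofReal (G t - G a) := by
    intro t ht
    have hs := (hG t ht).sub (hG a (left_mem_Icc.2 hab))
    rw [lintegral_tsum fun j => (measurable_deriv (g j)).ennreal_ofReal.aemeasurable,
      ← hs.tsum_eq, ENNReal.ofReal_tsum_of_nonneg _ hs.summable]
    · exact tsum_congr fun j => lintegral_deriv_of_monotoneOn (hg j) (hm j) ht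
    · exact fun j => sub_nonneg.2 (hm j (left_mem_Icc.2 hab) ht ht.1)
  have hmeas : Measurable fun s => ∑' j, ENNReal.ofReal (deriv (g j) s) :=
    Measurable.tsum fun j => (measurable_deriv (g j)).ennreal_ofReal
  have hfin : ∫⁻ s in Ioc a b, ∑' j, ENNReal.ofReal (deriv (g j) s) ≠ ⊤ := by
    rw [hl b (right_mem_Icc.2 hab)]; exact ENNReal.ofReal_ne_top
  refine ac_of_integral (g := fun s => (∑' j, ENNReal.ofReal (deriv (g j) s)).toReal)
    (C := G a) hab ?_ ?_
  · rw [intervalIntegrable_iff_integrableOn_Ioc_of_le hab]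
    exact integrable_toReal_of_lintegral_ne_top hmeas.aemeasurable hfin
  · intro t ht
    have hle : ∫⁻ s in Ioc a t, ∑' j, ENNReal.ofReal (deriv (g j) s) ≠ ⊤ := by
      rw [hl t ht]; exact ENNReal.ofReal_ne_top
    rw [intervalIntegral.integral_of_le ht.1,
      integral_toReal hmeas.aemeasurable (ae_lt_top hmeas hle), hl t ht, ENNReal.toReal_ofReal]
    · ring
    · exact sub_nonneg.2 (hasSum_le (fun j => hm j (left_mem_Icc.2 hab) ht ht.1)
        (hG a (left_mem_Icc.2 hab)) (hG t ht))

end AbsolutelyContinuous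

/-! ### The Skorokhod map -/

theorem bddBelow_image_of_continuousOn {ψ : ℝ → ℝ} {t : ℝ} (h : ContinuousOn ψ (Icc 0 t)) :
    BddBelow (ψ '' Icc 0 t) := (isCompact_Icc.image_of_continuousOn h).bddBelow

theorem skorokhod_nonneg {ψ : ℝ → ℝ} {t : ℝ} (ht : 0 ≤ t) (h : ContinuousOn ψ (Icc 0 t)) :
    0 ≤ skorokhod ψ t := by
  have := csInf_le (bddBelow_image_of_continuousOn h) (mem_image_of_mem ψ (right_mem_Icc.2 ht))
  unfold skorokhod
  have := min_le_left (sInf (ψ '' Icc 0 t)) 0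
  linarith

/-- As long as `ψ` stays above the running minimum reached by time `t₁`, the reflection term is
frozen and the reflected path moves by the increments of `ψ`. -/
theorem skorokhod_eq_of_le {ψ : ℝ → ℝ} {t₁ t : ℝ} (ht₁ : 0 ≤ t₁) (ht : t₁ ≤ t)
    (hc : ContinuousOn ψ (Icc 0 t))
    (h : ∀ s ∈ Icc t₁ t, ψ t₁ - skorokhod ψ t₁ ≤ ψ s) :
    skorokhod ψ t = ψ t - ψ t₁ + skorokhod ψ t₁ := by
  have hb := bddBelow_image_of_continuousOn hc
  have hsub : ψ '' Icc 0 t₁ ⊆ ψ '' Icc 0 t := image_mono (Icc_subset_Icc_right ht)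
  have hm : ψ t₁ - skorokhod ψ t₁ = min (sInf (ψ '' Icc 0 t₁)) 0 := by unfold skorokhod; ring
  have e : min (sInf (ψ '' Icc 0 t)) 0 = min (sInf (ψ '' Icc 0 t₁)) 0 := by
    apply le_antisymm
    · exact min_le_min_right 0
        (csInf_le_csInf hb ((nonempty_Icc.2 ht₁).image ψ) hsub)
    · refine le_min ?_ (min_le_right _ _)
      refine le_csInf ((nonempty_Icc.2 (ht₁.trans ht)).image ψ) ?_
      rintro _ ⟨s, hs, rfl⟩
      rcases le_total s t₁ with h' | h'
      · exact (min_le_left _ _).trans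
          (csInf_le (hb.mono hsub) (mem_image_of_mem ψ ⟨hs.1, h'⟩))
      · rw [← hm]; exact h s ⟨h', hs.2⟩
  unfold skorokhod at *
  rw [e]; ring

/-! ### Paths between two states -/

/-- The properties of the paths in `J2` between the times `a` and `b` that matter for their
cost. -/
structure DescentPath (x₁ x₂ : ℕ → ℝ) (a b : ℝ) (ζ : ℝ → ℕ → ℝ) : Prop where
  left : ζ a = x₁
  right : ζ b = x₂
  zero_nonneg : ∀ t ∈ Icc a b, 0 ≤ ζ t 0
  anti : ∀ k, 1 ≤ k → AntitoneOn (fun t => ζ t k) (Icc a b)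
  ac : ∀ k, 1 ≤ k → AbsolutelyContinuousOnInterval (fun t => ζ t k) a b
  nonneg : ∀ k, 1 ≤ k → ∀ t ∈ Icc a b, 0 ≤ ζ t k
  r_eq : ∀ t ∈ Icc a b, r (ζ t) = r x₁ - 2 * (t - a)

theorem summable_mul_of_le {p x : ℕ → ℝ} (hp : Summable fun k : ℕ => (k : ℝ) * p k)
    (h0 : ∀ k, 1 ≤ k → 0 ≤ x k) (h : ∀ k, 1 ≤ k → x k ≤ p k) :
    Summable fun k : ℕ => (k : ℝ) * x k := by
  refine hp.of_nonneg_of_le (fun k => ?_) fun k => ?_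
  · rcases Nat.eq_zero_or_pos k with rfl | hk
    · simp
    · exact mul_nonneg (Nat.cast_nonneg k) (h0 k hk)
  · rcases Nat.eq_zero_or_pos k with rfl | hk
    · simp
    · exact mul_le_mul_of_nonneg_left (h k hk) (Nat.cast_nonneg k)

section Admissible

variable {p : ℕ → ℝ} {T : ℝ} {ζ : ℝ → ℕ → ℝ} {ψ : ℝ → ℝ}

theorem Admissible.le_init (h : Admissible p T ζ ψ) {k : ℕ} (hk : 1 ≤ k) {t : ℝ}
    (ht : t ∈ Icc 0 T) : ζ t k ≤ p k := by
  rw [← h.ζ_init k hk]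
  exact h.ζ_anti k hk ⟨le_rfl, ht.1.trans ht.2⟩ ht ht.1

theorem Admissible.summable (h : Admissible p T ζ ψ)
    (hp : Summable fun k : ℕ => (k : ℝ) * p k) {t : ℝ} (ht : t ∈ Icc 0 T) :
    Summable fun k : ℕ => (k : ℝ) * ζ t k :=
  summable_mul_of_le hp (fun k hk => h.ζ_nonneg k hk t ht) fun _ hk => h.le_init hk ht

theorem Admissible.zero_nonneg (h : Admissible p T ζ ψ) {t : ℝ} (ht : t ∈ Icc 0 T) :
    0 ≤ ζ t 0 := by
  rw [h.ζ_refl t ht]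
  exact skorokhod_nonneg ht.1 (h.cont_ψ.mono (Icc_subset_Icc_right ht.2))

theorem Admissible.r_eq (h : Admissible p T ζ ψ) {t : ℝ} (ht : t ∈ Icc 0 T) :
    r (ζ t) = ζ t 0 + ∑' k : ℕ, (k : ℝ) * ζ t k := by
  rw [r, max_eq_left (h.zero_nonneg ht)]

/-- Coordinatewise absolute continuity does not pass to a series by itself; monotonicity of each
coordinate makes it do so. -/
theorem Admissible.ac_tsum (h : Admissible p T ζ ψ) (hT : 0 ≤ T)
    (hp : Summable fun k : ℕ => (k : ℝ) * p k) :
    AbsolutelyContinuousOnInterval (fun t => ∑' k : ℕ, (k : ℝ) * ζ t k) 0 T := by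
  have h1 := ConfigModel.ac_tsum (g := fun (k : ℕ) t => -((k : ℝ) * ζ t k))
    (G := fun t => -∑' k : ℕ, (k : ℝ) * ζ t k) hT (fun k => ?_) (fun k => ?_)
    (fun t ht => (h.summable hp ht).hasSum.neg)
  · refine ac_congr h1.neg fun t _ => ?_
    simp
  · rcases Nat.eq_zero_or_pos k with rfl | hk
    · simpa using! ((LipschitzWith.const (0 : ℝ)).lipschitzOnWith
        (s := uIcc 0 T)).absolutelyContinuousOnInterval
    · exact ((h.ζ_ac k hk).const_mul k).neg
  · rcases Nat.eq_zero_or_pos k with rfl | hk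
    · intro _ _ _ _ _; simp
    · intro s hs t ht hst
      exact neg_le_neg (mul_le_mul_of_nonneg_left (h.ζ_anti k hk hs ht hst) (Nat.cast_nonneg k))

end Admissible

theorem zero_eq_of_mem_J1 {p x₁ x₂ : ℕ → ℝ} {t₁ t₂ : ℝ} {w : (ℝ → ℕ → ℝ) × (ℝ → ℝ)}
    (ht₁ : 0 ≤ t₁) (ht : t₁ < t₂) (hw : w ∈ J1 p t₁ t₂ x₁ x₂) {t : ℝ} (hmem : t ∈ Icc t₁ t₂) :
    w.1 t 0 = w.2 t - w.2 t₁ + x₁ 0 := by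
  obtain ⟨⟨hadm, h1, -⟩, hlow⟩ := hw
  have hm1 : t₁ ∈ Icc 0 t₂ := ⟨ht₁, ht.le⟩
  have hz : skorokhod w.2 t₁ = x₁ 0 := by rw [← hadm.ζ_refl t₁ hm1, h1]
  -- The constraint in `J1` is on the open interval; continuity of `ψ` extends it to the endpoints.
  have hlow' : ∀ s ∈ Icc t₁ t₂, w.2 t₁ - x₁ 0 ≤ w.2 s := by
    intro s hs
    rw [← closure_Ioo ht.ne] at hs
    refine le_on_closure hlow continuousOn_const ?_ hs
    rw [closure_Ioo ht.ne]
    exact hadm.cont_ψ.mono (Icc_subset_Icc_left ht₁)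
  rw [hadm.ζ_refl t ⟨ht₁.trans hmem.1, hmem.2⟩, skorokhod_eq_of_le ht₁ hmem.1
    (hadm.cont_ψ.mono (Icc_subset_Icc_right hmem.2)), hz]
  intro s hs
  rw [hz]
  exact hlow' s ⟨hs.1, hs.2.trans hmem.2⟩

/-- The only point needing work is `r_eq`: the a.e. derivative determines `r` because `r + 2t` is
absolutely continuous. The zeroth coordinate inherits this from `ψ`, since reflection is inactive.
-/
theorem DescentPath.of_mem_J2 {p x₁ x₂ : ℕ → ℝ} {t₁ t₂ : ℝ} {w : (ℝ → ℕ → ℝ) × (ℝ → ℝ)}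
    (hp : Summable fun k : ℕ => (k : ℝ) * p k) (ht₁ : 0 ≤ t₁) (ht : t₁ < t₂)
    (hw : w ∈ J2 p t₁ t₂ x₁ x₂) : DescentPath x₁ x₂ t₁ t₂ w.1 := by
  have hadm := hw.1.1.1
  have hsub : Icc t₁ t₂ ⊆ Icc 0 t₂ := Icc_subset_Icc_left ht₁
  have husub : uIcc t₁ t₂ ⊆ uIcc 0 t₂ := by
    rwa [uIcc_of_le ht.le, uIcc_of_le (ht₁.trans ht.le)]
  refine ⟨hw.1.1.2.1, hw.1.1.2.2, fun t h => hadm.zero_nonneg (hsub h),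
    fun k hk => (hadm.ζ_anti k hk).mono hsub, fun k hk => (hadm.ζ_ac k hk).mono husub,
    fun k hk t h => hadm.ζ_nonneg k hk t (hsub h), ?_⟩
  have hac : AbsolutelyContinuousOnInterval (fun t => r (w.1 t) + 2 * t) t₁ t₂ := by
    have a1 : AbsolutelyContinuousOnInterval w.2 t₁ t₂ := hadm.ψ_ac.mono husub
    have a2 := (hadm.ac_tsum (ht₁.trans ht.le) hp).mono husub
    have a3 : AbsolutelyContinuousOnInterval (fun t : ℝ => x₁ 0 - w.2 t₁ + 2 * t) t₁ t₂ :=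
      ContDiffOn.absolutelyContinuousOnInterval (by fun_prop)
    refine ac_congr ((a1.add a2).add a3) fun t h => ?_
    rw [uIcc_of_le ht.le] at h
    have := zero_eq_of_mem_J1 ht₁ ht hw.1 h
    rw [hadm.r_eq (hsub h), this]
    simp only [Pi.add_apply]
    ring
  obtain ⟨C, hC⟩ := hac.const_of_ae_hasDerivAt_zero (by
    have h1 : ∀ᵐ x : ℝ, x ≠ t₁ := by simp [ae_iff, measure_singleton]
    have h2 : ∀ᵐ x : ℝ, x ≠ t₂ := by simp [ae_iff, measure_singleton]
    filter_upwards [hw.2, h1, h2] with t h h1 h2 hmem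
    rw [uIcc_of_le ht.le] at hmem
    have := (h ⟨lt_of_le_of_ne hmem.1 (Ne.symm h1), lt_of_le_of_ne hmem.2 h2⟩).add
      ((hasDerivAt_id t).const_mul 2)
    simpa using! this)
  rw [uIcc_of_le ht.le] at hC
  intro t h
  have e1 := hC t h
  have e2 := hC t₁ (left_mem_Icc.2 ht.le)
  rw [hw.1.1.2.1] at e2
  linarith

section DescentPath

variable {x₁ x₂ : ℕ → ℝ} {a b : ℝ} {ζ : ℝ → ℕ → ℝ}

theorem DescentPath.le_left (h : DescentPath x₁ x₂ a b ζ) {k : ℕ} (hk : 1 ≤ k) {t : ℝ}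
    (ht : t ∈ Icc a b) : ζ t k ≤ x₁ k := by
  rw [← h.left]
  exact h.anti k hk ⟨le_rfl, ht.1.trans ht.2⟩ ht ht.1

theorem DescentPath.right_le (h : DescentPath x₁ x₂ a b ζ) {k : ℕ} (hk : 1 ≤ k) {t : ℝ}
    (ht : t ∈ Icc a b) : x₂ k ≤ ζ t k := by
  rw [← h.right]
  exact h.anti k hk ht ⟨ht.1.trans ht.2, le_rfl⟩ ht.2

theorem DescentPath.summable (h : DescentPath x₁ x₂ a b ζ)
    (hs : Summable fun k : ℕ => (k : ℝ) * x₁ k) {t : ℝ} (ht : t ∈ Icc a b) :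
    Summable fun k : ℕ => (k : ℝ) * ζ t k :=
  summable_mul_of_le hs (fun k hk => h.nonneg k hk t ht) fun _ hk => h.le_left hk ht

/-- The mass law rearranged: the weighted decrease of all positive coordinates is known once the
zeroth coordinate is. All path-independent sums below come from it. -/
theorem DescentPath.hasSum_decrease (h : DescentPath x₁ x₂ a b ζ)
    (hs : Summable fun k : ℕ => (k : ℝ) * x₁ k) (hab : a ≤ b) {t : ℝ} (ht : t ∈ Icc a b) :
    HasSum (fun k : ℕ => (k : ℝ) * (x₁ k - ζ t k)) (ζ t 0 - x₁ 0 + 2 * (t - a)) := by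
  have h1 := h.r_eq t ht
  have h0 : 0 ≤ x₁ 0 := by
    have := h.zero_nonneg a (left_mem_Icc.2 hab)
    rwa [h.left] at this
  rw [r, r, max_eq_left (h.zero_nonneg t ht), max_eq_left h0] at h1
  have := hs.hasSum.sub (h.summable hs ht).hasSum
  rw [show ζ t 0 - x₁ 0 + 2 * (t - a) =
    ∑' k : ℕ, (k : ℝ) * x₁ k - ∑' k : ℕ, (k : ℝ) * ζ t k by linarith]
  refine this.congr_fun fun k => ?_
  ring

theorem DescentPath.deriv_nonpos (h : DescentPath x₁ x₂ a b ζ) {k : ℕ} (hk : 1 ≤ k) {t : ℝ}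
    (ht : t ∈ Ioo a b) : deriv (fun u => ζ u k) t ≤ 0 :=
  deriv_nonpos_of_antitoneOn (h.anti k hk) ht

end DescentPath

/-! ### The explicit path -/

/-- The assumptions on the two endpoints `x₁` and `x₂` and the parameter `β`. -/
structure Endpoints (p x₁ x₂ : ℕ → ℝ) (β : ℝ) : Prop where
  summable_p : Summable fun k : ℕ => (k : ℝ) * p k
  zero₁ : 0 ≤ x₁ 0
  zero₂ : 0 ≤ x₂ 0
  nonneg₂ : ∀ k : ℕ, 1 ≤ k → 0 ≤ x₂ k
  le₂₁ : ∀ k : ℕ, 1 ≤ k → x₂ k ≤ x₁ k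
  le_p : ∀ k : ℕ, 1 ≤ k → x₁ k ≤ p k
  lt : 2 * ∑' k : ℕ, (x₁ (k + 1) - x₂ (k + 1)) <
    (∑' k : ℕ, ((k : ℝ) + 1) * (x₁ (k + 1) - x₂ (k + 1))) + (x₁ 0 - x₂ 0)
  isBeta : IsBeta x₁ x₂ β

/-- `z̃_k = z_k / (1 - β^k)`. -/
def zt (x₁ x₂ : ℕ → ℝ) (β : ℝ) (k : ℕ) : ℝ := (x₁ k - x₂ k) / (1 - β ^ k)

/-- `ς̃ = ς / (1 - β²)`. -/
def sg (x₁ x₂ : ℕ → ℝ) (β : ℝ) : ℝ := varsig x₁ x₂ / (1 - β ^ 2)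

/-- `w(t) = 1 - (t - t₁) / ς̃`. -/
def wt (t₁ : ℝ) (x₁ x₂ : ℕ → ℝ) (β t : ℝ) : ℝ := 1 - (t - t₁) / sg x₁ x₂ β

/-- The explicit path between the times `t₁` and `t₁ + ς`. -/
def expl (t₁ : ℝ) (x₁ x₂ : ℕ → ℝ) (β t : ℝ) (k : ℕ) : ℝ :=
  if k = 0 then 2 * sg x₁ x₂ β * wt t₁ x₁ x₂ β t -
    ∑' k : ℕ, (k : ℝ) * zt x₁ x₂ β k * wt t₁ x₁ x₂ β t ^ ((k : ℝ) / 2)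
  else x₁ k - zt x₁ x₂ β k * (1 - wt t₁ x₁ x₂ β t ^ ((k : ℝ) / 2))

theorem rpow_half_sq {v : ℝ} (hv : 0 ≤ v) (k : ℕ) : (v ^ 2) ^ ((k : ℝ) / 2) = v ^ k := by
  rw [← Real.rpow_natCast v 2, ← Real.rpow_mul hv, ← Real.rpow_natCast v k]
  congr 1; push_cast; ring

namespace Endpoints

variable {p x₁ x₂ : ℕ → ℝ} {β : ℝ} (h : Endpoints p x₁ x₂ β)
include h

theorem nonneg₁ (k : ℕ) (hk : 1 ≤ k) : 0 ≤ x₁ k := (h.nonneg₂ k hk).trans (h.le₂₁ k hk)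

theorem summable₁ : Summable fun k : ℕ => (k : ℝ) * x₁ k :=
  summable_mul_of_le h.summable_p h.nonneg₁ h.le_p

theorem summable₂ : Summable fun k : ℕ => (k : ℝ) * x₂ k :=
  summable_mul_of_le h.summable₁ h.nonneg₂ h.le₂₁

theorem hasSum_z : HasSum (fun k : ℕ => (k : ℝ) * (x₁ k - x₂ k))
    (2 * varsig x₁ x₂ - x₁ 0 + x₂ 0) := by
  have h1 := h.summable₁.hasSum.sub h.summable₂.hasSum
  have e : 2 * varsig x₁ x₂ - x₁ 0 + x₂ 0 =
      ∑' k : ℕ, (k : ℝ) * x₁ k - ∑' k : ℕ, (k : ℝ) * x₂ k := by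
    unfold varsig r
    rw [max_eq_left h.zero₁, max_eq_left h.zero₂]; ring
  rw [e]
  exact h1.congr_fun fun k => by ring

theorem hasSum_z_shift : HasSum (fun k : ℕ => ((k : ℝ) + 1) * (x₁ (k + 1) - x₂ (k + 1)))
    (2 * varsig x₁ x₂ - x₁ 0 + x₂ 0) := by
  have := (hasSum_nat_add_iff' 1).2 h.hasSum_z
  simpa using! this

/-- The strict inequality in `lt` reads `2 ∑ z_k < 2 ς`, and the left side is nonnegative. -/
theorem varsig_pos : 0 < varsig x₁ x₂ := by
  have h1 := h.lt
  rw [h.hasSum_z_shift.tsum_eq] at h1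
  have : 0 ≤ ∑' k : ℕ, (x₁ (k + 1) - x₂ (k + 1)) :=
    tsum_nonneg fun k => sub_nonneg.2 (h.le₂₁ _ (by omega))
  linarith

theorem beta_nonneg : 0 ≤ β := h.isBeta.equation.1.1

theorem beta_lt_one : β < 1 := h.isBeta.equation.1.2

theorem one_sub_sq_pos : 0 < 1 - β ^ 2 :=
  sub_pos.2 (pow_lt_one₀ h.beta_nonneg h.beta_lt_one (by norm_num))

theorem sg_pos : 0 < sg x₁ x₂ β := div_pos h.varsig_pos h.one_sub_sq_pos

theorem sg_mul : sg x₁ x₂ β * (1 - β ^ 2) = varsig x₁ x₂ :=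
  div_mul_cancel₀ _ h.one_sub_sq_pos.ne'

theorem one_sub_pow_pos {k : ℕ} (hk : 1 ≤ k) : 0 < 1 - β ^ k :=
  sub_pos.2 (pow_lt_one₀ h.beta_nonneg h.beta_lt_one (by omega))

-- The denominator `1 - β^0` is zero and division by zero gives 0, so series over all `k` need no
-- special case at `k = 0`.
omit h in
theorem zt_zero : zt x₁ x₂ β 0 = 0 := by simp [zt]

theorem zt_nonneg (k : ℕ) : 0 ≤ zt x₁ x₂ β k := by
  rcases Nat.eq_zero_or_pos k with rfl | hk
  · rw [zt_zero]
  · exact div_nonneg (sub_nonneg.2 (h.le₂₁ k hk)) (h.one_sub_pow_pos hk).le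

theorem zt_mul {k : ℕ} (hk : 1 ≤ k) : zt x₁ x₂ β k * (1 - β ^ k) = x₁ k - x₂ k :=
  div_mul_cancel₀ _ (h.one_sub_pow_pos hk).ne'

theorem z_le_zt {k : ℕ} (hk : 1 ≤ k) : x₁ k - x₂ k ≤ zt x₁ x₂ β k := by
  rw [← h.zt_mul hk]
  exact mul_le_of_le_one_right (h.zt_nonneg k)
    (by linarith [pow_nonneg h.beta_nonneg k])

/-- For `k ≥ 1` the denominators are bounded below by `1 - β`. -/
theorem summable_zt : Summable fun k : ℕ => (k : ℝ) * zt x₁ x₂ β k := by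
  refine (h.hasSum_z.summable.mul_left (1 / (1 - β))).of_nonneg_of_le
    (fun k => mul_nonneg (Nat.cast_nonneg k) (h.zt_nonneg k)) fun k => ?_
  rcases Nat.eq_zero_or_pos k with rfl | hk
  · simp
  · have hb : 0 < 1 - β := sub_pos.2 h.beta_lt_one
    have : 1 - β ≤ 1 - β ^ k := by
      have := pow_le_of_le_one h.beta_nonneg h.beta_lt_one.le (show k ≠ 0 by omega)
      linarith
    have hz := sub_nonneg.2 (h.le₂₁ k hk)
    rw [zt, show 1 / (1 - β) * ((k : ℝ) * (x₁ k - x₂ k)) =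
      (k : ℝ) * ((x₁ k - x₂ k) / (1 - β)) by ring]
    gcongr

/-- The equation for `β` in terms of `z̃` and `ς̃`. -/
theorem hasSum_zt : HasSum (fun k : ℕ => (k : ℝ) * zt x₁ x₂ β k)
    (2 * sg x₁ x₂ β - x₁ 0) := by
  have h1 := h.isBeta.equation.2
  rw [h.hasSum_z_shift.tsum_eq] at h1
  have h2 := (hasSum_nat_add_iff' 1).2 h.summable_zt.hasSum
  simp only [Finset.range_one, Finset.sum_singleton, Nat.cast_zero, zero_mul, sub_zero] at h2
  have h3 : ∑' k : ℕ, ((k : ℝ) + 1) * (x₁ (k + 1) - x₂ (k + 1)) / (1 - β ^ (k + 1)) =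
      ∑' k : ℕ, (k : ℝ) * zt x₁ x₂ β k := by
    rw [← h2.tsum_eq]
    refine tsum_congr fun k => ?_
    rw [zt]; push_cast; ring
  rw [h3] at h1
  have h4 := h.sg_mul
  have h5 : (∑' k : ℕ, (k : ℝ) * zt x₁ x₂ β k) = 2 * sg x₁ x₂ β - x₁ 0 := by
    have := h.one_sub_sq_pos
    have e : (1 - β ^ 2) * ((∑' k : ℕ, (k : ℝ) * zt x₁ x₂ β k) - (2 * sg x₁ x₂ β - x₁ 0)) = 0 := by
      linear_combination (-2) * h4 - h1
    linarith [(mul_eq_zero.1 e).resolve_left this.ne']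
  rw [← h5]
  exact h.summable_zt.hasSum

/-- The value `β = 0` occurs only with `z_1 = 0`. This keeps the singular power `w^(1/2)` away from
`w = 0`. -/
theorem beta_pos_of_zt_one (hz : zt x₁ x₂ β 1 ≠ 0) : 0 < β := by
  refine lt_of_le_of_ne h.beta_nonneg fun hb => hz ?_
  rcases h.isBeta with ⟨-, h2, -⟩ | ⟨-, h2, -⟩
  · simp [zt, h2]
  · exact absurd h2.1 hb.not_lt

theorem zero₂_eq (hb : β = 0) : x₂ 0 = 0 := by
  rcases h.isBeta with ⟨h1, -, -⟩ | ⟨-, h2, -⟩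
  · exact h1
  · exact absurd hb h2.1.ne'

variable (t₁ : ℝ)

omit h in
theorem wt_left : wt t₁ x₁ x₂ β t₁ = 1 := by simp [wt]

theorem wt_right : wt t₁ x₁ x₂ β (t₁ + varsig x₁ x₂) = β ^ 2 := by
  unfold wt
  rw [add_sub_cancel_left, ← h.sg_mul, mul_div_cancel_left₀ _ h.sg_pos.ne']; ring

theorem wt_strictAnti : StrictAnti (wt t₁ x₁ x₂ β) := by
  intro s t hst
  unfold wt
  have := h.sg_pos
  have : (s - t₁) / sg x₁ x₂ β < (t - t₁) / sg x₁ x₂ β := by gcongr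
  linarith

theorem sg_mul_wt (t : ℝ) : sg x₁ x₂ β * (1 - wt t₁ x₁ x₂ β t) = t - t₁ := by
  unfold wt
  have := h.sg_pos.ne'
  field_simp
  ring

variable {t₁} {t : ℝ}

theorem wt_mem (ht : t ∈ Icc t₁ (t₁ + varsig x₁ x₂)) : wt t₁ x₁ x₂ β t ∈ Icc (β ^ 2) 1 := by
  rw [← h.wt_right t₁, ← wt_left t₁]
  exact ⟨(h.wt_strictAnti t₁).antitone ht.2, (h.wt_strictAnti t₁).antitone ht.1⟩

theorem wt_nonneg (ht : t ∈ Icc t₁ (t₁ + varsig x₁ x₂)) : 0 ≤ wt t₁ x₁ x₂ β t :=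
  (sq_nonneg β).trans (h.wt_mem ht).1

theorem sq_lt_wt (ht : t < t₁ + varsig x₁ x₂) : β ^ 2 < wt t₁ x₁ x₂ β t := by
  rw [← h.wt_right t₁]
  exact h.wt_strictAnti t₁ ht

theorem wt_pos (ht : t < t₁ + varsig x₁ x₂) : 0 < wt t₁ x₁ x₂ β t :=
  (sq_nonneg β).trans_lt (h.sq_lt_wt ht)

theorem rpow_mem (ht : t ∈ Icc t₁ (t₁ + varsig x₁ x₂)) (k : ℕ) :
    wt t₁ x₁ x₂ β t ^ ((k : ℝ) / 2) ∈ Icc (0 : ℝ) 1 :=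
  ⟨Real.rpow_nonneg (h.wt_nonneg ht) _,
    Real.rpow_le_one (h.wt_nonneg ht) (h.wt_mem ht).2 (by positivity)⟩

theorem summable_zt_rpow (ht : t ∈ Icc t₁ (t₁ + varsig x₁ x₂)) :
    Summable fun k : ℕ => (k : ℝ) * zt x₁ x₂ β k * wt t₁ x₁ x₂ β t ^ ((k : ℝ) / 2) := by
  have h0 : ∀ k : ℕ, 0 ≤ (k : ℝ) * zt x₁ x₂ β k := fun k =>
    mul_nonneg (Nat.cast_nonneg k) (h.zt_nonneg k)
  exact h.summable_zt.of_nonneg_of_le (fun k => mul_nonneg (h0 k) (h.rpow_mem ht k).1)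
    fun k => mul_le_of_le_one_right (h0 k) (h.rpow_mem ht k).2

omit h in
theorem expl_of_pos {k : ℕ} (hk : 1 ≤ k) : expl t₁ x₁ x₂ β t k =
    x₁ k - zt x₁ x₂ β k * (1 - wt t₁ x₁ x₂ β t ^ ((k : ℝ) / 2)) := by
  rw [expl, if_neg (by omega)]

theorem expl_zero (ht : t ∈ Icc t₁ (t₁ + varsig x₁ x₂)) :
    HasSum (fun k : ℕ => (k : ℝ) * zt x₁ x₂ β k * wt t₁ x₁ x₂ β t ^ ((k : ℝ) / 2))
      (2 * sg x₁ x₂ β * wt t₁ x₁ x₂ β t - expl t₁ x₁ x₂ β t 0) := by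
  have := (h.summable_zt_rpow ht).hasSum
  convert this using 1
  simp [expl]

/-- In coordinate 0 this is the equation for `β` in the form `∑ k z̃_k = 2 ς̃ - x₁ 0`. -/
theorem expl_left : expl t₁ x₁ x₂ β t₁ = x₁ := by
  ext k
  rcases Nat.eq_zero_or_pos k with rfl | hk
  · rw [expl, if_pos rfl, wt_left]
    simp [h.hasSum_zt.tsum_eq]
  · rw [expl_of_pos hk, wt_left]; simp

/-- At the end `w = β²`, so `w^(k/2) = β^k` and `k z̃_k β^k = k z̃_k - k z_k`; both series on the
right are known. -/
theorem expl_right : expl t₁ x₁ x₂ β (t₁ + varsig x₁ x₂) = x₂ := by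
  ext k
  rcases Nat.eq_zero_or_pos k with rfl | hk
  · rw [expl, if_pos rfl, h.wt_right]
    have h1 := h.hasSum_zt.sub h.hasSum_z
    have h2 : HasSum (fun k : ℕ => (k : ℝ) * zt x₁ x₂ β k * (β ^ 2) ^ ((k : ℝ) / 2))
        (2 * sg x₁ x₂ β - x₁ 0 - (2 * varsig x₁ x₂ - x₁ 0 + x₂ 0)) := by
      refine h1.congr_fun fun k => ?_
      rw [rpow_half_sq h.beta_nonneg]
      rcases Nat.eq_zero_or_pos k with rfl | hk
      · simp
      · rw [← h.zt_mul hk]; ring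
    rw [h2.tsum_eq]
    linear_combination (-2) * h.sg_mul
  · rw [expl_of_pos hk, h.wt_right, rpow_half_sq h.beta_nonneg, h.zt_mul hk]; ring

/-- With `v = √w ∈ [β, 1]` the coordinate is `v Φ(v)`, where `Φ(v) = 2 ς̃ v - ∑ (j+1) z̃_{j+1} v^j`
is concave. It therefore suffices that `Φ ≥ 0` at `β` and at 1, which follows from the nonnegative
endpoints. -/
theorem expl_zero_nonneg (ht : t ∈ Icc t₁ (t₁ + varsig x₁ x₂)) :
    0 ≤ expl t₁ x₁ x₂ β t 0 := by
  have hw := h.wt_mem ht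
  set v := Real.sqrt (wt t₁ x₁ x₂ β t) with hv
  have hv0 : 0 ≤ v := Real.sqrt_nonneg _
  have hv2 : v ^ 2 = wt t₁ x₁ x₂ β t := Real.sq_sqrt (h.wt_nonneg ht)
  have hvβ : β ≤ v := Real.le_sqrt_of_sq_le hw.1
  have hv1 : v ≤ 1 := Real.sqrt_le_one.2 hw.2
  have hs : ∀ u ∈ Icc (0 : ℝ) 1,
      Summable fun j : ℕ => ((j : ℝ) + 1) * zt x₁ x₂ β (j + 1) * u ^ j := by
    intro u hu
    have := (summable_nat_add_iff 1).2 h.summable_zt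
    refine this.of_nonneg_of_le (fun j => ?_) fun j => ?_
    · exact mul_nonneg (mul_nonneg (by positivity) (h.zt_nonneg _)) (pow_nonneg hu.1 j)
    · push_cast
      exact mul_le_of_le_one_right (mul_nonneg (by positivity) (h.zt_nonneg _))
        (pow_le_one₀ hu.1 hu.2)
  set Φ : ℝ → ℝ := fun u => 2 * sg x₁ x₂ β * u -
    ∑' j : ℕ, ((j : ℝ) + 1) * zt x₁ x₂ β (j + 1) * u ^ j with hΦ
  have hmul : ∀ s ∈ Icc t₁ (t₁ + varsig x₁ x₂), ∀ u ∈ Icc (0 : ℝ) 1,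
      u ^ 2 = wt t₁ x₁ x₂ β s → expl t₁ x₁ x₂ β s 0 = u * Φ u := by
    intro s hs' u hu hus
    have h1 := (hasSum_nat_add_iff' 1).2 (h.expl_zero hs')
    have h2 := (hs u hu).hasSum.mul_left u
    have h3 : u * ∑' j : ℕ, ((j : ℝ) + 1) * zt x₁ x₂ β (j + 1) * u ^ j =
        2 * sg x₁ x₂ β * wt t₁ x₁ x₂ β s - expl t₁ x₁ x₂ β s 0 := by
      have h1' : HasSum (fun j : ℕ => u * (((j : ℝ) + 1) * zt x₁ x₂ β (j + 1) * u ^ j))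
          (2 * sg x₁ x₂ β * wt t₁ x₁ x₂ β s - expl t₁ x₁ x₂ β s 0) := by
        simp only [Finset.range_one, Finset.sum_singleton, Nat.cast_zero, zero_mul, sub_zero] at h1
        refine h1.congr_fun fun j => ?_
        rw [← hus, rpow_half_sq hu.1]
        push_cast; ring
      exact h2.unique h1'
    simp only [hΦ]
    rw [mul_sub, h3, ← hus]; ring
  have hΦ1 : 0 ≤ Φ 1 := by
    have hl : t₁ ∈ Icc t₁ (t₁ + varsig x₁ x₂) :=
      ⟨le_rfl, by linarith [h.varsig_pos]⟩
    have := hmul t₁ hl 1 (by simp) (by rw [wt_left]; norm_num)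
    rw [h.expl_left, one_mul] at this
    rw [← this]; exact h.zero₁
  -- For `β > 0` divide `x₂ 0 = β Φ(β)` by `β`. For `β = 0` this is unavailable, but then `Φ 0 =
  -- -z̃_1 = 0`.
  have hΦβ : 0 ≤ Φ β := by
    rcases h.beta_nonneg.eq_or_lt with hb | hb
    · have hz : zt x₁ x₂ β 1 = 0 := by
        by_contra hne
        exact (h.beta_pos_of_zt_one hne).ne hb
      simp only [hΦ]
      rw [← hb] at hz ⊢
      rw [tsum_eq_single 0]
      · simp [hz]
      · intro j hj; simp [hj]
    · have := hmul (t₁ + varsig x₁ x₂) ⟨by linarith [h.varsig_pos], le_rfl⟩ β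
        ⟨h.beta_nonneg, h.beta_lt_one.le⟩ (by rw [h.wt_right])
      rw [h.expl_right] at this
      have hx := h.zero₂
      rw [this] at hx
      exact nonneg_of_mul_nonneg_right hx hb
  obtain ⟨c, d, hc, hd, hcd, hv'⟩ : ∃ c d : ℝ, 0 ≤ c ∧ 0 ≤ d ∧ c + d = 1 ∧
      c * β + d * 1 = v := by
    have : v ∈ segment ℝ β 1 := by
      rw [segment_eq_Icc h.beta_lt_one.le]; exact ⟨hvβ, hv1⟩
    simpa [segment] using this
  -- Concavity of `Φ`, from convexity of each power with nonnegative coefficient.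
  have hΦv : c * Φ β + d * Φ 1 ≤ Φ v := by
    have hsum := ((hs β ⟨h.beta_nonneg, h.beta_lt_one.le⟩).mul_left c).add
      ((hs 1 (by simp)).mul_left d)
    have : ∑' j : ℕ, ((j : ℝ) + 1) * zt x₁ x₂ β (j + 1) * v ^ j ≤
        c * ∑' j : ℕ, ((j : ℝ) + 1) * zt x₁ x₂ β (j + 1) * β ^ j +
        d * ∑' j : ℕ, ((j : ℝ) + 1) * zt x₁ x₂ β (j + 1) * 1 ^ j := by
      rw [← tsum_mul_left, ← tsum_mul_left, ← ((hs β ⟨h.beta_nonneg,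
        h.beta_lt_one.le⟩).mul_left c).tsum_add ((hs 1 (by simp)).mul_left d)]
      refine (hs v ⟨hv0, hv1⟩).tsum_le_tsum (fun j => ?_) hsum
      have hconv := (convexOn_pow j).2 (show β ∈ Ici (0 : ℝ) from h.beta_nonneg)
        (mem_Ici.2 (zero_le_one (α := ℝ))) hc hd hcd
      simp only [smul_eq_mul] at hconv
      rw [hv'] at hconv
      have hz : 0 ≤ ((j : ℝ) + 1) * zt x₁ x₂ β (j + 1) :=
        mul_nonneg (by positivity) (h.zt_nonneg _)
      nlinarith [mul_le_mul_of_nonneg_left hconv hz]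
    simp only [hΦ]
    rw [← hv'] at this ⊢
    linarith
  rw [hmul t ht v ⟨hv0, hv1⟩ hv2]
  exact mul_nonneg hv0 ((add_nonneg (mul_nonneg hc hΦβ) (mul_nonneg hd hΦ1)).trans hΦv)

theorem expl_antitone {k : ℕ} (hk : 1 ≤ k) :
    AntitoneOn (fun t => expl t₁ x₁ x₂ β t k) (Icc t₁ (t₁ + varsig x₁ x₂)) := by
  intro s hs t ht hst
  simp only
  rw [expl_of_pos hk, expl_of_pos hk]
  have h1 : wt t₁ x₁ x₂ β t ^ ((k : ℝ) / 2) ≤ wt t₁ x₁ x₂ β s ^ ((k : ℝ) / 2) :=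
    Real.rpow_le_rpow (h.wt_nonneg ht) ((h.wt_strictAnti t₁).antitone hst) (by positivity)
  have := h.zt_nonneg k
  gcongr

theorem expl_ac {k : ℕ} (hk : 1 ≤ k) :
    AbsolutelyContinuousOnInterval (fun t => expl t₁ x₁ x₂ β t k) t₁ (t₁ + varsig x₁ x₂) := by
  have hu : uIcc t₁ (t₁ + varsig x₁ x₂) = Icc t₁ (t₁ + varsig x₁ x₂) :=
    uIcc_of_le (by linarith [h.varsig_pos])
  apply ContDiffOn.absolutelyContinuousOnInterval
  have e : (fun t => expl t₁ x₁ x₂ β t k) = fun t =>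
      x₁ k - zt x₁ x₂ β k * (1 - wt t₁ x₁ x₂ β t ^ ((k : ℝ) / 2)) := by
    ext t; exact expl_of_pos hk
  rw [e, hu]
  have hw : ContDiff ℝ 1 (wt t₁ x₁ x₂ β) := by unfold wt; fun_prop
  rcases eq_or_ne (zt x₁ x₂ β k) 0 with hz | hz
  · simp only [hz, zero_mul]; fun_prop
  · refine contDiffOn_const.sub (contDiffOn_const.mul (contDiffOn_const.sub ?_))
    -- The exponent `k/2` is at least 1 for `k ≥ 2`; for `k = 1` a moving coordinate forces `w ≥ β²
    -- > 0`.
    rcases Nat.lt_or_ge k 2 with hk2 | hk2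
    · have : k = 1 := by omega
      subst this
      refine hw.contDiffOn.rpow_const_of_ne fun t ht => ?_
      exact ((pow_pos (h.beta_pos_of_zt_one hz) 2).trans_le (h.wt_mem ht).1).ne'
    · have : (1 : ℝ) ≤ (k : ℝ) / 2 := by
        have : (2 : ℝ) ≤ k := by exact_mod_cast hk2
        linarith
      exact (hw.rpow_const_of_le (by simpa using this)).contDiffOn

theorem expl_hasSum_decrease (ht : t ∈ Icc t₁ (t₁ + varsig x₁ x₂)) :
    HasSum (fun k : ℕ => (k : ℝ) * (x₁ k - expl t₁ x₁ x₂ β t k))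
      (expl t₁ x₁ x₂ β t 0 - x₁ 0 + 2 * (t - t₁)) := by
  have h1 := h.hasSum_zt.sub (h.expl_zero ht)
  have e := h.sg_mul_wt t₁ t
  rw [show expl t₁ x₁ x₂ β t 0 - x₁ 0 + 2 * (t - t₁) = 2 * sg x₁ x₂ β - x₁ 0 -
    (2 * sg x₁ x₂ β * wt t₁ x₁ x₂ β t - expl t₁ x₁ x₂ β t 0) by rw [← e]; ring]
  refine h1.congr_fun fun k => ?_
  rcases Nat.eq_zero_or_pos k with rfl | hk
  · simp
  · rw [expl_of_pos hk]; ring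

/-- By the decrease identity the coordinate is an affine function plus a series of nondecreasing
absolutely continuous functions. -/
theorem expl_zero_ac :
    AbsolutelyContinuousOnInterval (fun t => expl t₁ x₁ x₂ β t 0) t₁ (t₁ + varsig x₁ x₂) := by
  have hle : t₁ ≤ t₁ + varsig x₁ x₂ := by linarith [h.varsig_pos]
  have h1 := ac_tsum (g := fun (k : ℕ) t => (k : ℝ) * (x₁ k - expl t₁ x₁ x₂ β t k)) hle
    (fun k => ?_) (fun k => ?_) fun t ht => h.expl_hasSum_decrease ht
  · have h2 : AbsolutelyContinuousOnInterval (fun t : ℝ => x₁ 0 - 2 * (t - t₁)) t₁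
        (t₁ + varsig x₁ x₂) := ContDiffOn.absolutelyContinuousOnInterval (by fun_prop)
    refine ac_congr (h1.add h2) fun t _ => ?_
    simp only [Pi.add_apply]; ring
  · rcases Nat.eq_zero_or_pos k with rfl | hk
    · simpa using! ((LipschitzWith.const (0 : ℝ)).lipschitzOnWith
        (s := uIcc t₁ (t₁ + varsig x₁ x₂))).absolutelyContinuousOnInterval
    · refine AbsolutelyContinuousOnInterval.const_mul _ ?_
      exact (((LipschitzWith.const (x₁ k)).lipschitzOnWith
        (s := uIcc t₁ (t₁ + varsig x₁ x₂))).absolutelyContinuousOnInterval).sub (h.expl_ac hk)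
  · rcases Nat.eq_zero_or_pos k with rfl | hk
    · intro _ _ _ _ _; simp
    · intro s hs t ht hst
      have := h.expl_antitone hk hs ht hst
      simp only at this ⊢
      gcongr

theorem expl_nonneg {k : ℕ} (hk : 1 ≤ k) (ht : t ∈ Icc t₁ (t₁ + varsig x₁ x₂)) :
    0 ≤ expl t₁ x₁ x₂ β t k := by
  have := h.expl_antitone hk ht ⟨ht.1.trans ht.2, le_rfl⟩ ht.2
  simp only [h.expl_right] at this
  exact (h.nonneg₂ k hk).trans this

theorem expl_r (ht : t ∈ Icc t₁ (t₁ + varsig x₁ x₂)) :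
    r (expl t₁ x₁ x₂ β t) = r x₁ - 2 * (t - t₁) := by
  have h1 := h.summable₁.hasSum.sub (h.expl_hasSum_decrease ht)
  have h2 : HasSum (fun k : ℕ => (k : ℝ) * expl t₁ x₁ x₂ β t k) _ := h1.congr_fun fun k => by ring
  rw [r, r, max_eq_left h.zero₁, max_eq_left (h.expl_zero_nonneg ht), h2.tsum_eq]
  ring

theorem descentPath_expl :
    DescentPath x₁ x₂ t₁ (t₁ + varsig x₁ x₂) (expl t₁ x₁ x₂ β) :=
  ⟨h.expl_left, h.expl_right, fun _ ht => h.expl_zero_nonneg ht, fun _ hk => h.expl_antitone hk,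
    fun _ hk => h.expl_ac hk, fun _ hk _ ht => h.expl_nonneg hk ht, fun _ ht => h.expl_r ht⟩

/-- The definition by increments agrees with the closed form because `β` solves its equation. -/
theorem tildeIncr_eq (ht : t ∈ Icc t₁ (t₁ + varsig x₁ x₂)) :
    tildeIncr t₁ x₁ x₂ β t = expl t₁ x₁ x₂ β t 0 - x₁ 0 := by
  have h1 := (hasSum_nat_add_iff' 1).2 (h.expl_hasSum_decrease ht)
  simp only [Finset.range_one, Finset.sum_singleton, Nat.cast_zero, zero_mul, sub_zero] at h1
  have h2 : ∑' k : ℕ, ((k : ℝ) + 1) * (x₁ (k + 1) - tildeCoord t₁ x₁ x₂ β t (k + 1)) =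
      expl t₁ x₁ x₂ β t 0 - x₁ 0 + 2 * (t - t₁) := by
    rw [← h1.tsum_eq]
    refine tsum_congr fun k => ?_
    rw [expl_of_pos (by omega), tildeCoord, zt, wt, sg]
    push_cast; ring
  rw [tildeIncr, h2]; ring

theorem tildeζ_eq {ζs : ℝ → ℕ → ℝ} (hζ : ζs t₁ = x₁) (ht : t ∈ Icc t₁ (t₁ + varsig x₁ x₂)) :
    tildeζ t₁ x₁ x₂ β ζs t = expl t₁ x₁ x₂ β t := by
  rcases ht.1.eq_or_lt with rfl | hlt
  · rw [h.expl_left, ← hζ]; ext k; simp [tildeζ]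
  · ext k
    rcases Nat.eq_zero_or_pos k with rfl | hk
    · simp [tildeζ, hlt.not_ge, h.tildeIncr_eq ht]
    · rw [expl_of_pos hk]
      simp [tildeζ, hlt.not_ge, show k ≠ 0 by omega, tildeCoord, zt, wt, sg]

theorem tildeψ_eq {ψs : ℝ → ℝ} (ht : t ∈ Icc t₁ (t₁ + varsig x₁ x₂)) :
    tildeψ t₁ x₁ x₂ β ψs t = ψs t₁ + (expl t₁ x₁ x₂ β t 0 - x₁ 0) := by
  rcases ht.1.eq_or_lt with rfl | hlt
  · simp [h.expl_left, tildeψ]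
  · simp [tildeψ, hlt.not_ge, h.tildeIncr_eq ht]

end Endpoints

/-! ### Gluing the explicit path to the given initial path -/

theorem continuousOn_glue {X : Type*} [TopologicalSpace X] {f : ℝ → X} {a b c : ℝ} (hab : a ≤ b)
    (hbc : b ≤ c) (h1 : ContinuousOn f (Icc a b)) (h2 : ContinuousOn f (Icc b c)) :
    ContinuousOn f (Icc a c) := by
  rw [← Icc_union_Icc_eq_Icc hab hbc]
  exact h1.union_of_isClosed h2 isClosed_Icc isClosed_Icc

theorem antitoneOn_glue {f : ℝ → ℝ} {a b c : ℝ} (hab : a ≤ b) (hbc : b ≤ c)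
    (h1 : AntitoneOn f (Icc a b)) (h2 : AntitoneOn f (Icc b c)) : AntitoneOn f (Icc a c) := by
  rw [← Icc_union_Icc_eq_Icc hab hbc]
  exact h1.union_right h2 (isGreatest_Icc hab) (isLeast_Icc hbc)

namespace Endpoints

variable {p x₁ x₂ : ℕ → ℝ} {β : ℝ} (h : Endpoints p x₁ x₂ β) {t₁ : ℝ} {ζs : ℝ → ℕ → ℝ}
  {ψs : ℝ → ℝ}
include h

/-- The reflection identity after `t₁` holds because `ψ̃ - ψ̃(t₁) + x₁ 0` equals the nonnegative
zeroth coordinate, so no new running minimum below `ψ̃(t₁) - x₁ 0` is reached. -/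
theorem admissible_tilde (ht₁ : 0 ≤ t₁) (hs : (ζs, ψs) ∈ J0 p 0 t₁ p x₁) :
    Admissible p (t₁ + varsig x₁ x₂) (tildeζ t₁ x₁ x₂ β ζs) (tildeψ t₁ x₁ x₂ β ψs) := by
  obtain ⟨hadm, -, h1⟩ := hs
  simp only at hadm h1
  have hle : t₁ ≤ t₁ + varsig x₁ x₂ := by linarith [h.varsig_pos]
  have hT : 0 ≤ t₁ + varsig x₁ x₂ := ht₁.trans hle
  have eζ : ∀ t ≤ t₁, tildeζ t₁ x₁ x₂ β ζs t = ζs t := fun t ht => by ext k; simp [tildeζ, ht]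
  have eψ : ∀ t ≤ t₁, tildeψ t₁ x₁ x₂ β ψs t = ψs t := fun t ht => by simp [tildeψ, ht]
  have eζ' : ∀ t ∈ Icc t₁ (t₁ + varsig x₁ x₂),
      tildeζ t₁ x₁ x₂ β ζs t = expl t₁ x₁ x₂ β t := fun t ht => h.tildeζ_eq h1 ht
  have eψ' : ∀ t ∈ Icc t₁ (t₁ + varsig x₁ x₂),
      tildeψ t₁ x₁ x₂ β ψs t = ψs t₁ + (expl t₁ x₁ x₂ β t 0 - x₁ 0) :=
    fun t ht => h.tildeψ_eq ht
  have hac : ∀ k, AbsolutelyContinuousOnInterval (fun t => expl t₁ x₁ x₂ β t k) t₁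
      (t₁ + varsig x₁ x₂) := fun k => by
    rcases Nat.eq_zero_or_pos k with rfl | hk
    · exact h.expl_zero_ac
    · exact h.expl_ac hk
  have hψac : AbsolutelyContinuousOnInterval (tildeψ t₁ x₁ x₂ β ψs) 0 (t₁ + varsig x₁ x₂) := by
    refine ac_trans ht₁ hle (ac_congr hadm.ψ_ac fun t ht => ?_) ?_
    · rw [uIcc_of_le ht₁] at ht
      exact (eψ t ht.2).symm
    · have hc : AbsolutelyContinuousOnInterval (fun _ : ℝ => ψs t₁ - x₁ 0) t₁
          (t₁ + varsig x₁ x₂) := ContDiffOn.absolutelyContinuousOnInterval (by fun_prop)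
      refine ac_congr ((hac 0).add hc) fun t ht => ?_
      rw [uIcc_of_le hle] at ht
      rw [eψ' t ht]
      simp only [Pi.add_apply]; ring
  have hψc : ContinuousOn (tildeψ t₁ x₁ x₂ β ψs) (Icc 0 (t₁ + varsig x₁ x₂)) := by
    have := hψac.continuousOn
    rwa [uIcc_of_le hT] at this
  have esk : ∀ t ≤ t₁, skorokhod (tildeψ t₁ x₁ x₂ β ψs) t = skorokhod ψs t := fun t ht => by
    unfold skorokhod
    rw [eψ t ht, image_congr fun s hs => eψ s (hs.2.trans ht)]
  refine ⟨?_, hψc, ?_, hψac, ?_, ?_, ?_, ?_, ?_⟩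
  · refine continuousOn_glue ht₁ hle ?_ ?_
    · exact hadm.cont_ζ.congr fun t ht => eζ t ht.2
    · refine ContinuousOn.congr ?_ eζ'
      rw [continuousOn_pi]
      intro k
      have := (hac k).continuousOn
      rwa [uIcc_of_le hle] at this
  · rw [eψ 0 ht₁, hadm.ψ_zero]
  · intro t ht
    rcases le_total t t₁ with h' | h'
    · rw [eζ t h', esk t h']; exact hadm.ζ_refl t ⟨ht.1, h'⟩
    · have hx : skorokhod (tildeψ t₁ x₁ x₂ β ψs) t₁ = x₁ 0 := by
        rw [esk t₁ le_rfl, ← hadm.ζ_refl t₁ ⟨ht₁, le_rfl⟩, h1]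
      rw [skorokhod_eq_of_le ht₁ h' (hψc.mono (Icc_subset_Icc_right ht.2)), hx,
        eψ t₁ le_rfl, eψ' t ⟨h', ht.2⟩, eζ' t ⟨h', ht.2⟩]
      · ring
      · intro s hs
        rw [hx, eψ t₁ le_rfl, eψ' s ⟨hs.1, hs.2.trans ht.2⟩]
        linarith [h.expl_zero_nonneg (t₁ := t₁) ⟨hs.1, hs.2.trans ht.2⟩]
  · intro k hk
    rw [eζ 0 ht₁]; exact hadm.ζ_init k hk
  · intro k hk
    refine antitoneOn_glue ht₁ hle ?_ ?_
    · exact (hadm.ζ_anti k hk).congr fun t ht => by simp only [eζ t ht.2]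
    · exact (h.expl_antitone hk).congr fun t ht => by simp only [eζ' t ht]
  · intro k hk
    refine ac_trans ht₁ hle (ac_congr (hadm.ζ_ac k hk) fun t ht => ?_)
      (ac_congr (hac k) fun t ht => ?_)
    · rw [uIcc_of_le ht₁] at ht
      simp only [eζ t ht.2]
    · rw [uIcc_of_le hle] at ht
      simp only [eζ' t ht]
  · intro k hk t ht
    rcases le_total t t₁ with h' | h'
    · rw [eζ t h']; exact hadm.ζ_nonneg k hk t ⟨ht.1, h'⟩
    · rw [eζ' t ⟨h', ht.2⟩]; exact h.expl_nonneg hk ⟨h', ht.2⟩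

theorem tilde_mem_J2 (ht₁ : 0 ≤ t₁) (hs : (ζs, ψs) ∈ J0 p 0 t₁ p x₁) :
    (tildeζ t₁ x₁ x₂ β ζs, tildeψ t₁ x₁ x₂ β ψs) ∈
      J2 p t₁ (t₁ + varsig x₁ x₂) x₁ x₂ := by
  have h1 : ζs t₁ = x₁ := hs.2.2
  have hle : t₁ ≤ t₁ + varsig x₁ x₂ := by linarith [h.varsig_pos]
  refine ⟨⟨⟨h.admissible_tilde ht₁ hs, ?_, ?_⟩, ?_⟩, ?_⟩
  · simp only
    rw [h.tildeζ_eq h1 (left_mem_Icc.2 hle), h.expl_left]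
  · simp only
    rw [h.tildeζ_eq h1 (right_mem_Icc.2 hle), h.expl_right]
  · intro t ht
    simp only
    rw [h.tildeψ_eq (left_mem_Icc.2 hle), h.tildeψ_eq (Ioo_subset_Icc_self ht), h.expl_left]
    linarith [h.expl_zero_nonneg (Ioo_subset_Icc_self ht)]
  · refine Filter.Eventually.of_forall fun t ht => ?_
    have h2 : HasDerivAt (fun s => r x₁ - 2 * (s - t₁)) (-2) t := by
      have := (((hasDerivAt_id t).sub_const t₁).const_mul 2).const_sub (r x₁)
      simpa using! this
    refine h2.congr_of_eventuallyEq ?_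
    filter_upwards [Ioo_mem_nhds ht.1 ht.2] with s hs'
    rw [h.tildeζ_eq h1 (Ioo_subset_Icc_self hs'), h.expl_r (Ioo_subset_Icc_self hs')]

end Endpoints

/-! ### The cost of a path as an integral of nonnegative functions -/

/-- The velocity of a path. -/
def vel (ζ : ℝ → ℕ → ℝ) (t : ℝ) (k : ℕ) : ℝ := deriv (fun u => ζ u k) t

section LocalCost

variable {x₁ x₂ : ℕ → ℝ} {a b : ℝ} {ζ : ℝ → ℕ → ℝ}

/-- Mass falls at rate 2 down to a nonnegative value at `b`, so it is positive strictly before `b`.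
-/
theorem DescentPath.r_pos (h : DescentPath x₁ x₂ a b ζ) {t : ℝ} (ht : t ∈ Ico a b) :
    0 < r (ζ t) := by
  have hab := ht.1.trans ht.2.le
  have h1 := h.r_eq t (Ico_subset_Icc_self ht)
  have h2 := h.r_eq b (right_mem_Icc.2 hab)
  have h3 : 0 ≤ r (ζ b) := by
    unfold r
    refine add_nonneg (le_max_right _ _) (tsum_nonneg fun k => ?_)
    rcases Nat.eq_zero_or_pos k with rfl | hk
    · simp
    · exact mul_nonneg (Nat.cast_nonneg k) (h.nonneg k hk b (right_mem_Icc.2 hab))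
  linarith [ht.2]

theorem DescentPath.L_eq (h : DescentPath x₁ x₂ a b ζ)
    (hs : Summable fun k : ℕ => (k : ℝ) * x₁ k) {t : ℝ} (ht : t ∈ Ioo a b)
    (hv : SubVelocity (vel ζ t)) :
    L (ζ t) (vel ζ t) = ((∑' k, klTerm (nu (vel ζ t) k) (rk (ζ t) k) : ℝ≥0∞) : EReal) :=
  L_eq_tsum (fun k hk => h.nonneg k hk t (Ioo_subset_Icc_self ht))
    (h.summable hs (Ioo_subset_Icc_self ht)) (h.r_pos (Ioo_subset_Ico_self ht))
    (fun _ hk => h.deriv_nonpos hk ht) hv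

theorem DescentPath.L_nonneg (h : DescentPath x₁ x₂ a b ζ)
    (hs : Summable fun k : ℕ => (k : ℝ) * x₁ k) {t : ℝ} (ht : t ∈ Ioo a b) :
    0 ≤ L (ζ t) (vel ζ t) := by
  by_cases hv : SubVelocity (vel ζ t)
  · rw [h.L_eq hs ht hv]; exact EReal.coe_ennreal_nonneg _
  · rw [L_eq_top hv]; exact le_top

/-- Relative entropy is nonnegative, so the negative part of the integral vanishes. The endpoints
are discarded since two-sided derivatives and positive mass are available only inside. -/
theorem DescentPath.LCost_eq (h : DescentPath x₁ x₂ a b ζ)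
    (hs : Summable fun k : ℕ => (k : ℝ) * x₁ k) :
    LCost a b ζ = ((∫⁻ t in Ioo a b, (L (ζ t) (vel ζ t)).toENNReal : ℝ≥0∞) : EReal) := by
  have h0 : ∫⁻ t in Ioo a b, (-L (ζ t) (vel ζ t)).toENNReal = 0 := by
    refine (setLIntegral_congr_fun measurableSet_Ioo (g := fun _ => 0) fun t ht => ?_).trans
      (by simp)
    exact EReal.toENNReal_of_nonpos (by simpa using h.L_nonneg hs ht)
  unfold LCost eint
  rw [← Measure.restrict_congr_set (Ioo_ae_eq_Icc (a := a) (b := b))]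
  change _ - ((∫⁻ t in Ioo a b, (-L (ζ t) (vel ζ t)).toENNReal : ℝ≥0∞) : EReal) = _
  rw [h0]
  simp only [EReal.coe_ennreal_zero, sub_zero]
  rfl

end LocalCost

/-! ### Jensen's inequality for the cost of a control -/

theorem ofReal_integral_le_lintegral {α : Type*} [MeasurableSpace α] {μ : Measure α} {g : α → ℝ}
    (hg : Integrable g μ) : ENNReal.ofReal (∫ x, g x ∂μ) ≤ ∫⁻ x, ENNReal.ofReal (g x) ∂μ := by
  refine ENNReal.ofReal_le_of_le_toReal ?_
  rw [integral_eq_lintegral_pos_part_sub_lintegral_neg_part hg]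
  exact sub_le_self _ ENNReal.toReal_nonneg

theorem ell_tangent {u θ : ℝ} (hu : 0 ≤ u) (hθ : 0 < θ) :
    u * Real.log θ - θ + 1 ≤ ell u := by
  have := mul_log_div_tangent hu one_pos hθ
  simpa [ell] using this

theorem Icc_inter_lt {m : ℝ} (hm : m ≤ 1) : Icc (0 : ℝ) 1 ∩ {y | y < m} = Ico 0 m := by
  ext y
  simp only [mem_inter_iff, mem_Icc, mem_ofPred_eq, mem_Ico]
  constructor
  · rintro ⟨⟨h1, -⟩, h2⟩; exact ⟨h1, h2⟩
  · rintro ⟨h1, h2⟩; exact ⟨⟨h1, h2.le.trans hm⟩, h2⟩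

theorem lintegral_indicator_lt {m : ℝ} (hm : m ≤ 1) (f : ℝ → ℝ≥0∞) :
    ∫⁻ y in Icc (0 : ℝ) 1, {y | y < m}.indicator f y = ∫⁻ y in Ico 0 m, f y := by
  have hmeas : MeasurableSet {y : ℝ | y < m} := measurableSet_lt measurable_id measurable_const
  rw [setLIntegral_indicator hmeas, inter_comm, Icc_inter_lt hm]

/-- Jensen's inequality through tangents: integrate `ℓ(u) ≥ u log θ - θ + 1` over `[0, m)` and
choose `θ = ρ/m`. The cost above height `m` is nonnegative and dropped. -/
theorem klTerm_le_lintegral_ell {f : ℝ → ℝ≥0} (hf : Measurable f) {m : ℝ} (hm : m ∈ Icc (0 : ℝ) 1)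
    (hfin : ∫⁻ y in Icc (0 : ℝ) 1, {y | y < m}.indicator (fun y => (f y : ℝ≥0∞)) y ≠ ⊤) :
    klTerm (∫⁻ y in Icc (0 : ℝ) 1, {y | y < m}.indicator (fun y => (f y : ℝ≥0∞)) y).toReal m ≤
      ∫⁻ y in Icc (0 : ℝ) 1, ENNReal.ofReal (ell (f y)) := by
  rw [lintegral_indicator_lt hm.2] at hfin ⊢
  have hsub : ∫⁻ y in Ico 0 m, ENNReal.ofReal (ell (f y)) ≤
      ∫⁻ y in Icc (0 : ℝ) 1, ENNReal.ofReal (ell (f y)) :=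
    lintegral_mono_set fun y hy => ⟨hy.1, hy.2.le.trans hm.2⟩
  refine le_trans ?_ hsub
  set ρ := (∫⁻ y in Ico 0 m, (f y : ℝ≥0∞)).toReal with hρ
  have hρ0 : 0 ≤ ρ := ENNReal.toReal_nonneg
  have hint : IntegrableOn (fun y => (f y : ℝ)) (Ico 0 m) := by
    have := integrable_toReal_of_lintegral_ne_top hf.coe_nnreal_ennreal.aemeasurable hfin
    simpa [IntegrableOn] using this
  have hρint : ∫ y in Ico 0 m, (f y : ℝ) = ρ := by
    have := integral_toReal (μ := volume.restrict (Ico 0 m))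
      hf.coe_nnreal_ennreal.aemeasurable (Filter.Eventually.of_forall fun y => ENNReal.coe_lt_top)
    simpa using this
  have key : ∀ θ : ℝ, 0 < θ → ENNReal.ofReal (ρ * Real.log θ - θ * m + m) ≤
      ∫⁻ y in Ico 0 m, ENNReal.ofReal (ell (f y)) := by
    intro θ hθ
    have hc : IntegrableOn (fun _ : ℝ => -θ + 1) (Ico 0 m) := by
      exact integrableOn_const (by simp)
    have hg : IntegrableOn (fun y => (f y : ℝ) * Real.log θ + (-θ + 1)) (Ico 0 m) :=
      (hint.mul_const _).add hc
    have e : ∫ y in Ico 0 m, ((f y : ℝ) * Real.log θ + (-θ + 1)) =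
        ρ * Real.log θ - θ * m + m := by
      rw [integral_add (hint.mul_const _) hc, integral_mul_const, hρint]
      simp [hm.1]; ring
    rw [← e]
    refine (ofReal_integral_le_lintegral hg).trans (lintegral_mono fun y => ?_)
    refine ENNReal.ofReal_le_ofReal ?_
    have := ell_tangent (f y).2 hθ
    linarith! [this]
  rcases hm.1.eq_or_lt with h0 | h0
  · have : ρ = 0 := by rw [hρ, ← h0]; simp
    simp [this, ← h0, klTerm]
  · rcases hρ0.eq_or_lt with h1 | h1
    · rw [← h1, klTerm_zero_left]
      -- At `ρ = 0` the optimal `θ` would be 0, which is reached only as a limit.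
      have hlim : Filter.Tendsto (fun θ : ℝ => ENNReal.ofReal (ρ * Real.log θ - θ * m + m))
          (nhdsWithin 0 (Ioi 0)) (nhds (ENNReal.ofReal m)) := by
        refine ENNReal.tendsto_ofReal ?_
        simp only [← h1, zero_mul]
        have : Filter.Tendsto (fun θ : ℝ => 0 - θ * m + m) (nhds 0) (nhds (0 - 0 * m + m)) :=
          Continuous.tendsto (by fun_prop) 0
        simp only [zero_mul, sub_zero, zero_add] at this
        exact this.mono_left nhdsWithin_le_nhds
      exact le_of_tendsto hlim (eventually_nhdsWithin_of_forall fun θ hθ => key θ hθ)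
    · have := key (ρ / m) (div_pos h1 h0)
      rw [div_mul_cancel₀ _ h0.ne'] at this
      rw [klTerm, if_neg h0.ne']
      exact this

/-! ### Rates of a control -/

theorem rk_le_one {x : ℕ → ℝ} (hx : ∀ k, 1 ≤ k → 0 ≤ x k) (k : ℕ) : rk x k ≤ 1 := by
  by_cases h : Summable (fun j : ℕ => (j : ℝ) * x j) ∧ 0 < r x
  · exact le_hasSum (hasSum_rk h.1 h.2) k fun j _ => rk_nonneg hx j
  · rw [rk, if_neg h]; exact zero_le_one

/-- Values of `ζ` outside `[0, T]` are arbitrary, so global measurability is obtained by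
precomposing with the projection onto the interval. -/
theorem Admissible.exists_measurable_rk {p : ℕ → ℝ} {T : ℝ} {ζ : ℝ → ℕ → ℝ} {ψ : ℝ → ℝ}
    (h : Admissible p T ζ ψ) (hT : 0 ≤ T) (hp : Summable fun k : ℕ => (k : ℝ) * p k) :
    ∃ m : ℕ → ℝ → ℝ, (∀ k, Measurable (m k)) ∧ ∀ k, ∀ t ∈ Icc 0 T, m k t = rk (ζ t) k := by
  set π : ℝ → ℝ := fun t => projIcc 0 T hT t with hπ
  have hπm : ∀ t, π t ∈ Icc 0 T := fun t => (projIcc 0 T hT t).2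
  have hπc : Continuous π := continuous_subtype_val.comp continuous_projIcc
  have hπe : ∀ t ∈ Icc 0 T, π t = t := fun t ht => by simp [hπ, projIcc_of_mem hT ht]
  have hc : ∀ k, Continuous fun t => ζ (π t) k := fun k =>
    (continuousOn_pi.1 h.cont_ζ k).comp_continuous hπc hπm
  have hr : Continuous fun t => ζ (π t) 0 + ∑' k : ℕ, (k : ℝ) * ζ (π t) k := by
    have := (h.ac_tsum hT hp).continuousOn
    rw [uIcc_of_le hT] at this
    exact (hc 0).add (this.comp_continuous hπc hπm)
  refine ⟨fun k t => rk (ζ (π t)) k, fun k => ?_, fun k t ht => by simp only [hπe t ht]⟩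
  have e : (fun t => rk (ζ (π t)) k) = fun t =>
      if 0 < ζ (π t) 0 + ∑' k : ℕ, (k : ℝ) * ζ (π t) k then
        (if k = 0 then max (ζ (π t) 0) 0 else (k : ℝ) * ζ (π t) k) /
          (ζ (π t) 0 + ∑' k : ℕ, (k : ℝ) * ζ (π t) k) else 0 := by
    ext t
    rw [rk, h.r_eq (hπm t)]
    simp only [h.summable hp (hπm t), true_and]
  change Measurable fun t => rk (ζ (π t)) k
  rw [e]
  refine Measurable.ite (measurableSet_lt measurable_const hr.measurable) ?_ measurable_const
  refine Measurable.div ?_ hr.measurable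
  split_ifs
  · exact ((hc 0).max continuous_const).measurable
  · exact ((hc k).const_mul (k : ℝ)).measurable

/-- The rate `∫₀¹ 1_{[0, m)}(y) φ(s, y) dy` of a control. -/
def rate (m : ℝ → ℝ) (φ : ℝ × ℝ → ℝ≥0) (s : ℝ) : ℝ≥0∞ :=
  ∫⁻ y in Icc (0 : ℝ) 1, {y | y < m s}.indicator (fun y => (φ (s, y) : ℝ≥0∞)) y

theorem measurable_indicator_lt {m : ℝ → ℝ} (hm : Measurable m) {φ : ℝ × ℝ → ℝ≥0}
    (hφ : Measurable φ) :
    Measurable ({q : ℝ × ℝ | q.2 < m q.1}.indicator fun q => (φ q : ℝ≥0∞)) :=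
  hφ.coe_nnreal_ennreal.indicator (measurableSet_lt measurable_snd (hm.comp measurable_fst))

theorem measurable_rate {m : ℝ → ℝ} (hm : Measurable m) {φ : ℝ × ℝ → ℝ≥0} (hφ : Measurable φ) :
    Measurable (rate m φ) :=
  (measurable_indicator_lt hm hφ).lintegral_prod_right'

theorem setLIntegral_prod_Icc {f : ℝ × ℝ → ℝ≥0∞} (hf : Measurable f) (a b : ℝ) :
    ∫⁻ q in Icc a b ×ˢ Icc (0 : ℝ) 1, f q = ∫⁻ s in Icc a b, ∫⁻ y in Icc (0 : ℝ) 1, f (s, y) := by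
  rw [Measure.volume_eq_prod, ← Measure.prod_restrict, lintegral_prod _ hf.aemeasurable]

theorem flow_eq_lintegral_rate {ζ : ℝ → ℕ → ℝ} {φ : ℕ → ℝ × ℝ → ℝ≥0} {m : ℝ → ℝ} {k : ℕ} {t : ℝ}
    (hm : Measurable m) (hφ : Measurable (φ k)) (h : ∀ s ∈ Icc 0 t, m s = rk (ζ s) k) :
    flow ζ φ k t = ∫⁻ s in Icc 0 t, rate m (φ k) s := by
  unfold flow
  rw [setLIntegral_congr_fun (g := {q : ℝ × ℝ | q.2 < m q.1}.indicator fun q => (φ k q : ℝ≥0∞))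
    (measurableSet_Icc.prod measurableSet_Icc) fun q hq => ?_,
    setLIntegral_prod_Icc (measurable_indicator_lt hm hφ)]
  · rfl
  · simp only [indicator, mem_ofPred_eq, h q.1 hq.1]

theorem controlCost_eq {φ : ℕ → ℝ × ℝ → ℝ≥0} (hφ : ∀ k, Measurable (φ k)) (a b : ℝ) :
    controlCost a b φ = ∫⁻ s in Icc a b, ∑' k, ∫⁻ y in Icc (0 : ℝ) 1,
      ENNReal.ofReal (ell (φ k (s, y))) := by
  have hm : ∀ k, Measurable fun q => ENNReal.ofReal (ell (φ k q)) := fun k => by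
    have := hφ k
    unfold ell
    fun_prop
  unfold controlCost
  rw [lintegral_tsum fun k => (hm k).lintegral_prod_right'.aemeasurable]
  exact tsum_congr fun k => setLIntegral_prod_Icc (hm k) a b

/-! ### The cost of a control dominates the cost of its path -/

theorem setLIntegral_Icc_add_Ioc {f : ℝ → ℝ≥0∞} {a b c : ℝ} (hab : a ≤ b) (hbc : b ≤ c) :
    ∫⁻ s in Icc a c, f s = (∫⁻ s in Icc a b, f s) + ∫⁻ s in Ioc b c, f s := by
  rw [← Icc_union_Ioc_eq_Icc hab hbc]
  refine lintegral_union measurableSet_Ioc ?_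
  rw [Set.disjoint_left]
  intro x hx hx'
  exact hx.2.not_gt hx'.1

theorem toReal_setLIntegral_Icc {f : ℝ → ℝ≥0∞} (hf : Measurable f) {a t : ℝ} (hat : a ≤ t)
    (hfin : ∫⁻ s in Icc a t, f s ≠ ⊤) :
    (∫⁻ s in Icc a t, f s).toReal = ∫ s in a..t, (f s).toReal := by
  rw [intervalIntegral.integral_of_le hat, ← integral_Icc_eq_integral_Ioc,
    integral_toReal hf.aemeasurable (ae_lt_top hf hfin)]

theorem intervalIntegrable_toReal {f : ℝ → ℝ≥0∞} (hf : Measurable f) {a b : ℝ} (hab : a ≤ b)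
    (hfin : ∫⁻ s in Ioc a b, f s ≠ ⊤) :
    IntervalIntegrable (fun s => (f s).toReal) volume a b := by
  rw [intervalIntegrable_iff_integrableOn_Ioc_of_le hab]
  exact integrable_toReal_of_lintegral_ne_top hf.aemeasurable hfin

theorem ae_mem_Ioo_lt_top {f : ℝ → ℝ≥0∞} (hf : Measurable f) {a b : ℝ}
    (hfin : ∫⁻ s in Ioc a b, f s ≠ ⊤) : ∀ᵐ s, s ∈ Ioo a b → f s < ⊤ := by
  have := ae_lt_top hf hfin
  rw [ae_restrict_iff' measurableSet_Ioc] at this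
  filter_upwards [this] with s hs hs'
  exact hs (Ioo_subset_Ioc_self hs')

section PathCost

variable {p x₁ x₂ : ℕ → ℝ} {t₁ t₂ : ℝ} {w : (ℝ → ℕ → ℝ) × (ℝ → ℝ)} {φ : ℕ → ℝ × ℝ → ℝ≥0}

/-- Along a path of `J2`, the total mass moved by a control grows at unit speed. -/
theorem hasSum_flow_sub (hp : Summable fun k : ℕ => (k : ℝ) * p k) (ht₁ : 0 ≤ t₁) (ht : t₁ < t₂)
    (hw : w ∈ J2 p t₁ t₂ x₁ x₂) (hφ : IsControl p t₂ w.1 w.2 φ) {t : ℝ} (hmem : t ∈ Icc t₁ t₂) :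
    HasSum (fun k => (flow w.1 φ k t).toReal - (flow w.1 φ k t₁).toReal) (t - t₁) := by
  have hadm := hw.1.1.1
  have hm : t ∈ Icc 0 t₂ := ⟨ht₁.trans hmem.1, hmem.2⟩
  have hm₁ : t₁ ∈ Icc 0 t₂ := ⟨ht₁, ht.le⟩
  have hd := DescentPath.of_mem_J2 hp ht₁ ht hw
  have hs₁ : Summable fun k : ℕ => (k : ℝ) * x₁ k := by
    have := hadm.summable hp hm₁
    rwa [hw.1.1.2.1] at this
  have h1 := (hφ.eq_ψ t hm).sub (hφ.eq_ψ t₁ hm₁)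
  have h2 := hd.hasSum_decrease hs₁ ht.le hmem
  rw [zero_eq_of_mem_J1 ht₁ ht hw.1 hmem] at h2
  -- With `Δ_k` the flow increments, the mass law gives `∑ k Δ_k = Δψ + 2 (t - t₁)` and the control
  -- equation gives `∑ (k - 2) Δ_k = Δψ`; half the difference is `∑ Δ_k`.
  have h3 := (h2.sub h1).div_const 2
  rw [show (w.2 t - w.2 t₁ + x₁ 0 - x₁ 0 + 2 * (t - t₁) - (w.2 t - w.2 t₁)) / 2 = t - t₁ by
    ring] at h3
  refine h3.congr_fun fun k => ?_
  rcases Nat.eq_zero_or_pos k with rfl | hk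
  · simp; ring
  · rw [← hw.1.1.2.1, hφ.eq_ζ k hk t hm, hφ.eq_ζ k hk t₁ hm₁]
    ring

/-- Lebesgue differentiation of the flows and of their sum, which is `t - t₁`. Consequently the
rates of every control along the path are the vector `ν(·|ζ')`. -/
theorem ae_rate_eq (hp : Summable fun k : ℕ => (k : ℝ) * p k) (ht₁ : 0 ≤ t₁) (ht : t₁ < t₂)
    (hw : w ∈ J2 p t₁ t₂ x₁ x₂) (hφ : IsControl p t₂ w.1 w.2 φ) {m : ℕ → ℝ → ℝ}
    (hm : ∀ k, Measurable (m k)) (hmeq : ∀ k, ∀ t ∈ Icc 0 t₂, m k t = rk (w.1 t) k) :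
    ∀ᵐ s, s ∈ Ioo t₁ t₂ → (∀ k, rate (m k) (φ k) s ≠ ⊤) ∧
      (∀ k, 1 ≤ k → vel w.1 s k = -(rate (m k) (φ k) s).toReal) ∧
      ∑' k, rate (m k) (φ k) s = 1 := by
  have hT : 0 ≤ t₂ := ht₁.trans ht.le
  have hmr : ∀ k, Measurable (rate (m k) (φ k)) := fun k => measurable_rate (hm k) (hφ.meas k)
  have hflow : ∀ k, ∀ t ∈ Icc 0 t₂, flow w.1 φ k t = ∫⁻ s in Icc 0 t, rate (m k) (φ k) s :=
    fun k t ht => flow_eq_lintegral_rate (hm k) (hφ.meas k)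
      fun s hs => hmeq k s ⟨hs.1, hs.2.trans ht.2⟩
  have hfinT : ∀ k, ∫⁻ s in Ioc 0 t₂, rate (m k) (φ k) s ≠ ⊤ := fun k => by
    refine ne_top_of_le_ne_top (hφ.finite k t₂ ⟨hT, le_rfl⟩) ?_
    rw [hflow k t₂ ⟨hT, le_rfl⟩]
    exact lintegral_mono_set Ioc_subset_Icc_self
  have hvel : ∀ k, 1 ≤ k → ∀ᵐ s, s ∈ Ioo 0 t₂ →
      HasDerivAt (fun u => w.1 u k) (-(rate (m k) (φ k) s).toReal) s := by
    intro k hk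
    refine ae_hasDerivAt_of_integral (C := p k)
      (intervalIntegrable_toReal (hmr k) hT (hfinT k)).neg fun t ht' => ?_
    rw [hφ.eq_ζ k hk t ht', hflow k t ht', toReal_setLIntegral_Icc (hmr k) ht'.1]
    · simp [sub_eq_add_neg]
    · rw [← hflow k t ht']; exact hφ.finite k t ht'
  have hΔ : ∀ t ∈ Icc t₁ t₂, ∀ k, ∫⁻ s in Ioc t₁ t, rate (m k) (φ k) s =
      ENNReal.ofReal ((flow w.1 φ k t).toReal - (flow w.1 φ k t₁).toReal) := by
    intro t ht' k
    have ht0 : t ∈ Icc 0 t₂ := ⟨ht₁.trans ht'.1, ht'.2⟩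
    have hf1 := hφ.finite k t ht0
    have hf2 := hφ.finite k t₁ ⟨ht₁, ht.le⟩
    have e : flow w.1 φ k t = flow w.1 φ k t₁ + ∫⁻ s in Ioc t₁ t, rate (m k) (φ k) s := by
      rw [hflow k t ht0, hflow k t₁ ⟨ht₁, ht.le⟩, setLIntegral_Icc_add_Ioc ht₁ ht'.1]
    have hf3 : ∫⁻ s in Ioc t₁ t, rate (m k) (φ k) s ≠ ⊤ := by
      intro h; rw [e, h] at hf1; simp at hf1
    rw [e, ENNReal.toReal_add hf2 hf3, add_sub_cancel_left, ENNReal.ofReal_toReal hf3]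
  have hmS : Measurable fun s => ∑' k, rate (m k) (φ k) s := Measurable.tsum hmr
  have hsum : ∀ t ∈ Icc t₁ t₂, ∫⁻ s in Ioc t₁ t, ∑' k, rate (m k) (φ k) s =
      ENNReal.ofReal (t - t₁) := by
    intro t ht'
    have h1 := hasSum_flow_sub hp ht₁ ht hw hφ ht'
    rw [lintegral_tsum fun k => (hmr k).aemeasurable, ← h1.tsum_eq,
      ENNReal.ofReal_tsum_of_nonneg _ h1.summable]
    · exact tsum_congr fun k => hΔ t ht' k
    · intro k
      have ht0 : t ∈ Icc 0 t₂ := ⟨ht₁.trans ht'.1, ht'.2⟩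
      refine sub_nonneg.2 (ENNReal.toReal_mono (hφ.finite k t ht0) ?_)
      rw [hflow k t ht0, hflow k t₁ ⟨ht₁, ht.le⟩]
      exact lintegral_mono_set (Icc_subset_Icc_right ht'.1)
  have hfinS : ∫⁻ s in Ioc t₁ t₂, ∑' k, rate (m k) (φ k) s ≠ ⊤ := by
    rw [hsum t₂ ⟨ht.le, le_rfl⟩]; exact ENNReal.ofReal_ne_top
  have hS : ∀ᵐ s, s ∈ Ioo t₁ t₂ →
      HasDerivAt (fun t => t - t₁) (∑' k, rate (m k) (φ k) s).toReal s := by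
    refine ae_hasDerivAt_of_integral (C := 0)
      (intervalIntegrable_toReal hmS ht.le hfinS) fun t ht' => ?_
    have hfin : ∫⁻ s in Ioc t₁ t, ∑' k, rate (m k) (φ k) s ≠ ⊤ := by
      rw [hsum t ht']; exact ENNReal.ofReal_ne_top
    rw [intervalIntegral.integral_of_le ht'.1,
      integral_toReal hmS.aemeasurable (ae_lt_top hmS hfin), hsum t ht',
      ENNReal.toReal_ofReal (sub_nonneg.2 ht'.1), zero_add]
  have hvel' : ∀ᵐ s, ∀ k, 1 ≤ k → s ∈ Ioo 0 t₂ →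
      HasDerivAt (fun u => w.1 u k) (-(rate (m k) (φ k) s).toReal) s := by
    rw [ae_all_iff]
    intro k
    by_cases hk : 1 ≤ k
    · filter_upwards [hvel k hk] with s hs _ using hs
    · exact Filter.Eventually.of_forall fun s h => absurd h hk
  filter_upwards [hvel', hS, ae_mem_Ioo_lt_top hmS hfinS] with s h1 h2 h3 hs
  have hone : (∑' k, rate (m k) (φ k) s).toReal = 1 :=
    (h2 hs).unique ((hasDerivAt_id s).sub_const t₁)
  have htop := (h3 hs).ne
  refine ⟨fun k => ne_top_of_le_ne_top htop (ENNReal.le_tsum k), fun k hk => ?_, ?_⟩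
  · exact (h1 k hk ⟨ht₁.trans_lt hs.1, hs.2⟩).deriv
  · rw [← ENNReal.ofReal_toReal htop, hone, ENNReal.ofReal_one]

/-- For almost every time the rates of a control are determined by the velocity, so Jensen's
inequality coordinate by coordinate bounds its instantaneous cost by `L`. -/
theorem LCost_le_pathCost (hp : Summable fun k : ℕ => (k : ℝ) * p k) (ht₁ : 0 ≤ t₁)
    (ht : t₁ < t₂) (hw : w ∈ J2 p t₁ t₂ x₁ x₂) :
    LCost t₁ t₂ w.1 ≤ (pathCost p t₁ t₂ w.1 w.2 : EReal) := by
  have hadm := hw.1.1.1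
  have hd := DescentPath.of_mem_J2 hp ht₁ ht hw
  have hs₁ : Summable fun k : ℕ => (k : ℝ) * x₁ k := by
    have := hadm.summable hp (t := t₁) ⟨ht₁, ht.le⟩
    rwa [hw.1.1.2.1] at this
  rw [hd.LCost_eq hs₁, EReal.coe_ennreal_le_coe_ennreal_iff]
  unfold pathCost
  refine le_iInf₂ fun φ hφ => ?_
  obtain ⟨m, hm, hmeq⟩ := hadm.exists_measurable_rk (ht₁.trans ht.le) hp
  rw [controlCost_eq hφ.meas, ← Measure.restrict_congr_set (Ioo_ae_eq_Icc (a := t₁) (b := t₂))]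
  refine lintegral_mono_ae ?_
  rw [ae_restrict_iff' measurableSet_Ioo]
  filter_upwards [ae_rate_eq hp ht₁ ht hw hφ hm hmeq] with s hs hmem
  obtain ⟨hfin, hvel, hsum⟩ := hs hmem
  have hs0 : s ∈ Icc 0 t₂ := ⟨ht₁.trans hmem.1.le, hmem.2.le⟩
  have hHas : HasSum (fun k => (rate (m k) (φ k) s).toReal) 1 := by
    have h1 : Summable fun k => (rate (m k) (φ k) s).toReal :=
      ENNReal.summable_toReal (by rw [hsum]; exact ENNReal.one_ne_top)
    have h2 := h1.hasSum
    rwa [← ENNReal.tsum_toReal_eq hfin, hsum, ENNReal.toReal_one] at h2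
  have hneg : HasSum (fun k => vel w.1 s (k + 1)) (-(1 - (rate (m 0) (φ 0) s).toReal)) := by
    have h1 := ((hasSum_nat_add_iff' 1).2 hHas).neg
    simp only [Finset.range_one, Finset.sum_singleton] at h1
    exact h1.congr_fun fun k => hvel (k + 1) (by omega)
  have hnu : ∀ k, nu (vel w.1 s) k = (rate (m k) (φ k) s).toReal := by
    intro k
    rcases Nat.eq_zero_or_pos k with rfl | hk
    · rw [nu, if_pos rfl, hneg.tsum_eq]; ring
    · rw [nu, if_neg (by omega), hvel k hk, neg_neg]
  have hsub : SubVelocity (vel w.1 s) := by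
    refine subVelocity_of_neg_one_le (fun k hk => hd.deriv_nonpos hk hmem) hneg.summable ?_
    rw [hneg.tsum_eq]
    linarith [ENNReal.toReal_nonneg (a := rate (m 0) (φ 0) s)]
  rw [hd.L_eq hs₁ hmem hsub, EReal.toENNReal_coe]
  refine ENNReal.tsum_le_tsum fun k => ?_
  have hx : ∀ k, 1 ≤ k → 0 ≤ w.1 s k := fun k hk => hadm.ζ_nonneg k hk s hs0
  rw [hnu k, ← hmeq k s hs0]
  refine klTerm_le_lintegral_ell (f := fun y => φ k (s, y))
    ((hφ.meas k).comp measurable_prodMk_left) ?_ (hfin k)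
  rw [hmeq k s hs0]
  exact ⟨rk_nonneg hx k, rk_le_one hx k⟩

end PathCost

/-! ### The velocity and the cost of the explicit path -/

/-- The rates `ν(k | ζ̃')` of the explicit path. -/
def explRate (t₁ : ℝ) (x₁ x₂ : ℕ → ℝ) (β t : ℝ) (k : ℕ) : ℝ :=
  (if k = 0 then expl t₁ x₁ x₂ β t 0
    else (k : ℝ) * zt x₁ x₂ β k * wt t₁ x₁ x₂ β t ^ ((k : ℝ) / 2)) /
  (2 * sg x₁ x₂ β * wt t₁ x₁ x₂ β t)

theorem measurable_wt (t₁ : ℝ) (x₁ x₂ : ℕ → ℝ) (β : ℝ) : Measurable (wt t₁ x₁ x₂ β) := by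
  unfold wt; fun_prop

theorem measurable_explRate (t₁ : ℝ) (x₁ x₂ : ℕ → ℝ) (β : ℝ) (k : ℕ) :
    Measurable fun t => explRate t₁ x₁ x₂ β t k := by
  have hw := measurable_wt t₁ x₁ x₂ β
  unfold explRate
  refine Measurable.div ?_ (by fun_prop)
  split_ifs
  · simp only [expl, if_pos]
    refine Measurable.sub (by fun_prop) ?_
    exact Measurable.tsum fun j => by fun_prop
  · fun_prop

namespace Endpoints

variable {p x₁ x₂ : ℕ → ℝ} {β : ℝ} (h : Endpoints p x₁ x₂ β) {t₁ t : ℝ}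
include h

theorem hasDerivAt_expl {k : ℕ} (hk : 1 ≤ k) (ht : t < t₁ + varsig x₁ x₂) :
    HasDerivAt (fun u => expl t₁ x₁ x₂ β u k) (-explRate t₁ x₁ x₂ β t k) t := by
  have e : (fun t => expl t₁ x₁ x₂ β t k) = fun t =>
      x₁ k - zt x₁ x₂ β k * (1 - wt t₁ x₁ x₂ β t ^ ((k : ℝ) / 2)) := by
    ext t; exact expl_of_pos hk
  rw [e]
  have hw := h.wt_pos ht
  have hsg := h.sg_pos
  have h1 : HasDerivAt (wt t₁ x₁ x₂ β) (-(1 / sg x₁ x₂ β)) t := by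
    have := (((hasDerivAt_id t).sub_const t₁).div_const (sg x₁ x₂ β)).const_sub 1
    simpa using! this
  have h2 := (((h1.rpow_const (p := (k : ℝ) / 2) (Or.inl hw.ne')).const_sub 1).const_mul
    (zt x₁ x₂ β k)).const_sub (x₁ k)
  have e' : -explRate t₁ x₁ x₂ β t k = -(zt x₁ x₂ β k * -(-(1 / sg x₁ x₂ β) * ((k : ℝ) / 2) *
      wt t₁ x₁ x₂ β t ^ ((k : ℝ) / 2 - 1))) := by
    rw [explRate, if_neg (by omega), Real.rpow_sub_one hw.ne']
    field_simp
  rw [e']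
  exact h2

theorem vel_expl {k : ℕ} (hk : 1 ≤ k) (ht : t < t₁ + varsig x₁ x₂) :
    vel (expl t₁ x₁ x₂ β) t k = -explRate t₁ x₁ x₂ β t k := (h.hasDerivAt_expl hk ht).deriv

theorem explRate_nonneg (ht : t ∈ Ico t₁ (t₁ + varsig x₁ x₂)) (k : ℕ) :
    0 ≤ explRate t₁ x₁ x₂ β t k := by
  have hw := h.wt_pos ht.2
  have hsg := h.sg_pos
  unfold explRate
  refine div_nonneg ?_ (by positivity)
  split_ifs
  · exact h.expl_zero_nonneg (Ico_subset_Icc_self ht)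
  · exact mul_nonneg (mul_nonneg (Nat.cast_nonneg k) (h.zt_nonneg k)) (Real.rpow_nonneg hw.le _)

/-- The zeroth coordinate is by definition what completes `∑ k z̃_k w^(k/2)` to `2 ς̃ w`. -/
theorem hasSum_explRate (ht : t ∈ Ico t₁ (t₁ + varsig x₁ x₂)) :
    HasSum (explRate t₁ x₁ x₂ β t) 1 := by
  have hw := h.wt_pos ht.2
  have hsg := h.sg_pos
  have h1 := (hasSum_ite_eq (0 : ℕ) (expl t₁ x₁ x₂ β t 0)).add
    (h.expl_zero (Ico_subset_Icc_self ht))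
  have h2 := h1.div_const (2 * sg x₁ x₂ β * wt t₁ x₁ x₂ β t)
  rw [add_sub_cancel, div_self (by positivity)] at h2
  refine h2.congr_fun fun k => ?_
  unfold explRate
  by_cases hk : k = 0 <;> simp [hk]

theorem hasSum_vel_expl (ht : t ∈ Ico t₁ (t₁ + varsig x₁ x₂)) :
    HasSum (fun k => vel (expl t₁ x₁ x₂ β) t (k + 1)) (-(1 - explRate t₁ x₁ x₂ β t 0)) := by
  have h1 := ((hasSum_nat_add_iff' 1).2 (h.hasSum_explRate ht)).neg
  simp only [Finset.range_one, Finset.sum_singleton] at h1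
  exact h1.congr_fun fun k => h.vel_expl (by omega) ht.2

theorem nu_vel_expl (ht : t ∈ Ico t₁ (t₁ + varsig x₁ x₂)) (k : ℕ) :
    nu (vel (expl t₁ x₁ x₂ β) t) k = explRate t₁ x₁ x₂ β t k := by
  rcases Nat.eq_zero_or_pos k with rfl | hk
  · rw [nu, if_pos rfl, (h.hasSum_vel_expl ht).tsum_eq]; ring
  · rw [nu, if_neg (by omega), h.vel_expl hk ht.2, neg_neg]

theorem subVelocity_expl (ht : t ∈ Ioo t₁ (t₁ + varsig x₁ x₂)) :
    SubVelocity (vel (expl t₁ x₁ x₂ β) t) := by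
  have ht' := Ioo_subset_Ico_self ht
  refine subVelocity_of_neg_one_le (fun k hk => h.descentPath_expl.deriv_nonpos hk ht)
    (h.hasSum_vel_expl ht').summable ?_
  rw [(h.hasSum_vel_expl ht').tsum_eq]
  linarith [h.explRate_nonneg ht' 0]

theorem L_expl (ht : t ∈ Ioo t₁ (t₁ + varsig x₁ x₂)) :
    (L (expl t₁ x₁ x₂ β t) (vel (expl t₁ x₁ x₂ β) t)).toENNReal =
      ∑' k, klTerm (explRate t₁ x₁ x₂ β t k) (rk (expl t₁ x₁ x₂ β t) k) := by
  rw [h.descentPath_expl.L_eq h.summable₁ ht (h.subVelocity_expl ht), EReal.toENNReal_coe]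
  exact tsum_congr fun k => by rw [h.nu_vel_expl (Ioo_subset_Ico_self ht)]

theorem LCost_expl :
    LCost t₁ (t₁ + varsig x₁ x₂) (expl t₁ x₁ x₂ β) =
      ((∫⁻ t in Ioo t₁ (t₁ + varsig x₁ x₂),
        ∑' k, klTerm (explRate t₁ x₁ x₂ β t k) (rk (expl t₁ x₁ x₂ β t) k) : ℝ≥0∞) : EReal) := by
  rw [h.descentPath_expl.LCost_eq h.summable₁]
  congr 1
  exact setLIntegral_congr_fun measurableSet_Ioo fun t ht => h.L_expl ht

theorem LCost_tilde {ζs : ℝ → ℕ → ℝ} {ψs : ℝ → ℝ} (ht₁ : 0 ≤ t₁)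
    (hs : (ζs, ψs) ∈ J0 p 0 t₁ p x₁) :
    LCost t₁ (t₁ + varsig x₁ x₂) (tildeζ t₁ x₁ x₂ β ζs) =
      LCost t₁ (t₁ + varsig x₁ x₂) (expl t₁ x₁ x₂ β) := by
  have hlt : t₁ < t₁ + varsig x₁ x₂ := by linarith [h.varsig_pos]
  have hd := DescentPath.of_mem_J2 h.summable_p ht₁ hlt (h.tilde_mem_J2 ht₁ hs)
  simp only at hd
  rw [hd.LCost_eq h.summable₁, h.descentPath_expl.LCost_eq h.summable₁]
  congr 1
  refine setLIntegral_congr_fun measurableSet_Ioo fun t ht => ?_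
  have e : vel (tildeζ t₁ x₁ x₂ β ζs) t = vel (expl t₁ x₁ x₂ β) t := by
    ext k
    refine Filter.EventuallyEq.deriv_eq ?_
    filter_upwards [Ioo_mem_nhds ht.1 ht.2] with s hs'
    rw [h.tildeζ_eq hs.2.2 (Ioo_subset_Icc_self hs')]
  simp only [e, h.tildeζ_eq hs.2.2 (Ioo_subset_Icc_self ht)]

/-- Here `ζ̃_k = x₂ k + z̃_k (w^(k/2) - β^k)`, and `w > β²` before the final time. -/
theorem expl_pos {k : ℕ} (hk : 1 ≤ k) (hz : 0 < zt x₁ x₂ β k)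
    (ht : t ∈ Ico t₁ (t₁ + varsig x₁ x₂)) : 0 < expl t₁ x₁ x₂ β t k := by
  have h1 : β ^ k < wt t₁ x₁ x₂ β t ^ ((k : ℝ) / 2) := by
    rw [← rpow_half_sq h.beta_nonneg]
    exact Real.rpow_lt_rpow (sq_nonneg β) (h.sq_lt_wt ht.2) (by positivity)
  rw [expl_of_pos hk]
  have h2 := h.zt_mul hk
  have h3 := h.nonneg₂ k hk
  nlinarith [mul_pos hz (sub_pos.2 h1)]

theorem rk_expl (ht : t ∈ Ico t₁ (t₁ + varsig x₁ x₂)) (k : ℕ) :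
    rk (expl t₁ x₁ x₂ β t) k =
      (if k = 0 then expl t₁ x₁ x₂ β t 0 else (k : ℝ) * expl t₁ x₁ x₂ β t k) /
        (r x₁ - 2 * (t - t₁)) := by
  have ht' := Ico_subset_Icc_self ht
  rw [← h.expl_r ht']
  exact rk_eq (h.expl_zero_nonneg ht') (h.descentPath_expl.summable h.summable₁ ht')
    (h.descentPath_expl.r_pos ht) k

/-- The rates are absolutely continuous with respect to the `r_k`, which lets the quotient `ν_k /
r_k` serve as a control. -/
theorem explRate_eq_zero (ht : t ∈ Ico t₁ (t₁ + varsig x₁ x₂)) {k : ℕ}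
    (hr : rk (expl t₁ x₁ x₂ β t) k = 0) : explRate t₁ x₁ x₂ β t k = 0 := by
  have hpos := h.descentPath_expl.r_pos ht
  rw [h.expl_r (Ico_subset_Icc_self ht)] at hpos
  rw [h.rk_expl ht, div_eq_zero_iff, or_iff_left hpos.ne'] at hr
  rcases Nat.eq_zero_or_pos k with rfl | hk
  · rw [if_pos rfl] at hr
    rw [explRate, if_pos rfl, hr, zero_div]
  · have hk0 : k ≠ 0 := by omega
    rw [if_neg hk0] at hr
    have hk' : (k : ℝ) ≠ 0 := by exact_mod_cast hk0
    have h0 := (mul_eq_zero.1 hr).resolve_left hk'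
    have hz : zt x₁ x₂ β k = 0 := by
      by_contra hne
      exact (h.expl_pos hk (lt_of_le_of_ne (h.zt_nonneg k) (Ne.symm hne)) ht).ne' h0
    rw [explRate, if_neg hk0, hz, mul_zero, zero_mul, zero_div]

end Endpoints

/-! ### The optimal control of the explicit path -/

theorem lintegral_step_flow {m : ℝ} (hm : m ∈ Icc (0 : ℝ) 1) (c : ℝ≥0) :
    ∫⁻ y in Icc (0 : ℝ) 1, {y | y < m}.indicator
      (fun y => ((if y < m then c else 1 : ℝ≥0) : ℝ≥0∞)) y = c * ENNReal.ofReal m := by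
  rw [lintegral_indicator_lt hm.2, setLIntegral_congr_fun (g := fun _ => (c : ℝ≥0∞))
    measurableSet_Ico fun y hy => by simp [hy.2]]
  simp

theorem lintegral_step_cost {m : ℝ} (hm : m ∈ Icc (0 : ℝ) 1) (c : ℝ≥0) :
    ∫⁻ y in Icc (0 : ℝ) 1, ENNReal.ofReal (ell ((if y < m then c else 1 : ℝ≥0) : ℝ)) =
      ENNReal.ofReal (ell c) * ENNReal.ofReal m := by
  have e : ∀ y : ℝ, ENNReal.ofReal (ell ((if y < m then c else 1 : ℝ≥0) : ℝ)) =
      {y | y < m}.indicator (fun _ => ENNReal.ofReal (ell c)) y := by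
    intro y
    by_cases hy : y < m <;> simp [hy, ell, indicator]
  simp_rw [e]
  rw [lintegral_indicator_lt hm.2]
  simp

theorem ell_nonneg {u : ℝ} (hu : 0 ≤ u) : 0 ≤ ell u := by
  have := ell_tangent hu one_pos
  simpa using this

theorem klTerm_eq_ell {a m : ℝ} (ha : 0 ≤ a) (hm : 0 ≤ m) (h : m = 0 → a = 0) :
    ENNReal.ofReal (ell ((a / m).toNNReal : ℝ)) * ENNReal.ofReal m = klTerm a m := by
  rcases hm.eq_or_lt with h0 | h0
  · simp [klTerm, ← h0, h h0.symm]
  · rw [Real.coe_toNNReal _ (div_nonneg ha hm), ← ENNReal.ofReal_mul (ell_nonneg (div_nonneg ha hm)),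
      klTerm, if_neg h0.ne', ell]
    congr 1
    field_simp

theorem toNNReal_div_mul_ofReal {a m : ℝ} (ha : 0 ≤ a) (hm : 0 ≤ m) (h : m = 0 → a = 0) :
    ((a / m).toNNReal : ℝ≥0∞) * ENNReal.ofReal m = ENNReal.ofReal a := by
  rcases hm.eq_or_lt with h0 | h0
  · simp [← h0, h h0.symm]
  · change ENNReal.ofReal (a / m) * ENNReal.ofReal m = _
    rw [← ENNReal.ofReal_mul (div_nonneg ha hm), div_mul_cancel₀ _ h0.ne']

/-- The control that follows `φ` up to time `t₁` and has the rates `n` afterwards. -/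
def glueControl (t₁ : ℝ) (φ : ℕ → ℝ × ℝ → ℝ≥0) (m n : ℕ → ℝ → ℝ) (k : ℕ) (q : ℝ × ℝ) : ℝ≥0 :=
  if q.1 ≤ t₁ then φ k q else if q.2 < m k q.1 then (n k q.1 / m k q.1).toNNReal else 1

theorem measurable_glueControl {t₁ : ℝ} {φ : ℕ → ℝ × ℝ → ℝ≥0} {m n : ℕ → ℝ → ℝ} {k : ℕ}
    (hφ : Measurable (φ k)) (hm : Measurable (m k)) (hn : Measurable (n k)) :
    Measurable (glueControl t₁ φ m n k) := by
  unfold glueControl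
  refine Measurable.ite (measurableSet_le measurable_fst measurable_const) hφ ?_
  refine Measurable.ite (measurableSet_lt measurable_snd (hm.comp measurable_fst)) ?_
    measurable_const
  fun_prop

namespace Endpoints

variable {p x₁ x₂ : ℕ → ℝ} {β : ℝ} (h : Endpoints p x₁ x₂ β) {t₁ : ℝ} {ζs : ℝ → ℕ → ℝ}
  {ψs : ℝ → ℝ}
include h

theorem lintegral_explRate {k : ℕ} (hk : 1 ≤ k) {t : ℝ} (ht : t ∈ Icc t₁ (t₁ + varsig x₁ x₂)) :
    ∫⁻ s in Ioo t₁ t, ENNReal.ofReal (explRate t₁ x₁ x₂ β s k) =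
      ENNReal.ofReal (x₁ k - expl t₁ x₁ x₂ β t k) := by
  have h1 := lintegral_deriv_of_monotoneOn (h.expl_ac (t₁ := t₁) hk).neg
    (fun s hs u hu hsu => neg_le_neg (h.expl_antitone hk hs hu hsu)) ht
  rw [← Measure.restrict_congr_set Ioo_ae_eq_Ioc] at h1
  have e : -expl t₁ x₁ x₂ β t k - -expl t₁ x₁ x₂ β t₁ k = x₁ k - expl t₁ x₁ x₂ β t k := by
    rw [h.expl_left]; ring
  simp only [Pi.neg_apply, e] at h1
  rw [← h1]
  refine setLIntegral_congr_fun measurableSet_Ioo fun s hs => ?_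
  rw [deriv.neg, (h.hasDerivAt_expl hk (hs.2.trans_le ht.2)).deriv, neg_neg]

/-- The control constant in height below `r_k` turns Jensen's inequality into an equality, and `ℓ(1)
= 0` makes the rest free. -/
theorem pathCost_tilde_le (ht₁ : 0 ≤ t₁) (hs : (ζs, ψs) ∈ J0 p 0 t₁ p x₁)
    (hcost : pathCost p 0 t₁ ζs ψs < ⊤) :
    (pathCost p t₁ (t₁ + varsig x₁ x₂) (tildeζ t₁ x₁ x₂ β ζs) (tildeψ t₁ x₁ x₂ β ψs) : EReal) ≤
      LCost t₁ (t₁ + varsig x₁ x₂) (expl t₁ x₁ x₂ β) := by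
  -- Finite cost supplies a control on `[0, t₁]`; its own cost does not enter, since the cost is
  -- counted from `t₁` on.
  obtain ⟨φ, hφ⟩ : ∃ φ, IsControl p t₁ ζs ψs φ := by
    by_contra hne
    push Not at hne
    simp [pathCost, hne] at hcost
  have hle : t₁ ≤ t₁ + varsig x₁ x₂ := by linarith [h.varsig_pos]
  have hT : 0 ≤ t₁ + varsig x₁ x₂ := ht₁.trans hle
  have hadm := h.admissible_tilde ht₁ hs
  obtain ⟨m, hm, hmeq⟩ := hadm.exists_measurable_rk hT h.summable_p
  set n : ℕ → ℝ → ℝ := fun k s => explRate t₁ x₁ x₂ β s k with hn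
  have hmn : ∀ k, Measurable (n k) := measurable_explRate t₁ x₁ x₂ β
  set φ' := glueControl t₁ φ m n with hφ'
  have hmφ : ∀ k, Measurable (φ' k) := fun k => measurable_glueControl (hφ.meas k) (hm k) (hmn k)
  have eζ : ∀ t ≤ t₁, tildeζ t₁ x₁ x₂ β ζs t = ζs t := fun t ht => by ext k; simp [tildeζ, ht]
  have hmexpl : ∀ k, ∀ s ∈ Icc t₁ (t₁ + varsig x₁ x₂), m k s = rk (expl t₁ x₁ x₂ β s) k :=
    fun k s hs' => by
      rw [hmeq k s ⟨ht₁.trans hs'.1, hs'.2⟩, h.tildeζ_eq hs.2.2 hs']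
  have hm01 : ∀ k, ∀ s ∈ Icc t₁ (t₁ + varsig x₁ x₂), m k s ∈ Icc (0 : ℝ) 1 := by
    intro k s hs'
    rw [hmexpl k s hs']
    have hx : ∀ j, 1 ≤ j → 0 ≤ expl t₁ x₁ x₂ β s j := fun j hj => h.expl_nonneg hj hs'
    exact ⟨rk_nonneg hx k, rk_le_one hx k⟩
  have hzero : ∀ k, ∀ s ∈ Ico t₁ (t₁ + varsig x₁ x₂), m k s = 0 → n k s = 0 := by
    intro k s hs' h0
    rw [hmexpl k s (Ico_subset_Icc_self hs')] at h0
    exact h.explRate_eq_zero hs' h0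
  have hrate : ∀ k, ∀ s ∈ Ioo t₁ (t₁ + varsig x₁ x₂),
      rate (m k) (φ' k) s = ENNReal.ofReal (n k s) := by
    intro k s hs'
    have hI := hm01 k s (Ioo_subset_Icc_self hs')
    have e := lintegral_step_flow hI (n k s / m k s).toNNReal
    rw [toNNReal_div_mul_ofReal (h.explRate_nonneg (Ioo_subset_Ico_self hs') k) hI.1
      (hzero k s (Ioo_subset_Ico_self hs'))] at e
    rw [← e, rate]
    simp only [hφ', glueControl, hs'.1.not_ge, if_false]
  have hflow₁ : ∀ k, ∀ t ∈ Icc 0 t₁,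
      flow (tildeζ t₁ x₁ x₂ β ζs) φ' k t = flow ζs φ k t := by
    intro k t ht
    unfold flow
    refine setLIntegral_congr_fun (measurableSet_Icc.prod measurableSet_Icc) fun q hq => ?_
    have hq1 : q.1 ≤ t₁ := hq.1.2.trans ht.2
    simp only [indicator, mem_ofPred_eq, eζ q.1 hq1, hφ', glueControl, hq1, if_true]
  have hflow₂ : ∀ k, ∀ t ∈ Icc t₁ (t₁ + varsig x₁ x₂),
      flow (tildeζ t₁ x₁ x₂ β ζs) φ' k t =
        flow ζs φ k t₁ + ∫⁻ s in Ioo t₁ t, ENNReal.ofReal (n k s) := by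
    intro k t ht
    rw [← hflow₁ k t₁ ⟨ht₁, le_rfl⟩,
      flow_eq_lintegral_rate (hm k) (hmφ k)
        fun s hs' => hmeq k s ⟨hs'.1, hs'.2.trans ht.2⟩,
      flow_eq_lintegral_rate (hm k) (hmφ k)
        fun s hs' => hmeq k s ⟨hs'.1, hs'.2.trans hle⟩,
      setLIntegral_Icc_add_Ioc ht₁ ht.1,
      ← Measure.restrict_congr_set (Ioo_ae_eq_Ioc (a := t₁) (b := t))]
    congr 1
    exact setLIntegral_congr_fun measurableSet_Ioo
      fun s hs' => hrate k s ⟨hs'.1, hs'.2.trans_le ht.2⟩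
  have htot : ∀ t ∈ Icc t₁ (t₁ + varsig x₁ x₂),
      ∑' k, ∫⁻ s in Ioo t₁ t, ENNReal.ofReal (n k s) = ENNReal.ofReal (t - t₁) := by
    intro t ht
    rw [← lintegral_tsum fun k => (hmn k).ennreal_ofReal.aemeasurable,
      setLIntegral_congr_fun (g := fun _ => 1) measurableSet_Ioo fun s hs' => ?_]
    · simp
    · have hs'' : s ∈ Ico t₁ (t₁ + varsig x₁ x₂) := ⟨hs'.1.le, hs'.2.trans_le ht.2⟩
      have h1 := h.hasSum_explRate hs''
      simp only [hn]
      rw [← ENNReal.ofReal_tsum_of_nonneg (h.explRate_nonneg hs'') h1.summable, h1.tsum_eq,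
        ENNReal.ofReal_one]
  have hfin : ∀ k, ∀ t ∈ Icc t₁ (t₁ + varsig x₁ x₂),
      ∫⁻ s in Ioo t₁ t, ENNReal.ofReal (n k s) ≠ ⊤ := fun k t ht => by
    refine ne_top_of_le_ne_top (b := ENNReal.ofReal (t - t₁)) ENNReal.ofReal_ne_top ?_
    rw [← htot t ht]
    exact ENNReal.le_tsum k
  have htot' : ∀ t ∈ Icc t₁ (t₁ + varsig x₁ x₂),
      HasSum (fun k => (∫⁻ s in Ioo t₁ t, ENNReal.ofReal (n k s)).toReal) (t - t₁) := by
    intro t ht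
    have h1 := (ENNReal.summable_toReal (by
      rw [htot t ht]; exact ENNReal.ofReal_ne_top)).hasSum
    rwa [← ENNReal.tsum_toReal_eq fun k => hfin k t ht, htot t ht,
      ENNReal.toReal_ofReal (sub_nonneg.2 ht.1)] at h1
  have hk_eq : ∀ k, 1 ≤ k → ∀ t ∈ Icc t₁ (t₁ + varsig x₁ x₂),
      (∫⁻ s in Ioo t₁ t, ENNReal.ofReal (n k s)).toReal = x₁ k - expl t₁ x₁ x₂ β t k := by
    intro k hk t ht
    simp only [hn]
    rw [h.lintegral_explRate hk ht, ENNReal.toReal_ofReal]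
    exact sub_nonneg.2 (h.descentPath_expl.le_left hk ht)
  have hcontrol : IsControl p (t₁ + varsig x₁ x₂) (tildeζ t₁ x₁ x₂ β ζs)
      (tildeψ t₁ x₁ x₂ β ψs) φ' := by
    have hl : t₁ ∈ Icc 0 t₁ := ⟨ht₁, le_rfl⟩
    refine ⟨hmφ, fun k t ht => ?_, fun t ht => ?_, fun k hk t ht => ?_⟩
    · rcases le_total t t₁ with h' | h'
      · rw [hflow₁ k t ⟨ht.1, h'⟩]; exact hφ.finite k t ⟨ht.1, h'⟩
      · rw [hflow₂ k t ⟨h', ht.2⟩]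
        exact ENNReal.add_ne_top.2 ⟨hφ.finite k t₁ hl, hfin k t ⟨h', ht.2⟩⟩
    · rcases le_total t t₁ with h' | h'
      · rw [show tildeψ t₁ x₁ x₂ β ψs t = ψs t by simp [tildeψ, h']]
        refine (hφ.eq_ψ t ⟨ht.1, h'⟩).congr_fun fun k => ?_
        rw [hflow₁ k t ⟨ht.1, h'⟩]
      · have ht' : t ∈ Icc t₁ (t₁ + varsig x₁ x₂) := ⟨h', ht.2⟩
        -- The increments satisfy `∑ (k - 2) Δ_k = ∑ k Δ_k - 2 ∑ Δ_k`: the decrease identity minus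
        -- twice the total mass `t - t₁`.
        have h1 := ((hφ.eq_ψ t₁ hl).add (h.expl_hasSum_decrease ht')).sub ((htot' t ht').mul_left 2)
        rw [h.tildeψ_eq ht', show ψs t₁ + (expl t₁ x₁ x₂ β t 0 - x₁ 0) =
          ψs t₁ + (expl t₁ x₁ x₂ β t 0 - x₁ 0 + 2 * (t - t₁)) - 2 * (t - t₁) by ring]
        refine h1.congr_fun fun k => ?_
        rw [hflow₂ k t ht', ENNReal.toReal_add (hφ.finite k t₁ hl) (hfin k t ht')]
        rcases Nat.eq_zero_or_pos k with rfl | hk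
        · simp; ring
        · rw [← hk_eq k hk t ht']; ring
    · rcases le_total t t₁ with h' | h'
      · rw [hflow₁ k t ⟨ht.1, h'⟩, eζ t h']; exact hφ.eq_ζ k hk t ⟨ht.1, h'⟩
      · have ht' : t ∈ Icc t₁ (t₁ + varsig x₁ x₂) := ⟨h', ht.2⟩
        have h1 := hφ.eq_ζ k hk t₁ hl
        have hx : ζs t₁ = x₁ := hs.2.2
        rw [hx] at h1
        rw [hflow₂ k t ht', ENNReal.toReal_add (hφ.finite k t₁ hl) (hfin k t ht'),
          hk_eq k hk t ht', h.tildeζ_eq hx ht']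
        linarith
  rw [h.LCost_expl, EReal.coe_ennreal_le_coe_ennreal_iff]
  refine (iInf₂_le φ' hcontrol).trans ?_
  rw [controlCost_eq hmφ, ← Measure.restrict_congr_set
    (Ioo_ae_eq_Icc (a := t₁) (b := t₁ + varsig x₁ x₂))]
  refine (setLIntegral_congr_fun measurableSet_Ioo fun s hs' => ?_).le
  refine tsum_congr fun k => ?_
  have hI := hm01 k s (Ioo_subset_Icc_self hs')
  have e := lintegral_step_cost hI (n k s / m k s).toNNReal
  rw [klTerm_eq_ell (h.explRate_nonneg (Ioo_subset_Ico_self hs') k) hI.1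
    (hzero k s (Ioo_subset_Ico_self hs')), hmexpl k s (Ioo_subset_Icc_self hs')] at e
  rw [← e]
  simp only [hφ', glueControl, hs'.1.not_ge, if_false, hmexpl k s (Ioo_subset_Icc_self hs')]

end Endpoints

/-! ### The function `v log v - v` -/

/-- `v log v - v`. -/
def entF (v : ℝ) : ℝ := v * Real.log v - v

theorem continuous_entF : Continuous entF := by
  unfold entF
  exact Real.continuous_mul_log.sub continuous_id

theorem hasDerivAt_entF {v : ℝ} (hv : v ≠ 0) : HasDerivAt entF (Real.log v) v := by
  have := (Real.hasDerivAt_mul_log hv).sub (hasDerivAt_id v)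
  simpa [entF] using! this

theorem entF_tangent {u θ : ℝ} (hu : 0 ≤ u) (hθ : 0 < θ) : u * Real.log θ - θ ≤ entF u := by
  have := ell_tangent hu hθ
  unfold ell at this
  unfold entF
  linarith

/-- Convexity bounds the difference by `(a - b) log a` above and `(a - b) log b` below. The gap is
at most 1, so growth in `a` is at most linear, which makes the entropy series dominated. -/
theorem abs_entF_sub_le {a b : ℝ} (hb : 0 ≤ b) (hba : b ≤ a) (hab : a ≤ b + 1) :
    |entF a - entF b| ≤ 1 + a := by
  have ha := hb.trans hba
  rw [abs_le]
  constructor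
  · have h1 : -1 ≤ entF a := by simpa using entF_tangent ha one_pos
    rcases le_or_gt b 1 with h | h
    · have h2 : entF b ≤ 0 := by
        unfold entF
        have := mul_nonpos_of_nonneg_of_nonpos hb (Real.log_nonpos hb h)
        linarith
      linarith
    · have h2 := entF_tangent ha (by linarith : 0 < b)
      have h3 : entF a - entF b ≥ (a - b) * Real.log b := by unfold entF at *; linarith
      have h4 := mul_nonneg (sub_nonneg.2 hba) (Real.log_nonneg h.le)
      linarith
  · rcases ha.eq_or_lt with h0 | h0
    · have : b = 0 := le_antisymm (hba.trans h0.symm.le) hb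
      simp [this, ← h0]
    · have h2 := entF_tangent hb h0
      have h3 : entF a - entF b ≤ (a - b) * Real.log a := by unfold entF at *; linarith
      have h4 : (a - b) * Real.log a ≤ a := by
        rcases le_or_gt a 1 with h | h
        · exact (mul_nonpos_of_nonneg_of_nonpos (sub_nonneg.2 hba)
            (Real.log_nonpos ha h)).trans ha
        · have hl := Real.log_nonneg h.le
          have hl' := Real.log_le_self ha
          nlinarith
      linarith

/-- `z v log v - z v` for `v = x / z`. -/
def entQ (z x : ℝ) : ℝ := z * entF (x / z)

theorem entQ_zero (x : ℝ) : entQ 0 x = 0 := by simp [entQ]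

theorem continuous_entQ (z : ℝ) : Continuous (entQ z) :=
  continuous_const.mul (continuous_entF.comp (continuous_id.div_const z))

theorem entQ_eq {z x : ℝ} (hz : 0 < z) : entQ z x = entF x - x * Real.log z := by
  unfold entQ entF
  rcases eq_or_ne x 0 with rfl | hx
  · simp
  · rw [Real.log_div hx hz.ne']
    field_simp
    ring

/-- Dividing by `z` reduces to a gap of at most 1, which fits coordinates that move by no more than
`z_k ≤ z̃_k`. -/
theorem abs_entQ_sub_le {z x y : ℝ} (hz : 0 ≤ z) (hx : 0 ≤ x) (hxy : x ≤ y) (hyx : y - x ≤ z) :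
    |entQ z y - entQ z x| ≤ z + y := by
  rcases hz.eq_or_lt with rfl | hz
  · simpa [entQ_zero] using hx.trans hxy
  · unfold entQ
    rw [← mul_sub, abs_mul, abs_of_pos hz]
    have h1 : y / z ≤ x / z + 1 := by
      rw [div_add_one hz.ne']
      gcongr
      linarith
    have := abs_entF_sub_le (div_nonneg hx hz.le) (by gcongr : x / z ≤ y / z) h1
    calc z * |entF (y / z) - entF (x / z)| ≤ z * (1 + y / z) := by gcongr
      _ = z + y := by field_simp

theorem integral_deriv_mul_log {f : ℝ → ℝ} {a b ε : ℝ} (hab : a ≤ b)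
    (hf : AbsolutelyContinuousOnInterval f a b) (hpos : ∀ t ∈ Icc a b, 0 < f t + ε) :
    ∫ t in a..b, deriv f t * Real.log (f t + ε) = entF (f b + ε) - entF (f a + ε) := by
  have hc := hf.continuousOn
  rw [uIcc_of_le hab] at hc
  obtain ⟨t₀, ht₀, hmin⟩ := isCompact_Icc.exists_isMinOn (nonempty_Icc.2 hab) hc
  obtain ⟨t₁, ht₁, hmax⟩ := isCompact_Icc.exists_isMaxOn (nonempty_Icc.2 hab) hc
  have hcd : ContDiffOn ℝ 1 (fun u => entF (u + ε)) (Icc (f t₀) (f t₁)) := by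
    intro u hu
    have h0 : u + ε ≠ 0 := by linarith [hpos t₀ ht₀, hu.1]
    unfold entF
    have : ContDiffWithinAt ℝ 1 (fun u : ℝ => u + ε) (Icc (f t₀) (f t₁)) u := by fun_prop
    exact (this.mul (this.log h0)).sub this
  obtain ⟨K, hK⟩ := hcd.exists_lipschitzOnWith (by decide) (convex_Icc _ _) isCompact_Icc
  have hac := ac_comp_lipschitz hf hK fun t ht => by
    rw [uIcc_of_le hab] at ht
    exact ⟨hmin ht, hmax ht⟩
  rw [← hac.integral_deriv_eq_sub]
  refine intervalIntegral.integral_congr_ae ?_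
  filter_upwards [hf.ae_differentiableAt] with t ht hmem
  have hmem' := uIoc_subset_uIcc hmem
  have hd := (ht hmem').hasDerivAt
  rw [uIcc_of_le hab] at hmem'
  have := (hasDerivAt_entF (hpos t hmem').ne').comp t (hd.add_const ε)
  rw [mul_comm]
  exact this.deriv.symm

theorem ofReal_integral_le_setLIntegral {g : ℝ → ℝ} {c : ℝ → ℝ≥0∞} {a b : ℝ} (hab : a ≤ b)
    (hg : IntervalIntegrable g volume a b)
    (h : ∀ᵐ t, t ∈ Ioo a b → ENNReal.ofReal (g t) ≤ c t) :
    ENNReal.ofReal (∫ t in a..b, g t) ≤ ∫⁻ t in Ioo a b, c t := by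
  rw [intervalIntegrable_iff_integrableOn_Ioo_of_le hab] at hg
  rw [intervalIntegral.integral_of_le hab, integral_Ioc_eq_integral_Ioo]
  refine (ofReal_integral_le_lintegral hg).trans (lintegral_mono_ae ?_)
  rwa [ae_restrict_iff' measurableSet_Ioo]

theorem setLIntegral_eq_ofReal_integral {g : ℝ → ℝ} {c : ℝ → ℝ≥0∞} {a b : ℝ} (hab : a ≤ b)
    (hg : IntervalIntegrable g volume a b) (h0 : ∀ t ∈ Ioo a b, 0 ≤ g t)
    (h : ∀ t ∈ Ioo a b, c t = ENNReal.ofReal (g t)) :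
    ∫⁻ t in Ioo a b, c t = ENNReal.ofReal (∫ t in a..b, g t) := by
  rw [intervalIntegrable_iff_integrableOn_Ioo_of_le hab] at hg
  rw [intervalIntegral.integral_of_le hab, integral_Ioc_eq_integral_Ioo,
    ofReal_integral_eq_lintegral_ofReal hg]
  · exact setLIntegral_congr_fun measurableSet_Ioo h
  · filter_upwards [ae_restrict_mem measurableSet_Ioo] with t ht using h0 t ht

/-! ### Properties of the rates along a path -/

theorem measurable_nu_vel (ζ : ℝ → ℕ → ℝ) (k : ℕ) : Measurable fun t => nu (vel ζ t) k := by
  unfold nu vel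
  split_ifs
  · exact measurable_const.add (Measurable.tsum fun j => measurable_deriv _)
  · exact (measurable_deriv _).neg

theorem measurableSet_subVelocity (ζ : ℝ → ℕ → ℝ) : MeasurableSet {t | SubVelocity (vel ζ t)} := by
  have e : {t | SubVelocity (vel ζ t)} =
      ⋂ n : ℕ, {t | ∑ j ∈ Finset.range n, -vel ζ t (j + 1) ≤ 1} := by
    ext t; simp [SubVelocity]
  rw [e]
  refine MeasurableSet.iInter fun n => measurableSet_le ?_ measurable_const
  exact Finset.measurable_fun_sum _ fun j _ => (measurable_deriv _).neg

section Path

variable {x₁ x₂ : ℕ → ℝ} {a b : ℝ} {ζ : ℝ → ℕ → ℝ}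

theorem DescentPath.continuousOn (h : DescentPath x₁ x₂ a b ζ)
    (hs : Summable fun k : ℕ => (k : ℝ) * x₁ k) (hab : a ≤ b) (k : ℕ) :
    ContinuousOn (fun t => ζ t k) (Icc a b) := by
  have hpos : ∀ k, 1 ≤ k → ContinuousOn (fun t => ζ t k) (Icc a b) := fun k hk => by
    have := (h.ac k hk).continuousOn
    rwa [uIcc_of_le hab] at this
  rcases Nat.eq_zero_or_pos k with rfl | hk
  · have h1 : ContinuousOn (fun t => ∑' k : ℕ, (k : ℝ) * (x₁ k - ζ t k)) (Icc a b) := by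
      refine continuousOn_tsum (fun k => ?_) hs fun k t ht => ?_
      · rcases Nat.eq_zero_or_pos k with rfl | hk
        · simpa using! continuousOn_const
        · exact continuousOn_const.mul (continuousOn_const.sub (hpos k hk))
      · rcases Nat.eq_zero_or_pos k with rfl | hk
        · simp
        · rw [Real.norm_of_nonneg (mul_nonneg (Nat.cast_nonneg k)
            (sub_nonneg.2 (h.le_left hk ht)))]
          have := h.nonneg k hk t ht
          gcongr
          linarith
    have h2 : ContinuousOn (fun t => ∑' k : ℕ, (k : ℝ) * (x₁ k - ζ t k) + x₁ 0 - 2 * (t - a))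
        (Icc a b) := (h1.add continuousOn_const).sub (by fun_prop)
    refine h2.congr fun t ht => ?_
    simp only
    rw [(h.hasSum_decrease hs hab ht).tsum_eq]; ring
  · exact hpos k hk

theorem DescentPath.rk_eq' (h : DescentPath x₁ x₂ a b ζ)
    (hs : Summable fun k : ℕ => (k : ℝ) * x₁ k) {t : ℝ} (ht : t ∈ Ico a b) (k : ℕ) :
    rk (ζ t) k = (if k = 0 then ζ t 0 else (k : ℝ) * ζ t k) / (r x₁ - 2 * (t - a)) := by
  have ht' := Ico_subset_Icc_self ht
  rw [← h.r_eq t ht']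
  exact rk_eq (h.zero_nonneg t ht') (h.summable hs ht') (h.r_pos ht) k

theorem DescentPath.intervalIntegrable_nu (h : DescentPath x₁ x₂ a b ζ) {s : ℝ} (hs : s ∈ Icc a b)
    (hv : ∀ᵐ t, t ∈ Ioo a b → SubVelocity (vel ζ t)) (k : ℕ) :
    IntervalIntegrable (fun t => nu (vel ζ t) k) volume a s := by
  rw [intervalIntegrable_iff_integrableOn_Ioo_of_le hs.1]
  refine Measure.integrableOn_of_bounded (M := 1) (by simp)
    (measurable_nu_vel ζ k).aestronglyMeasurable ?_
  rw [ae_restrict_iff' measurableSet_Ioo]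
  filter_upwards [hv] with t ht hmem
  have hmem' : t ∈ Ioo a b := ⟨hmem.1, hmem.2.trans_le hs.2⟩
  have hb : ∀ k : ℕ, 1 ≤ k → vel ζ t k ≤ 0 := fun k hk => h.deriv_nonpos hk hmem'
  have h0 := nu_nonneg hb (ht hmem')
  rw [Real.norm_of_nonneg (h0 k)]
  exact le_hasSum (hasSum_nu ((ht hmem').summable hb)) k fun j _ => h0 j

/-- The rates form a probability vector for almost every `t`; dominated convergence exchanges sum
and integral. -/
theorem DescentPath.hasSum_integral_nu_mul (h : DescentPath x₁ x₂ a b ζ) {s : ℝ}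
    (hs : s ∈ Icc a b) (hv : ∀ᵐ t, t ∈ Ioo a b → SubVelocity (vel ζ t)) {g : ℝ → ℝ}
    (hg : ContinuousOn g (Icc a s)) :
    HasSum (fun k => ∫ t in a..s, nu (vel ζ t) k * g t) (∫ t in a..s, g t) := by
  obtain ⟨C, hC⟩ := isCompact_Icc.exists_bound_of_continuousOn hg
  have hne : ∀ᵐ t : ℝ, t ≠ s := by simp [ae_iff, measure_singleton]
  have hgood : ∀ᵐ t, t ∈ uIoc a s → (∀ k, 0 ≤ nu (vel ζ t) k) ∧ HasSum (nu (vel ζ t)) 1 := by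
    filter_upwards [hv, hne] with t ht hts hmem
    rw [uIoc_of_le hs.1] at hmem
    have hmem' : t ∈ Ioo a b := ⟨hmem.1, (lt_of_le_of_ne hmem.2 hts).trans_le hs.2⟩
    have hb : ∀ k : ℕ, 1 ≤ k → vel ζ t k ≤ 0 := fun k hk => h.deriv_nonpos hk hmem'
    exact ⟨nu_nonneg hb (ht hmem'), hasSum_nu ((ht hmem').summable hb)⟩
  refine intervalIntegral.hasSum_integral_of_dominated_convergence
    (fun k t => nu (vel ζ t) k * C) (fun k => ?_) (fun k => ?_) ?_ ?_ ?_
  · refine (measurable_nu_vel ζ k).aestronglyMeasurable.mul ?_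
    rw [uIoc_of_le hs.1]
    exact (hg.mono Ioc_subset_Icc_self).aestronglyMeasurable measurableSet_Ioc
  · filter_upwards [hgood] with t ht hmem
    rw [norm_mul, Real.norm_of_nonneg ((ht hmem).1 k)]
    rw [uIoc_of_le hs.1] at hmem
    have hmem' := hmem
    refine mul_le_mul_of_nonneg_left (hC t (Ioc_subset_Icc_self hmem)) ?_
    rw [← uIoc_of_le hs.1] at hmem'
    exact (ht hmem').1 k
  · filter_upwards [hgood] with t ht hmem
    exact ((ht hmem).2.mul_right C).summable
  · refine (intervalIntegrable_const (c := C)).congr_ae ?_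
    rw [Filter.EventuallyEq, ae_restrict_iff' measurableSet_uIoc]
    filter_upwards [hgood] with t ht hmem
    rw [((ht hmem).2.mul_right C).tsum_eq, one_mul]
  · filter_upwards [hgood] with t ht hmem
    simpa using (ht hmem).2.mul_right (g t)

theorem DescentPath.continuousOn_rk (h : DescentPath x₁ x₂ a b ζ)
    (hs₁ : Summable fun k : ℕ => (k : ℝ) * x₁ k) {s : ℝ} (hs : s ∈ Ico a b) (k : ℕ) :
    ContinuousOn (fun t => rk (ζ t) k) (Icc a s) := by
  have hab : a ≤ b := hs.1.trans hs.2.le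
  have hsub : Icc a s ⊆ Icc a b := Icc_subset_Icc_right hs.2.le
  have hc := fun k => (h.continuousOn hs₁ hab k).mono hsub
  have h1 : ContinuousOn (fun t => (if k = 0 then ζ t 0 else (k : ℝ) * ζ t k) /
      (r x₁ - 2 * (t - a))) (Icc a s) := by
    refine ContinuousOn.div ?_ (by fun_prop) fun t ht => ?_
    · split_ifs
      · exact hc 0
      · exact continuousOn_const.mul (hc k)
    · have := h.r_pos (t := t) ⟨ht.1, ht.2.trans_lt hs.2⟩
      rw [h.r_eq t (hsub ht)] at this
      exact this.ne'
  exact h1.congr fun t ht => h.rk_eq' hs₁ ⟨ht.1, ht.2.trans_lt hs.2⟩ k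

theorem DescentPath.hasSum_integral_rk (h : DescentPath x₁ x₂ a b ζ)
    (hs₁ : Summable fun k : ℕ => (k : ℝ) * x₁ k) {s : ℝ} (hs : s ∈ Ico a b) :
    HasSum (fun k => ∫ t in a..s, rk (ζ t) k) (s - a) := by
  have hgood : ∀ t ∈ uIoc a s, (∀ k, 0 ≤ rk (ζ t) k) ∧ HasSum (rk (ζ t)) 1 := by
    intro t hmem
    rw [uIoc_of_le hs.1] at hmem
    have ht : t ∈ Ico a b := ⟨hmem.1.le, hmem.2.trans_lt hs.2⟩
    exact ⟨rk_nonneg fun k hk => h.nonneg k hk t (Ico_subset_Icc_self ht),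
      hasSum_rk (h.summable hs₁ (Ico_subset_Icc_self ht)) (h.r_pos ht)⟩
  have := intervalIntegral.hasSum_integral_of_dominated_convergence (μ := volume) (a := a) (b := s)
    (F := fun k t => rk (ζ t) k) (f := fun _ => (1 : ℝ)) (fun k t => rk (ζ t) k) (fun k => ?_)
    (fun k => ?_) ?_ ?_ ?_
  · simpa using this
  · rw [uIoc_of_le hs.1]
    exact ((h.continuousOn_rk hs₁ hs k).mono Ioc_subset_Icc_self).aestronglyMeasurable
      measurableSet_Ioc
  · exact Filter.Eventually.of_forall fun t ht => by
      rw [Real.norm_of_nonneg ((hgood t ht).1 k)]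
  · exact Filter.Eventually.of_forall fun t ht => (hgood t ht).2.summable
  · refine (intervalIntegrable_const (c := (1 : ℝ))).congr_ae ?_
    rw [Filter.EventuallyEq, ae_restrict_iff' measurableSet_uIoc]
    exact Filter.Eventually.of_forall fun t ht => (hgood t ht).2.tsum_eq.symm
  · exact Filter.Eventually.of_forall fun t ht => (hgood t ht).2

end Path

/-! ### The action of a path, coordinate by coordinate -/

/-- `κ(t) = r(ζ(t)) / (2 ς̃ w(t))`, the same for all paths between `x₁` and `x₂`. -/
def kap (t₁ : ℝ) (x₁ x₂ : ℕ → ℝ) (β t : ℝ) : ℝ :=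
  (r x₁ - 2 * (t - t₁)) / (2 * sg x₁ x₂ β * wt t₁ x₁ x₂ β t)

/-- The part of the action of a path up to time `s` whose sum over the coordinates depends on the
path only through the position of the zeroth coordinate at time `s`. -/
def bulk (t₁ : ℝ) (x₁ x₂ : ℕ → ℝ) (β : ℝ) (ζ : ℝ → ℕ → ℝ) (s : ℝ) (k : ℕ) : ℝ :=
  (∫ t in t₁..s, nu (vel ζ t) k * Real.log (kap t₁ x₁ x₂ β t)) +
    (k : ℝ) / 2 * (∫ t in t₁..s, nu (vel ζ t) k * Real.log (wt t₁ x₁ x₂ β t)) +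
    (∫ t in t₁..s, rk (ζ t) k) -
    (if k = 0 then ∫ t in t₁..s, ζ t 0 * (2 * sg x₁ x₂ β * wt t₁ x₁ x₂ β t)⁻¹ else 0)

/-- The tangent lower bound for the cost of the `k`-th coordinate up to time `s`. -/
def action (t₁ : ℝ) (x₁ x₂ : ℕ → ℝ) (β : ℝ) (ζ : ℝ → ℕ → ℝ) (s : ℝ) (k : ℕ) : ℝ :=
  bulk t₁ x₁ x₂ β ζ s k +
    (entQ (zt x₁ x₂ β k) (ζ s k) - entQ (zt x₁ x₂ β k) (x₁ k)) -
    (if k = 0 then 0 else ∫ t in t₁..s, explRate t₁ x₁ x₂ β t k)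

namespace Endpoints

variable {p x₁ x₂ : ℕ → ℝ} {β : ℝ} (h : Endpoints p x₁ x₂ β) {t₁ s t : ℝ}
include h

theorem mass_pos (ht : t ∈ Ico t₁ (t₁ + varsig x₁ x₂)) : 0 < r x₁ - 2 * (t - t₁) := by
  have := h.descentPath_expl.r_pos ht
  rwa [h.expl_r (Ico_subset_Icc_self ht)] at this

theorem denom_pos (ht : t < t₁ + varsig x₁ x₂) : 0 < 2 * sg x₁ x₂ β * wt t₁ x₁ x₂ β t :=
  mul_pos (mul_pos two_pos h.sg_pos) (h.wt_pos ht)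

theorem kap_pos (ht : t ∈ Ico t₁ (t₁ + varsig x₁ x₂)) : 0 < kap t₁ x₁ x₂ β t :=
  div_pos (h.mass_pos ht) (h.denom_pos ht.2)

theorem continuousOn_log_wt (hs : s < t₁ + varsig x₁ x₂) :
    ContinuousOn (fun t => Real.log (wt t₁ x₁ x₂ β t)) (Icc t₁ s) := by
  refine ContinuousOn.log (by unfold wt; fun_prop) fun t ht => ?_
  exact (h.wt_pos (ht.2.trans_lt hs)).ne'

theorem continuousOn_inv_denom (hs : s < t₁ + varsig x₁ x₂) :
    ContinuousOn (fun t => (2 * sg x₁ x₂ β * wt t₁ x₁ x₂ β t)⁻¹) (Icc t₁ s) := by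
  refine ContinuousOn.inv₀ (by unfold wt; fun_prop) fun t ht => ?_
  exact (h.denom_pos (ht.2.trans_lt hs)).ne'

theorem continuousOn_log_kap (hs : s < t₁ + varsig x₁ x₂) :
    ContinuousOn (fun t => Real.log (kap t₁ x₁ x₂ β t)) (Icc t₁ s) := by
  refine ContinuousOn.log ?_ fun t ht => (h.kap_pos ⟨ht.1, ht.2.trans_lt hs⟩).ne'
  unfold kap
  refine ContinuousOn.div (by fun_prop) (by unfold wt; fun_prop) fun t ht => ?_
  exact (h.denom_pos (ht.2.trans_lt hs)).ne'

theorem hasDerivAt_log_wt (ht : t < t₁ + varsig x₁ x₂) :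
    HasDerivAt (fun u => Real.log (wt t₁ x₁ x₂ β u))
      (-(2 * (2 * sg x₁ x₂ β * wt t₁ x₁ x₂ β t)⁻¹)) t := by
  have h1 : HasDerivAt (wt t₁ x₁ x₂ β) (-(1 / sg x₁ x₂ β)) t := by
    have := (((hasDerivAt_id t).sub_const t₁).div_const (sg x₁ x₂ β)).const_sub 1
    simpa using! this
  have h2 := h1.log (h.wt_pos ht).ne'
  have e : -(2 * (2 * sg x₁ x₂ β * wt t₁ x₁ x₂ β t)⁻¹) =
      -(1 / sg x₁ x₂ β) / wt t₁ x₁ x₂ β t := by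
    have := (h.wt_pos ht).ne'
    have := h.sg_pos.ne'
    field_simp
  rw [e]
  exact h2

theorem ac_log_wt (hs : s ∈ Ico t₁ (t₁ + varsig x₁ x₂)) :
    AbsolutelyContinuousOnInterval (fun u => Real.log (wt t₁ x₁ x₂ β u)) t₁ s := by
  apply ContDiffOn.absolutelyContinuousOnInterval
  rw [uIcc_of_le hs.1]
  have hw : ContDiff ℝ 1 (wt t₁ x₁ x₂ β) := by unfold wt; fun_prop
  exact hw.contDiffOn.log fun t ht => (h.wt_pos (ht.2.trans_lt hs.2)).ne'

variable {ζ : ℝ → ℕ → ℝ} (hd : DescentPath x₁ x₂ t₁ (t₁ + varsig x₁ x₂) ζ)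
include hd

omit h in
theorem ac_path {k : ℕ} (hk : 1 ≤ k) (hs : s ∈ Ico t₁ (t₁ + varsig x₁ x₂)) :
    AbsolutelyContinuousOnInterval (fun t => ζ t k) t₁ s := by
  refine (hd.ac k hk).mono ?_
  rw [uIcc_of_le hs.1, uIcc_of_le (hs.1.trans hs.2.le)]
  exact Icc_subset_Icc_right hs.2.le

/-- Integration by parts with `(log w)' = -2/(2 ς̃ w)`; the boundary term at `t₁` vanishes because
`w(t₁) = 1`. -/
theorem integral_nu_mul_log_wt (hs : s ∈ Ico t₁ (t₁ + varsig x₁ x₂)) (k : ℕ) :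
    (k : ℝ) / 2 * (∫ t in t₁..s, nu (vel ζ t) k * Real.log (wt t₁ x₁ x₂ β t)) =
      (k : ℝ) * (x₁ k - ζ s k) * (Real.log (wt t₁ x₁ x₂ β s) / 2) +
        ∫ t in t₁..s, (k : ℝ) * (x₁ k - ζ t k) * (2 * sg x₁ x₂ β * wt t₁ x₁ x₂ β t)⁻¹ := by
  rcases Nat.eq_zero_or_pos k with rfl | hk
  · simp
  have hac := ac_path hd hk hs
  have hf : AbsolutelyContinuousOnInterval (fun t => x₁ k - ζ t k) t₁ s :=
    (((LipschitzWith.const (x₁ k)).lipschitzOnWith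
      (s := uIcc t₁ s)).absolutelyContinuousOnInterval).sub hac
  have hparts := (h.ac_log_wt hs).integral_mul_deriv_eq_deriv_mul hf
  have e1 : ∫ t in t₁..s, nu (vel ζ t) k * Real.log (wt t₁ x₁ x₂ β t) =
      ∫ t in t₁..s, Real.log (wt t₁ x₁ x₂ β t) * deriv (fun t => x₁ k - ζ t k) t := by
    refine intervalIntegral.integral_congr fun t _ => ?_
    simp only [nu, if_neg (show k ≠ 0 by omega), vel, deriv_const_sub]
    ring
  have e2 : ∫ t in t₁..s, deriv (fun u => Real.log (wt t₁ x₁ x₂ β u)) t * (x₁ k - ζ t k) =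
      ∫ t in t₁..s, -2 * ((x₁ k - ζ t k) * (2 * sg x₁ x₂ β * wt t₁ x₁ x₂ β t)⁻¹) := by
    refine intervalIntegral.integral_congr fun t ht => ?_
    rw [uIcc_of_le hs.1] at ht
    rw [(h.hasDerivAt_log_wt (ht.2.trans_lt hs.2)).deriv]
    ring
  have e3 : ∫ t in t₁..s, (k : ℝ) * (x₁ k - ζ t k) * (2 * sg x₁ x₂ β * wt t₁ x₁ x₂ β t)⁻¹ =
      (k : ℝ) * ∫ t in t₁..s, (x₁ k - ζ t k) * (2 * sg x₁ x₂ β * wt t₁ x₁ x₂ β t)⁻¹ := by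
    rw [← intervalIntegral.integral_const_mul]
    exact intervalIntegral.integral_congr fun t _ => by ring
  rw [e1, hparts, e2, e3, intervalIntegral.integral_const_mul, wt_left, Real.log_one]
  ring

theorem hasSum_integral_nu_mul_log_wt (hs : s ∈ Ico t₁ (t₁ + varsig x₁ x₂)) :
    HasSum (fun k : ℕ => (k : ℝ) / 2 *
        (∫ t in t₁..s, nu (vel ζ t) k * Real.log (wt t₁ x₁ x₂ β t)))
      ((ζ s 0 - x₁ 0 + 2 * (s - t₁)) * (Real.log (wt t₁ x₁ x₂ β s) / 2) +
        ∫ t in t₁..s, (ζ t 0 - x₁ 0 + 2 * (t - t₁)) *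
          (2 * sg x₁ x₂ β * wt t₁ x₁ x₂ β t)⁻¹) := by
  have hle : t₁ ≤ t₁ + varsig x₁ x₂ := by linarith [h.varsig_pos]
  have hci := h.continuousOn_inv_denom hs.2
  have hsub : Icc t₁ s ⊆ Icc t₁ (t₁ + varsig x₁ x₂) := Icc_subset_Icc_right hs.2.le
  have h1 : HasSum (fun k : ℕ => ∫ t in t₁..s, (k : ℝ) * (x₁ k - ζ t k) *
      (2 * sg x₁ x₂ β * wt t₁ x₁ x₂ β t)⁻¹)
      (∫ t in t₁..s, (ζ t 0 - x₁ 0 + 2 * (t - t₁)) *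
        (2 * sg x₁ x₂ β * wt t₁ x₁ x₂ β t)⁻¹) := by
    refine intervalIntegral.hasSum_integral_of_dominated_convergence
      (fun k t => (k : ℝ) * x₁ k * (2 * sg x₁ x₂ β * wt t₁ x₁ x₂ β t)⁻¹) (fun k => ?_)
      (fun k => ?_) ?_ ?_ ?_
    · rw [uIoc_of_le hs.1]
      refine ContinuousOn.aestronglyMeasurable ?_ measurableSet_Ioc
      have hc := (hd.continuousOn h.summable₁ hle k).mono (Ioc_subset_Icc_self.trans hsub)
      exact (continuousOn_const.mul (continuousOn_const.sub hc)).mul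
        (hci.mono Ioc_subset_Icc_self)
    · refine Filter.Eventually.of_forall fun t ht => ?_
      rw [uIoc_of_le hs.1] at ht
      have hm : t ∈ Icc t₁ (t₁ + varsig x₁ x₂) := hsub (Ioc_subset_Icc_self ht)
      have hden := (inv_pos.2 (h.denom_pos (ht.2.trans_lt hs.2))).le
      rcases Nat.eq_zero_or_pos k with rfl | hk
      · simp
      · rw [Real.norm_of_nonneg (mul_nonneg (mul_nonneg (Nat.cast_nonneg k)
          (sub_nonneg.2 (hd.le_left hk hm))) hden)]
        have := hd.nonneg k hk t hm
        gcongr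
        linarith
    · exact Filter.Eventually.of_forall fun t _ => h.summable₁.mul_right _
    · simp_rw [tsum_mul_right]
      refine ContinuousOn.intervalIntegrable ?_
      rw [uIcc_of_le hs.1]
      exact continuousOn_const.mul hci
    · refine Filter.Eventually.of_forall fun t ht => ?_
      rw [uIoc_of_le hs.1] at ht
      exact (hd.hasSum_decrease h.summable₁ hle (hsub (Ioc_subset_Icc_self ht))).mul_right _
  have h2 := (hd.hasSum_decrease h.summable₁ hle
    (Ico_subset_Icc_self hs)).mul_right (Real.log (wt t₁ x₁ x₂ β s) / 2)
  exact (h2.add h1).congr_fun fun k => h.integral_nu_mul_log_wt hd hs k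

/-- The total depends on `ζ` only through `ζ s 0`. Unit mass handles the `log κ` term and the
decrease identity the `log w` term. -/
theorem hasSum_bulk (hs : s ∈ Ico t₁ (t₁ + varsig x₁ x₂))
    (hv : ∀ᵐ t, t ∈ Ioo t₁ (t₁ + varsig x₁ x₂) → SubVelocity (vel ζ t)) :
    HasSum (bulk t₁ x₁ x₂ β ζ s)
      ((∫ t in t₁..s, Real.log (kap t₁ x₁ x₂ β t)) +
        (ζ s 0 - x₁ 0 + 2 * (s - t₁)) * (Real.log (wt t₁ x₁ x₂ β s) / 2) +
        (∫ t in t₁..s, (-x₁ 0 + 2 * (t - t₁)) * (2 * sg x₁ x₂ β * wt t₁ x₁ x₂ β t)⁻¹) +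
        (s - t₁)) := by
  have hle : t₁ ≤ t₁ + varsig x₁ x₂ := by linarith [h.varsig_pos]
  have hci := h.continuousOn_inv_denom hs.2
  have hc0 := (hd.continuousOn h.summable₁ hle 0).mono (Icc_subset_Icc_right hs.2.le)
  have i1 : IntervalIntegrable (fun t => (ζ t 0 - x₁ 0 + 2 * (t - t₁)) *
      (2 * sg x₁ x₂ β * wt t₁ x₁ x₂ β t)⁻¹) volume t₁ s := by
    refine ContinuousOn.intervalIntegrable ?_
    rw [uIcc_of_le hs.1]
    exact ((hc0.sub continuousOn_const).add (by fun_prop)).mul hci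
  have i2 : IntervalIntegrable (fun t => ζ t 0 * (2 * sg x₁ x₂ β * wt t₁ x₁ x₂ β t)⁻¹)
      volume t₁ s := by
    refine ContinuousOn.intervalIntegrable ?_
    rw [uIcc_of_le hs.1]
    exact hc0.mul hci
  -- This is the cancellation of the running integral of `ζ_0`: the part produced by integrating by
  -- parts against the part subtracted in `bulk`.
  have e : ∫ t in t₁..s, (-x₁ 0 + 2 * (t - t₁)) * (2 * sg x₁ x₂ β * wt t₁ x₁ x₂ β t)⁻¹ =
      (∫ t in t₁..s, (ζ t 0 - x₁ 0 + 2 * (t - t₁)) *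
        (2 * sg x₁ x₂ β * wt t₁ x₁ x₂ β t)⁻¹) -
      ∫ t in t₁..s, ζ t 0 * (2 * sg x₁ x₂ β * wt t₁ x₁ x₂ β t)⁻¹ := by
    rw [← intervalIntegral.integral_sub i1 i2]
    exact intervalIntegral.integral_congr fun t _ => by ring
  have h1 := hd.hasSum_integral_nu_mul (Ico_subset_Icc_self hs) hv (h.continuousOn_log_kap hs.2)
  have h2 := h.hasSum_integral_nu_mul_log_wt hd hs
  have h3 := hd.hasSum_integral_rk h.summable₁ hs
  have h4 := hasSum_ite_eq (0 : ℕ)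
    (∫ t in t₁..s, ζ t 0 * (2 * sg x₁ x₂ β * wt t₁ x₁ x₂ β t)⁻¹)
  have h5 := ((h1.add h2).add h3).sub h4
  have h6 : HasSum (bulk t₁ x₁ x₂ β ζ s) _ := h5.congr_fun fun k => by
    by_cases hk : k = 0 <;> simp [bulk, hk]
  rw [e]
  convert h6 using 1
  ring

/-- The tangent at `θ = κ`, for which `θ r_0 = ζ_0/(2 ς̃ w)`. -/
theorem integral_tangent_zero (hs : s ∈ Ico t₁ (t₁ + varsig x₁ x₂))
    (hv : ∀ᵐ t, t ∈ Ioo t₁ (t₁ + varsig x₁ x₂) → SubVelocity (vel ζ t)) :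
    IntervalIntegrable (fun t => nu (vel ζ t) 0 * Real.log (kap t₁ x₁ x₂ β t) -
        ζ t 0 * (2 * sg x₁ x₂ β * wt t₁ x₁ x₂ β t)⁻¹ + rk (ζ t) 0) volume t₁ s ∧
    ∫ t in t₁..s, (nu (vel ζ t) 0 * Real.log (kap t₁ x₁ x₂ β t) -
        ζ t 0 * (2 * sg x₁ x₂ β * wt t₁ x₁ x₂ β t)⁻¹ + rk (ζ t) 0) =
      action t₁ x₁ x₂ β ζ s 0 := by
  have hle : t₁ ≤ t₁ + varsig x₁ x₂ := by linarith [h.varsig_pos]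
  have hc0 := (hd.continuousOn h.summable₁ hle 0).mono (Icc_subset_Icc_right hs.2.le)
  have i1 : IntervalIntegrable (fun t => nu (vel ζ t) 0 * Real.log (kap t₁ x₁ x₂ β t))
      volume t₁ s := by
    refine (hd.intervalIntegrable_nu (Ico_subset_Icc_self hs) hv 0).mul_continuousOn ?_
    rw [uIcc_of_le hs.1]
    exact h.continuousOn_log_kap hs.2
  have i2 : IntervalIntegrable (fun t => ζ t 0 * (2 * sg x₁ x₂ β * wt t₁ x₁ x₂ β t)⁻¹)
      volume t₁ s := by
    refine ContinuousOn.intervalIntegrable ?_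
    rw [uIcc_of_le hs.1]
    exact hc0.mul (h.continuousOn_inv_denom hs.2)
  have i3 : IntervalIntegrable (fun t => rk (ζ t) 0) volume t₁ s := by
    refine ContinuousOn.intervalIntegrable ?_
    rw [uIcc_of_le hs.1]
    exact hd.continuousOn_rk h.summable₁ hs 0
  refine ⟨(i1.sub i2).add i3, ?_⟩
  rw [intervalIntegral.integral_add (i1.sub i2) i3, intervalIntegral.integral_sub i1 i2]
  simp only [action, bulk, zt_zero, entQ_zero, Nat.cast_zero, if_true]
  ring

/-- The integrated tangent for a coordinate `k ≥ 1`, with the position shifted by `ε`. -/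
theorem integral_tangent {k : ℕ} (hk : 1 ≤ k) (hs : s ∈ Ico t₁ (t₁ + varsig x₁ x₂))
    (hv : ∀ᵐ t, t ∈ Ioo t₁ (t₁ + varsig x₁ x₂) → SubVelocity (vel ζ t)) {ε : ℝ}
    (hε : 0 < ζ s k + ε) :
    IntervalIntegrable (fun t => nu (vel ζ t) k * (Real.log (kap t₁ x₁ x₂ β t) +
        (k : ℝ) / 2 * Real.log (wt t₁ x₁ x₂ β t) + Real.log (zt x₁ x₂ β k) -
        Real.log (ζ t k + ε)) - explRate t₁ x₁ x₂ β t k + rk (ζ t) k) volume t₁ s ∧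
    ∫ t in t₁..s, (nu (vel ζ t) k * (Real.log (kap t₁ x₁ x₂ β t) +
        (k : ℝ) / 2 * Real.log (wt t₁ x₁ x₂ β t) + Real.log (zt x₁ x₂ β k) -
        Real.log (ζ t k + ε)) - explRate t₁ x₁ x₂ β t k + rk (ζ t) k) =
      bulk t₁ x₁ x₂ β ζ s k +
        ((entF (ζ s k + ε) - (ζ s k) * Real.log (zt x₁ x₂ β k)) -
          (entF (x₁ k + ε) - x₁ k * Real.log (zt x₁ x₂ β k))) -
        ∫ t in t₁..s, explRate t₁ x₁ x₂ β t k := by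
  have hk0 : k ≠ 0 := by omega
  have hle : t₁ ≤ t₁ + varsig x₁ x₂ := by linarith [h.varsig_pos]
  have hsI := Ico_subset_Icc_self hs
  have hac := ac_path hd hk hs
  have hpos : ∀ t ∈ Icc t₁ s, 0 < ζ t k + ε := fun t ht => by
    have := hd.anti k hk ⟨ht.1, ht.2.trans hs.2.le⟩ hsI ht.2
    simp only at this
    linarith
  have hck := (hd.continuousOn h.summable₁ hle k).mono (Icc_subset_Icc_right hs.2.le)
  have hN := hd.intervalIntegrable_nu hsI hv k
  have i1 : IntervalIntegrable (fun t => nu (vel ζ t) k * Real.log (kap t₁ x₁ x₂ β t))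
      volume t₁ s := hN.mul_continuousOn (by
    rw [uIcc_of_le hs.1]; exact h.continuousOn_log_kap hs.2)
  have i2 : IntervalIntegrable (fun t => nu (vel ζ t) k * Real.log (wt t₁ x₁ x₂ β t))
      volume t₁ s := hN.mul_continuousOn (by
    rw [uIcc_of_le hs.1]; exact h.continuousOn_log_wt hs.2)
  have i3 : IntervalIntegrable (fun t => nu (vel ζ t) k * Real.log (ζ t k + ε))
      volume t₁ s := hN.mul_continuousOn (by
    rw [uIcc_of_le hs.1]
    exact (hck.add continuousOn_const).log fun t ht => (hpos t ht).ne')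
  have i4 : IntervalIntegrable (fun t => rk (ζ t) k) volume t₁ s := by
    refine ContinuousOn.intervalIntegrable ?_
    rw [uIcc_of_le hs.1]
    exact hd.continuousOn_rk h.summable₁ hs k
  have i5 : IntervalIntegrable (fun t => explRate t₁ x₁ x₂ β t k) volume t₁ s := by
    refine ContinuousOn.intervalIntegrable ?_
    rw [uIcc_of_le hs.1]
    simp only [explRate, if_neg hk0]
    refine ContinuousOn.div (continuousOn_const.mul (ContinuousOn.rpow_const
      (by unfold wt; fun_prop) fun t ht => Or.inr (by positivity)))
      (by unfold wt; fun_prop) fun t ht => (h.denom_pos (ht.2.trans_lt hs.2)).ne'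
  have i6 := (((i1.add (i2.const_mul ((k : ℝ) / 2))).add
    (hN.const_mul (Real.log (zt x₁ x₂ β k)))).sub i3)
  have efun : (fun t => nu (vel ζ t) k * (Real.log (kap t₁ x₁ x₂ β t) +
        (k : ℝ) / 2 * Real.log (wt t₁ x₁ x₂ β t) + Real.log (zt x₁ x₂ β k) -
        Real.log (ζ t k + ε)) - explRate t₁ x₁ x₂ β t k + rk (ζ t) k) =
      fun t => (nu (vel ζ t) k * Real.log (kap t₁ x₁ x₂ β t) +
        (k : ℝ) / 2 * (nu (vel ζ t) k * Real.log (wt t₁ x₁ x₂ β t)) +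
        Real.log (zt x₁ x₂ β k) * nu (vel ζ t) k -
        nu (vel ζ t) k * Real.log (ζ t k + ε)) - explRate t₁ x₁ x₂ β t k + rk (ζ t) k := by
    ext t; ring
  have hnu : ∀ t, nu (vel ζ t) k = -deriv (fun t => ζ t k) t := fun t => by
    rw [nu, if_neg hk0]; rfl
  have e1 : ∫ t in t₁..s, nu (vel ζ t) k = x₁ k - ζ s k := by
    simp_rw [hnu]
    rw [intervalIntegral.integral_neg, hac.integral_deriv_eq_sub, hd.left]
    ring
  -- An exact differential: the rate is minus the derivative of `ζ_k`.
  have e2 : ∫ t in t₁..s, nu (vel ζ t) k * Real.log (ζ t k + ε) =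
      entF (x₁ k + ε) - entF (ζ s k + ε) := by
    have := integral_deriv_mul_log hs.1 hac hpos
    rw [hd.left] at this
    simp_rw [hnu, neg_mul]
    rw [intervalIntegral.integral_neg, this]
    ring
  rw [efun]
  refine ⟨(i6.sub i5).add i4, ?_⟩
  rw [intervalIntegral.integral_add (i6.sub i5) i4, intervalIntegral.integral_sub i6 i5,
    intervalIntegral.integral_sub ((i1.add (i2.const_mul _)).add (hN.const_mul _)) i3,
    intervalIntegral.integral_add (i1.add (i2.const_mul _)) (hN.const_mul _),
    intervalIntegral.integral_add i1 (i2.const_mul _), intervalIntegral.integral_const_mul,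
    intervalIntegral.integral_const_mul, e1, e2]
  simp only [bulk, if_neg hk0]
  ring

/-- If `z̃_k = 0`, the `k`-th coordinate does not move. -/
theorem nu_eq_zero {k : ℕ} (hk : 1 ≤ k) (hz : zt x₁ x₂ β k = 0)
    (ht : t ∈ Ioo t₁ (t₁ + varsig x₁ x₂)) : nu (vel ζ t) k = 0 := by
  have hx : x₁ k = x₂ k := by
    have := h.zt_mul hk
    rw [hz, zero_mul] at this
    linarith
  have hc : ∀ u ∈ Icc t₁ (t₁ + varsig x₁ x₂), ζ u k = x₁ k := fun u hu =>
    le_antisymm (hd.le_left hk hu) (hx ▸ hd.right_le hk hu)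
  have : deriv (fun u => ζ u k) t = 0 := by
    have e : (fun u => ζ u k) =ᶠ[nhds t] fun _ => x₁ k := by
      filter_upwards [Ioo_mem_nhds ht.1 ht.2] with u hu using hc u (Ioo_subset_Icc_self hu)
    rw [e.deriv_eq, deriv_const]
  rw [nu, if_neg (by omega), vel, this, neg_zero]

theorem action_of_zt_eq_zero {k : ℕ} (hk : 1 ≤ k) (hz : zt x₁ x₂ β k = 0)
    (hs : s ∈ Ico t₁ (t₁ + varsig x₁ x₂)) :
    action t₁ x₁ x₂ β ζ s k = ∫ t in t₁..s, rk (ζ t) k := by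
  have hk0 : k ≠ 0 := by omega
  have e : ∀ g : ℝ → ℝ, ∫ t in t₁..s, nu (vel ζ t) k * g t = 0 := by
    intro g
    rw [intervalIntegral.integral_of_le hs.1, integral_Ioc_eq_integral_Ioo]
    refine (setIntegral_congr_fun (g := fun _ => (0 : ℝ)) measurableSet_Ioo fun t ht => ?_).trans
      (by simp)
    simp only [h.nu_eq_zero hd hk hz ⟨ht.1, ht.2.trans hs.2⟩, zero_mul]
  have e' : ∀ t, explRate t₁ x₁ x₂ β t k = 0 := fun t => by
    rw [explRate, if_neg hk0, hz]; simp
  simp only [action, bulk, e, hz, entQ_zero, if_neg hk0, e']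
  simp

omit h hd in
theorem action_eq {k : ℕ} (hk : 1 ≤ k) (hz : 0 < zt x₁ x₂ β k) :
    action t₁ x₁ x₂ β ζ s k = bulk t₁ x₁ x₂ β ζ s k +
        ((entF (ζ s k) - (ζ s k) * Real.log (zt x₁ x₂ β k)) -
          (entF (x₁ k) - x₁ k * Real.log (zt x₁ x₂ β k))) -
        ∫ t in t₁..s, explRate t₁ x₁ x₂ β t k := by
  rw [action, entQ_eq hz, entQ_eq hz, if_neg (by omega)]

/-- Tangent bound with `θ_0 = κ` and `θ_k = κ w^(k/2) z̃_k / ζ_k`, built from the competitor's own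
position. A coordinate with `z̃_k = 0` does not move and costs exactly `∫ r_k`. -/
theorem ofReal_action_le (hs : s ∈ Ico t₁ (t₁ + varsig x₁ x₂))
    (hv : ∀ᵐ t, t ∈ Ioo t₁ (t₁ + varsig x₁ x₂) → SubVelocity (vel ζ t)) (k : ℕ) :
    ENNReal.ofReal (action t₁ x₁ x₂ β ζ s k) ≤
      ∫⁻ t in Ioo t₁ s, klTerm (nu (vel ζ t) k) (rk (ζ t) k) := by
  have hgood : ∀ᵐ t, t ∈ Ioo t₁ s → 0 ≤ nu (vel ζ t) k ∧ 0 ≤ rk (ζ t) k := by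
    filter_upwards [hv] with t ht hmem
    have hmem' : t ∈ Ioo t₁ (t₁ + varsig x₁ x₂) := ⟨hmem.1, hmem.2.trans hs.2⟩
    exact ⟨nu_nonneg (fun k hk => hd.deriv_nonpos hk hmem') (ht hmem') k,
      rk_nonneg (fun k hk => hd.nonneg k hk t (Ioo_subset_Icc_self hmem')) k⟩
  rcases Nat.eq_zero_or_pos k with rfl | hk
  · obtain ⟨hi, he⟩ := h.integral_tangent_zero hd hs hv
    rw [← he]
    refine ofReal_integral_le_setLIntegral hs.1 hi ?_
    filter_upwards [hgood] with t ht hmem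
    have hmem' : t ∈ Ico t₁ (t₁ + varsig x₁ x₂) := ⟨hmem.1.le, hmem.2.trans hs.2⟩
    have e : ζ t 0 * (2 * sg x₁ x₂ β * wt t₁ x₁ x₂ β t)⁻¹ =
        kap t₁ x₁ x₂ β t * rk (ζ t) 0 := by
      have := (h.mass_pos hmem').ne'
      rw [hd.rk_eq' h.summable₁ hmem', kap, if_pos rfl]
      field_simp
    rw [e]
    exact ofReal_tangent_le_klTerm (ht hmem).1 (ht hmem).2 (h.kap_pos hmem')
  · rcases (h.zt_nonneg k).eq_or_lt with hz | hz
    · rw [h.action_of_zt_eq_zero hd hk hz.symm hs]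
      refine ofReal_integral_le_setLIntegral hs.1 ?_ ?_
      · refine ContinuousOn.intervalIntegrable ?_
        rw [uIcc_of_le hs.1]
        exact hd.continuousOn_rk h.summable₁ hs k
      · refine Filter.Eventually.of_forall fun t ht => ?_
        rw [h.nu_eq_zero hd hk hz.symm ⟨ht.1, ht.2.trans hs.2⟩, klTerm_zero_left]
    · have hsI := Ico_subset_Icc_self hs
      -- A competitor's coordinate may reach 0 early, making `log ζ_k` singular; the position is
      -- shifted by `ε`, which is then sent to 0.
      have key : ∀ ε : ℝ, 0 < ε → ENNReal.ofReal (bulk t₁ x₁ x₂ β ζ s k +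
          ((entF (ζ s k + ε) - (ζ s k) * Real.log (zt x₁ x₂ β k)) -
            (entF (x₁ k + ε) - x₁ k * Real.log (zt x₁ x₂ β k))) -
          ∫ t in t₁..s, explRate t₁ x₁ x₂ β t k) ≤
          ∫⁻ t in Ioo t₁ s, klTerm (nu (vel ζ t) k) (rk (ζ t) k) := by
        intro ε hε
        obtain ⟨hi, he⟩ := h.integral_tangent hd hk hs hv
          (add_pos_of_nonneg_of_pos (hd.nonneg k hk s hsI) hε)
        rw [← he]
        refine ofReal_integral_le_setLIntegral hs.1 hi ?_
        filter_upwards [hgood] with t ht hmem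
        have hmem' : t ∈ Ico t₁ (t₁ + varsig x₁ x₂) := ⟨hmem.1.le, hmem.2.trans hs.2⟩
        have hw := h.wt_pos hmem'.2
        have hsg := h.sg_pos
        have hκ := h.kap_pos hmem'
        have hR := h.mass_pos hmem'
        have hζ := hd.nonneg k hk t (Ico_subset_Icc_self hmem')
        have hζε : 0 < ζ t k + ε := by positivity
        have hwk : 0 < wt t₁ x₁ x₂ β t ^ ((k : ℝ) / 2) := Real.rpow_pos_of_pos hw _
        set θ := kap t₁ x₁ x₂ β t * wt t₁ x₁ x₂ β t ^ ((k : ℝ) / 2) * zt x₁ x₂ β k /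
          (ζ t k + ε) with hθ
        have hθpos : 0 < θ := by positivity
        have hlog : Real.log θ = Real.log (kap t₁ x₁ x₂ β t) +
            (k : ℝ) / 2 * Real.log (wt t₁ x₁ x₂ β t) + Real.log (zt x₁ x₂ β k) -
            Real.log (ζ t k + ε) := by
          rw [hθ, Real.log_div (by positivity) hζε.ne', Real.log_mul (by positivity) hz.ne',
            Real.log_mul hκ.ne' hwk.ne', Real.log_rpow hw]
        -- The shift only decreases `θ r_k` below the explicit rate, so the inequality keeps its
        -- direction.
        have hθM : θ * rk (ζ t) k ≤ explRate t₁ x₁ x₂ β t k := by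
          have e : θ * rk (ζ t) k = explRate t₁ x₁ x₂ β t k * (ζ t k / (ζ t k + ε)) := by
            rw [hd.rk_eq' h.summable₁ hmem', hθ, kap, explRate, if_neg (by omega),
              if_neg (by omega)]
            field_simp
          rw [e]
          refine mul_le_of_le_one_right (h.explRate_nonneg hmem' k) ?_
          rw [div_le_one hζε]
          linarith
        refine le_trans (ENNReal.ofReal_le_ofReal ?_)
          (ofReal_tangent_le_klTerm (ht hmem).1 (ht hmem).2 hθpos)
        rw [hlog]
        linarith
      rw [action_eq hk hz]
      have hlim : Filter.Tendsto (fun ε : ℝ => ENNReal.ofReal (bulk t₁ x₁ x₂ β ζ s k +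
          ((entF (ζ s k + ε) - (ζ s k) * Real.log (zt x₁ x₂ β k)) -
            (entF (x₁ k + ε) - x₁ k * Real.log (zt x₁ x₂ β k))) -
          ∫ t in t₁..s, explRate t₁ x₁ x₂ β t k)) (nhdsWithin 0 (Ioi 0))
          (nhds (ENNReal.ofReal (bulk t₁ x₁ x₂ β ζ s k +
          ((entF (ζ s k) - (ζ s k) * Real.log (zt x₁ x₂ β k)) -
            (entF (x₁ k) - x₁ k * Real.log (zt x₁ x₂ β k))) -
          ∫ t in t₁..s, explRate t₁ x₁ x₂ β t k))) := by
        refine ENNReal.tendsto_ofReal ?_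
        have hcF := continuous_entF
        have hcont : Continuous fun ε : ℝ => bulk t₁ x₁ x₂ β ζ s k +
          ((entF (ζ s k + ε) - (ζ s k) * Real.log (zt x₁ x₂ β k)) -
            (entF (x₁ k + ε) - x₁ k * Real.log (zt x₁ x₂ β k))) -
          ∫ t in t₁..s, explRate t₁ x₁ x₂ β t k := by fun_prop
        have := hcont.tendsto 0
        simp only [add_zero] at this
        exact this.mono_left nhdsWithin_le_nhds
      exact le_of_tendsto hlim (eventually_nhdsWithin_of_forall fun ε hε => key ε hε)

omit hd in
/-- For the explicit path the tangent bound is attained. -/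
theorem lintegral_klTerm_expl (hs : s ∈ Ico t₁ (t₁ + varsig x₁ x₂)) (k : ℕ) :
    ∫⁻ t in Ioo t₁ s, klTerm (explRate t₁ x₁ x₂ β t k) (rk (expl t₁ x₁ x₂ β t) k) =
      ENNReal.ofReal (action t₁ x₁ x₂ β (expl t₁ x₁ x₂ β) s k) ∧
    0 ≤ action t₁ x₁ x₂ β (expl t₁ x₁ x₂ β) s k := by
  have hd := h.descentPath_expl (t₁ := t₁)
  have hv : ∀ᵐ t, t ∈ Ioo t₁ (t₁ + varsig x₁ x₂) →
      SubVelocity (vel (expl t₁ x₁ x₂ β) t) :=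
    Filter.Eventually.of_forall fun t ht => h.subVelocity_expl ht
  have hIco : ∀ t ∈ Ioo t₁ s, t ∈ Ico t₁ (t₁ + varsig x₁ x₂) := fun t ht =>
    ⟨ht.1.le, ht.2.trans hs.2⟩
  have hrk0 : ∀ t ∈ Ioo t₁ s, 0 ≤ rk (expl t₁ x₁ x₂ β t) k := fun t ht =>
    rk_nonneg (fun k hk => h.expl_nonneg hk (Ico_subset_Icc_self (hIco t ht))) k
  have hnonneg : ∀ {θ b : ℝ}, 0 ≤ b → 0 < θ → 0 ≤ θ * b * Real.log θ - θ * b + b := by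
    intro θ b hb hθ
    have h1 := mul_nonneg hb (ell_nonneg hθ.le)
    have e : θ * b * Real.log θ - θ * b + b = b * ell θ := by unfold ell; ring
    rw [e]; exact h1
  have finish : ∀ g : ℝ → ℝ, IntervalIntegrable g volume t₁ s →
      ∫ t in t₁..s, g t = action t₁ x₁ x₂ β (expl t₁ x₁ x₂ β) s k →
      (∀ t ∈ Ioo t₁ s, 0 ≤ g t) →
      (∀ t ∈ Ioo t₁ s, klTerm (explRate t₁ x₁ x₂ β t k) (rk (expl t₁ x₁ x₂ β t) k) =
        ENNReal.ofReal (g t)) →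
      ∫⁻ t in Ioo t₁ s, klTerm (explRate t₁ x₁ x₂ β t k) (rk (expl t₁ x₁ x₂ β t) k) =
        ENNReal.ofReal (action t₁ x₁ x₂ β (expl t₁ x₁ x₂ β) s k) ∧
      0 ≤ action t₁ x₁ x₂ β (expl t₁ x₁ x₂ β) s k := by
    intro g hi he h0 hg
    rw [← he]
    refine ⟨setLIntegral_eq_ofReal_integral hs.1 hi h0 hg, ?_⟩
    rw [intervalIntegral.integral_of_le hs.1, integral_Ioc_eq_integral_Ioo]
    exact setIntegral_nonneg measurableSet_Ioo h0
  rcases Nat.eq_zero_or_pos k with rfl | hk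
  · obtain ⟨hi, he⟩ := h.integral_tangent_zero hd hs hv
    have e : ∀ t ∈ Ioo t₁ s, expl t₁ x₁ x₂ β t 0 * (2 * sg x₁ x₂ β * wt t₁ x₁ x₂ β t)⁻¹ =
        kap t₁ x₁ x₂ β t * rk (expl t₁ x₁ x₂ β t) 0 := fun t ht => by
      have := (h.mass_pos (hIco t ht)).ne'
      rw [hd.rk_eq' h.summable₁ (hIco t ht), kap, if_pos rfl]
      field_simp
    have e' : ∀ t ∈ Ioo t₁ s, explRate t₁ x₁ x₂ β t 0 =
        kap t₁ x₁ x₂ β t * rk (expl t₁ x₁ x₂ β t) 0 := fun t ht => by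
      rw [← e t ht, explRate, if_pos rfl, div_eq_mul_inv]
    refine finish _ hi he (fun t ht => ?_) fun t ht => ?_
    · rw [h.nu_vel_expl (hIco t ht), e t ht, e' t ht]
      exact hnonneg (hrk0 t ht) (h.kap_pos (hIco t ht))
    · rw [h.nu_vel_expl (hIco t ht), e t ht, e' t ht]
      exact klTerm_mul_left
  · have hk0 : k ≠ 0 := by omega
    rcases (h.zt_nonneg k).eq_or_lt with hz | hz
    · have e' : ∀ t, explRate t₁ x₁ x₂ β t k = 0 := fun t => by
        rw [explRate, if_neg hk0, ← hz]; simp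
      refine finish (fun t => rk (expl t₁ x₁ x₂ β t) k) ?_
        (h.action_of_zt_eq_zero hd hk hz.symm hs).symm hrk0 fun t ht => ?_
      · refine ContinuousOn.intervalIntegrable ?_
        rw [uIcc_of_le hs.1]
        exact hd.continuousOn_rk h.summable₁ hs k
      · rw [e', klTerm_zero_left]
    -- No shift is needed here: a moving coordinate of the explicit path is positive before the
    -- final time.
    · obtain ⟨hi, he⟩ := h.integral_tangent hd hk hs hv (ε := 0)
        (by rw [add_zero]; exact h.expl_pos hk hz hs)
      simp only [add_zero] at hi he
      rw [← action_eq hk hz] at he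
      have key : ∀ t ∈ Ioo t₁ s, ∃ θ : ℝ, 0 < θ ∧
          explRate t₁ x₁ x₂ β t k = θ * rk (expl t₁ x₁ x₂ β t) k ∧
          Real.log θ = Real.log (kap t₁ x₁ x₂ β t) +
            (k : ℝ) / 2 * Real.log (wt t₁ x₁ x₂ β t) + Real.log (zt x₁ x₂ β k) -
            Real.log (expl t₁ x₁ x₂ β t k) := by
        intro t ht
        have hmem' := hIco t ht
        have hw := h.wt_pos hmem'.2
        have hsg := h.sg_pos
        have hκ := h.kap_pos hmem'
        have hR := h.mass_pos hmem'
        have hζ := h.expl_pos hk hz hmem'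
        have hwk : 0 < wt t₁ x₁ x₂ β t ^ ((k : ℝ) / 2) := Real.rpow_pos_of_pos hw _
        refine ⟨kap t₁ x₁ x₂ β t * wt t₁ x₁ x₂ β t ^ ((k : ℝ) / 2) * zt x₁ x₂ β k /
          expl t₁ x₁ x₂ β t k, by positivity, ?_, ?_⟩
        · rw [hd.rk_eq' h.summable₁ hmem', kap, explRate, if_neg hk0, if_neg hk0]
          field_simp
        · rw [Real.log_div (by positivity) hζ.ne', Real.log_mul (by positivity) hz.ne',
            Real.log_mul hκ.ne' hwk.ne', Real.log_rpow hw]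
      refine finish _ hi he (fun t ht => ?_) fun t ht => ?_
      · obtain ⟨θ, hθ, h1, h2⟩ := key t ht
        rw [h.nu_vel_expl (hIco t ht), ← h2, h1]
        exact hnonneg (hrk0 t ht) hθ
      · obtain ⟨θ, hθ, h1, h2⟩ := key t ht
        rw [h.nu_vel_expl (hIco t ht), ← h2, h1]
        exact klTerm_mul_left

end Endpoints

/-! ### Optimality of the explicit path -/

/-- The two actions need not be known summable separately. Only their difference is a convergent
series, and the case of infinite competitor cost is trivial. -/
theorem tsum_ofReal_le_add {a b : ℕ → ℝ} {D : ℝ} (ha : ∀ k, 0 ≤ a k)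
    (h : HasSum (fun k => a k - b k) D) :
    ∑' k, ENNReal.ofReal (a k) ≤ ∑' k, ENNReal.ofReal (b k) + ENNReal.ofReal D := by
  by_cases hb : ∑' k, ENNReal.ofReal (b k) = ⊤
  · rw [hb, top_add]; exact le_top
  · have hs : Summable fun k => (ENNReal.ofReal (b k)).toReal := ENNReal.summable_toReal hb
    have hle : ∀ k, a k ≤ (ENNReal.ofReal (b k)).toReal + (a k - b k) := fun k => by
      have : b k ≤ (ENNReal.ofReal (b k)).toReal := by
        rw [ENNReal.toReal_ofReal']; exact le_max_left _ _
      linarith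
    have hsum := hs.hasSum.add h
    have hsa : Summable a := hsum.summable.of_nonneg_of_le ha hle
    rw [← ENNReal.ofReal_tsum_of_nonneg ha hsa]
    refine (ENNReal.ofReal_le_ofReal (hasSum_le hle hsa.hasSum hsum)).trans ?_
    refine ENNReal.ofReal_add_le.trans ?_
    gcongr
    rw [ENNReal.ofReal_tsum_of_nonneg (fun k => ENNReal.toReal_nonneg) hs]
    exact ENNReal.tsum_le_tsum fun k => ENNReal.ofReal_toReal_le

namespace Endpoints

variable {p x₁ x₂ : ℕ → ℝ} {β : ℝ} (h : Endpoints p x₁ x₂ β) {t₁ s t : ℝ}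
  {ζ : ℝ → ℕ → ℝ} (hd : DescentPath x₁ x₂ t₁ (t₁ + varsig x₁ x₂) ζ)
include h hd

theorem abs_entQ_path_le (ht : t ∈ Icc t₁ (t₁ + varsig x₁ x₂)) (k : ℕ) :
    |entQ (zt x₁ x₂ β k) (x₁ k) - entQ (zt x₁ x₂ β k) (ζ t k)| ≤
      (k : ℝ) * zt x₁ x₂ β k + (k : ℝ) * x₁ k := by
  rcases Nat.eq_zero_or_pos k with rfl | hk
  · simp [zt_zero, entQ_zero]
  · have h1 : (1 : ℝ) ≤ k := by exact_mod_cast hk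
    refine (abs_entQ_sub_le (h.zt_nonneg k) (hd.nonneg k hk t ht) (hd.le_left hk ht) ?_).trans ?_
    · linarith [h.z_le_zt hk, hd.right_le hk ht]
    · have := h.zt_nonneg k
      have := h.nonneg₁ k hk
      nlinarith

theorem abs_entQ_diff_le (ht : t ∈ Icc t₁ (t₁ + varsig x₁ x₂)) (k : ℕ) :
    |entQ (zt x₁ x₂ β k) (expl t₁ x₁ x₂ β t k) - entQ (zt x₁ x₂ β k) (ζ t k)| ≤
      2 * ((k : ℝ) * zt x₁ x₂ β k + (k : ℝ) * x₁ k) := by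
  have h1 := abs_le.1 (h.abs_entQ_path_le hd ht k)
  have h2 := abs_le.1 (h.abs_entQ_path_le h.descentPath_expl ht k)
  rw [abs_le]
  constructor <;> linarith [h1.1, h1.2, h2.1, h2.2]

omit hd in
theorem summable_bound :
    Summable fun k : ℕ => 2 * ((k : ℝ) * zt x₁ x₂ β k + (k : ℝ) * x₁ k) :=
  (h.summable_zt.add h.summable₁).mul_left 2

/-- The explicit rates and the starting entropies cancel, and the bulk sums differ only through the
zeroth coordinate at time `s`. -/
theorem hasSum_action_sub (hs : s ∈ Ico t₁ (t₁ + varsig x₁ x₂))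
    (hv : ∀ᵐ t, t ∈ Ioo t₁ (t₁ + varsig x₁ x₂) → SubVelocity (vel ζ t)) :
    HasSum (fun k => action t₁ x₁ x₂ β (expl t₁ x₁ x₂ β) s k - action t₁ x₁ x₂ β ζ s k)
      ((expl t₁ x₁ x₂ β s 0 - ζ s 0) * (Real.log (wt t₁ x₁ x₂ β s) / 2) +
        ∑' k, (entQ (zt x₁ x₂ β k) (expl t₁ x₁ x₂ β s k) - entQ (zt x₁ x₂ β k) (ζ s k))) := by
  have hv' : ∀ᵐ t, t ∈ Ioo t₁ (t₁ + varsig x₁ x₂) →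
      SubVelocity (vel (expl t₁ x₁ x₂ β) t) :=
    Filter.Eventually.of_forall fun t ht => h.subVelocity_expl ht
  have h1 := (h.hasSum_bulk h.descentPath_expl hs hv').sub (h.hasSum_bulk hd hs hv)
  have h2 : Summable fun k => entQ (zt x₁ x₂ β k) (expl t₁ x₁ x₂ β s k) -
      entQ (zt x₁ x₂ β k) (ζ s k) :=
    h.summable_bound.of_norm_bounded fun k => h.abs_entQ_diff_le hd (Ico_subset_Icc_self hs) k
  have h3 := h1.add h2.hasSum
  have h4 : HasSum (fun k => action t₁ x₁ x₂ β (expl t₁ x₁ x₂ β) s k -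
      action t₁ x₁ x₂ β ζ s k) _ := h3.congr_fun fun k => by unfold action; ring
  convert h4 using 1
  ring

theorem tendsto_entQ_diff :
    Filter.Tendsto (fun s => ∑' k, (entQ (zt x₁ x₂ β k) (expl t₁ x₁ x₂ β s k) -
        entQ (zt x₁ x₂ β k) (ζ s k)))
      (nhdsWithin (t₁ + varsig x₁ x₂) (Ioo t₁ (t₁ + varsig x₁ x₂))) (nhds 0) := by
  have hle : t₁ ≤ t₁ + varsig x₁ x₂ := by linarith [h.varsig_pos]
  have hlim : ∀ {ξ : ℝ → ℕ → ℝ}, DescentPath x₁ x₂ t₁ (t₁ + varsig x₁ x₂) ξ → ∀ k,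
      Filter.Tendsto (fun s => entQ (zt x₁ x₂ β k) (ξ s k))
        (nhdsWithin (t₁ + varsig x₁ x₂) (Ioo t₁ (t₁ + varsig x₁ x₂)))
        (nhds (entQ (zt x₁ x₂ β k) (x₂ k))) := by
    intro ξ hξ k
    refine ((continuous_entQ _).tendsto _).comp ?_
    have := (hξ.continuousOn h.summable₁ hle k) _ (right_mem_Icc.2 hle)
    rw [ContinuousWithinAt, hξ.right] at this
    exact this.mono_left (nhdsWithin_mono _ Ioo_subset_Icc_self)
  have := tendsto_tsum_of_dominated_convergence
    (𝓕 := nhdsWithin (t₁ + varsig x₁ x₂) (Ioo t₁ (t₁ + varsig x₁ x₂)))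
    (f := fun s k => entQ (zt x₁ x₂ β k) (expl t₁ x₁ x₂ β s k) -
      entQ (zt x₁ x₂ β k) (ζ s k)) (g := fun _ => (0 : ℝ)) h.summable_bound (fun k => ?_) ?_
  · simpa using this
  · have := (hlim h.descentPath_expl k).sub (hlim hd k)
    rwa [sub_self] at this
  · filter_upwards [self_mem_nhdsWithin] with s hs k
    exact h.abs_entQ_diff_le hd (Ioo_subset_Icc_self hs) k

/-- The weighted decrease is nondecreasing in time, so `ζ_0(t)` is at most twice the remaining time,
and for `β = 0` the remaining time is `ς̃ w`. -/
theorem zero_le_of_right_eq (hx : x₂ 0 = 0) (hb : β = 0)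
    (ht : t ∈ Icc t₁ (t₁ + varsig x₁ x₂)) :
    ζ t 0 ≤ 2 * (sg x₁ x₂ β * wt t₁ x₁ x₂ β t) := by
  have hle : t₁ ≤ t₁ + varsig x₁ x₂ := by linarith [h.varsig_pos]
  have hr : t₁ + varsig x₁ x₂ ∈ Icc t₁ (t₁ + varsig x₁ x₂) := right_mem_Icc.2 hle
  have h1 := hd.hasSum_decrease h.summable₁ hle ht
  have h2 := hd.hasSum_decrease h.summable₁ hle hr
  have h3 := hasSum_le (fun k => ?_) h1 h2
  · rw [hd.right, hx] at h3
    have e1 := h.sg_mul_wt t₁ t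
    have e2 := h.sg_mul
    rw [hb] at e2
    rw [hb] at e1 ⊢
    nlinarith
  · rcases Nat.eq_zero_or_pos k with rfl | hk
    · simp
    · have := hd.anti k hk ht hr ht.2
      simp only at this
      gcongr

/-- For `β > 0` the logarithm stays bounded and the coordinates share a limit. For `β = 0` the
logarithm diverges, but the difference is `O(w)` and `w log w → 0`. -/
theorem tendsto_zero_diff :
    Filter.Tendsto (fun s => (expl t₁ x₁ x₂ β s 0 - ζ s 0) *
        (Real.log (wt t₁ x₁ x₂ β s) / 2))
      (nhdsWithin (t₁ + varsig x₁ x₂) (Ioo t₁ (t₁ + varsig x₁ x₂))) (nhds 0) := by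
  have hle : t₁ ≤ t₁ + varsig x₁ x₂ := by linarith [h.varsig_pos]
  have hw : Filter.Tendsto (wt t₁ x₁ x₂ β)
      (nhdsWithin (t₁ + varsig x₁ x₂) (Ioo t₁ (t₁ + varsig x₁ x₂))) (nhds (β ^ 2)) := by
    have hc : Continuous (wt t₁ x₁ x₂ β) := by unfold wt; fun_prop
    have := hc.tendsto (t₁ + varsig x₁ x₂)
    rw [h.wt_right] at this
    exact this.mono_left nhdsWithin_le_nhds
  rcases h.beta_nonneg.eq_or_lt with hb | hb
  · have hx := h.zero₂_eq hb.symm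
    have h1 : Filter.Tendsto (fun s => sg x₁ x₂ β *
        |wt t₁ x₁ x₂ β s * Real.log (wt t₁ x₁ x₂ β s)|)
        (nhdsWithin (t₁ + varsig x₁ x₂) (Ioo t₁ (t₁ + varsig x₁ x₂))) (nhds 0) := by
      have h2 := (Real.continuous_mul_log.tendsto (β ^ 2)).comp hw
      have e : β ^ 2 * Real.log (β ^ 2) = 0 := by simp [← hb]
      rw [e] at h2
      have := (h2.abs).const_mul (sg x₁ x₂ β)
      simpa using! this
    refine squeeze_zero_norm' ?_ h1
    filter_upwards [self_mem_nhdsWithin] with s hs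
    have hs' := Ioo_subset_Icc_self hs
    have a1 := h.zero_le_of_right_eq hd hx hb.symm hs'
    have a2 := h.zero_le_of_right_eq h.descentPath_expl hx hb.symm hs'
    have a3 := hd.zero_nonneg s hs'
    have a4 := h.expl_zero_nonneg hs'
    have hwp := h.wt_pos hs.2
    rw [Real.norm_eq_abs, abs_mul, abs_mul, abs_of_pos hwp, abs_div, abs_two]
    have a5 : |expl t₁ x₁ x₂ β s 0 - ζ s 0| ≤ 2 * (sg x₁ x₂ β * wt t₁ x₁ x₂ β s) := by
      rw [abs_le]; constructor <;> linarith
    have := mul_le_mul_of_nonneg_right a5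
      (div_nonneg (abs_nonneg (Real.log (wt t₁ x₁ x₂ β s))) zero_le_two)
    linarith
  · have hlim : ∀ {ξ : ℝ → ℕ → ℝ}, DescentPath x₁ x₂ t₁ (t₁ + varsig x₁ x₂) ξ →
        Filter.Tendsto (fun s => ξ s 0)
          (nhdsWithin (t₁ + varsig x₁ x₂) (Ioo t₁ (t₁ + varsig x₁ x₂))) (nhds (x₂ 0)) := by
      intro ξ hξ
      have := (hξ.continuousOn h.summable₁ hle 0) _ (right_mem_Icc.2 hle)
      rw [ContinuousWithinAt, hξ.right] at this
      exact this.mono_left (nhdsWithin_mono _ Ioo_subset_Icc_self)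
    have h1 := (hlim h.descentPath_expl).sub (hlim hd)
    have h2 := (hw.log (pow_pos hb 2).ne').div_const 2
    have h3 := h1.mul h2
    rwa [sub_self, zero_mul] at h3

omit h in
theorem aemeasurable_klTerm (hs₁ : Summable fun k : ℕ => (k : ℝ) * x₁ k)
    (hs : s ∈ Ico t₁ (t₁ + varsig x₁ x₂)) (k : ℕ) :
    AEMeasurable (fun t => klTerm (nu (vel ζ t) k) (rk (ζ t) k))
      (volume.restrict (Ioo t₁ s)) := by
  have h1 : AEMeasurable (fun t => rk (ζ t) k) (volume.restrict (Ioo t₁ s)) :=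
    ((hd.continuousOn_rk hs₁ hs k).mono Ioo_subset_Icc_self).aemeasurable measurableSet_Ioo
  exact measurable_klTerm.comp_aemeasurable ((measurable_nu_vel ζ k).aemeasurable.prodMk h1)

theorem lintegral_expl_le_add (hs : s ∈ Ico t₁ (t₁ + varsig x₁ x₂))
    (hv : ∀ᵐ t, t ∈ Ioo t₁ (t₁ + varsig x₁ x₂) → SubVelocity (vel ζ t)) :
    ∫⁻ t in Ioo t₁ s, ∑' k, klTerm (explRate t₁ x₁ x₂ β t k) (rk (expl t₁ x₁ x₂ β t) k) ≤
      (∫⁻ t in Ioo t₁ s, ∑' k, klTerm (nu (vel ζ t) k) (rk (ζ t) k)) +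
      ENNReal.ofReal ((expl t₁ x₁ x₂ β s 0 - ζ s 0) * (Real.log (wt t₁ x₁ x₂ β s) / 2) +
        ∑' k, (entQ (zt x₁ x₂ β k) (expl t₁ x₁ x₂ β s k) -
          entQ (zt x₁ x₂ β k) (ζ s k))) := by
  rw [lintegral_tsum fun k => aemeasurable_klTerm hd h.summable₁ hs k,
    setLIntegral_congr_fun (g := fun t => ∑' k, klTerm (nu (vel (expl t₁ x₁ x₂ β) t) k)
      (rk (expl t₁ x₁ x₂ β t) k)) measurableSet_Ioo fun t ht => ?_,
    lintegral_tsum fun k => aemeasurable_klTerm h.descentPath_expl h.summable₁ hs k]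
  · refine le_trans (le_of_eq ?_) ((tsum_ofReal_le_add
      (fun k => (h.lintegral_klTerm_expl hs k).2) (h.hasSum_action_sub hd hs hv)).trans ?_)
    · refine tsum_congr fun k => ?_
      rw [← (h.lintegral_klTerm_expl hs k).1]
      refine setLIntegral_congr_fun measurableSet_Ioo fun t ht => ?_
      simp only [h.nu_vel_expl (t := t) ⟨ht.1.le, ht.2.trans hs.2⟩]
    · gcongr with k
      exact h.ofReal_action_le hd hs hv k
  · simp only [h.nu_vel_expl (t := t) ⟨ht.1.le, ht.2.trans hs.2⟩]

/-- Cut the explicit cost at a fixed `s`, compare up to `u > s` and let `u` tend to the final time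
so that the boundary error disappears; then let `s` increase by monotone convergence. -/
theorem lintegral_expl_le
    (hv : ∀ᵐ t, t ∈ Ioo t₁ (t₁ + varsig x₁ x₂) → SubVelocity (vel ζ t)) :
    ∫⁻ t in Ioo t₁ (t₁ + varsig x₁ x₂),
        ∑' k, klTerm (explRate t₁ x₁ x₂ β t k) (rk (expl t₁ x₁ x₂ β t) k) ≤
      ∫⁻ t in Ioo t₁ (t₁ + varsig x₁ x₂), ∑' k, klTerm (nu (vel ζ t) k) (rk (ζ t) k) := by
  have hlt : t₁ < t₁ + varsig x₁ x₂ := by linarith [h.varsig_pos]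
  have hne : (nhdsWithin (t₁ + varsig x₁ x₂) (Ioo t₁ (t₁ + varsig x₁ x₂))).NeBot :=
    right_nhdsWithin_Ioo_neBot hlt
  have key : ∀ s ∈ Ioo t₁ (t₁ + varsig x₁ x₂), ∫⁻ t in Ioo t₁ s,
        ∑' k, klTerm (explRate t₁ x₁ x₂ β t k) (rk (expl t₁ x₁ x₂ β t) k) ≤
      ∫⁻ t in Ioo t₁ (t₁ + varsig x₁ x₂), ∑' k, klTerm (nu (vel ζ t) k) (rk (ζ t) k) := by
    intro s hs
    have hD := (h.tendsto_zero_diff hd).add (h.tendsto_entQ_diff hd)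
    have hlim := (ENNReal.tendsto_ofReal hD).const_add
      (∫⁻ t in Ioo t₁ (t₁ + varsig x₁ x₂), ∑' k, klTerm (nu (vel ζ t) k) (rk (ζ t) k))
    rw [add_zero, ENNReal.ofReal_zero, add_zero] at hlim
    refine ge_of_tendsto hlim ?_
    have hmem : Ioi s ∈ nhdsWithin (t₁ + varsig x₁ x₂) (Ioo t₁ (t₁ + varsig x₁ x₂)) :=
      mem_nhdsWithin_of_mem_nhds (Ioi_mem_nhds hs.2)
    filter_upwards [self_mem_nhdsWithin, hmem] with u hu hsu
    refine (lintegral_mono_set (Ioo_subset_Ioo_right (le_of_lt hsu))).trans ?_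
    refine (h.lintegral_expl_le_add hd (Ioo_subset_Ico_self hu) hv).trans ?_
    gcongr
    exact hu.2.le
  -- Adding 2 in the denominator puts every cutoff strictly between the two endpoints.
  have hU : Ioo t₁ (t₁ + varsig x₁ x₂) =
      ⋃ n : ℕ, Ioo t₁ (t₁ + varsig x₁ x₂ - varsig x₁ x₂ / ((n : ℝ) + 2)) := by
    ext t
    simp only [mem_iUnion, mem_Ioo]
    constructor
    · rintro ⟨ha, hb⟩
      have hpos : 0 < t₁ + varsig x₁ x₂ - t := sub_pos.2 hb
      obtain ⟨n, hn⟩ := exists_nat_gt (varsig x₁ x₂ / (t₁ + varsig x₁ x₂ - t))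
      refine ⟨n, ha, ?_⟩
      have hn2 : (0 : ℝ) < (n : ℝ) + 2 := by positivity
      have : varsig x₁ x₂ / ((n : ℝ) + 2) < t₁ + varsig x₁ x₂ - t := by
        rw [div_lt_iff₀ hpos] at hn
        rw [div_lt_iff₀ hn2]
        nlinarith
      linarith
    · rintro ⟨n, ha, hb⟩
      have : 0 < varsig x₁ x₂ / ((n : ℝ) + 2) := div_pos h.varsig_pos (by positivity)
      exact ⟨ha, by linarith⟩
  have hmono : Monotone fun n : ℕ =>
      Ioo t₁ (t₁ + varsig x₁ x₂ - varsig x₁ x₂ / ((n : ℝ) + 2)) := by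
    intro m n hmn
    have := h.varsig_pos.le
    refine Ioo_subset_Ioo_right ?_
    gcongr
  nth_rewrite 1 [hU]
  rw [setLIntegral_iUnion_of_directed _ hmono.directed_le]
  refine iSup_le fun n => key _ ?_
  have h1 : varsig x₁ x₂ / ((n : ℝ) + 2) < varsig x₁ x₂ := by
    refine div_lt_self h.varsig_pos ?_
    have : (0 : ℝ) ≤ n := Nat.cast_nonneg n
    linarith
  have h2 : 0 < varsig x₁ x₂ / ((n : ℝ) + 2) := div_pos h.varsig_pos (by positivity)
  constructor <;> linarith

theorem LCost_expl_le :
    LCost t₁ (t₁ + varsig x₁ x₂) (expl t₁ x₁ x₂ β) ≤ LCost t₁ (t₁ + varsig x₁ x₂) ζ := by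
  rw [h.LCost_expl, hd.LCost_eq h.summable₁, EReal.coe_ennreal_le_coe_ennreal_iff]
  by_cases hv : ∀ᵐ t, t ∈ Ioo t₁ (t₁ + varsig x₁ x₂) → SubVelocity (vel ζ t)
  · refine (h.lintegral_expl_le hd hv).trans (le_of_eq (lintegral_congr_ae ?_))
    rw [Filter.EventuallyEq, ae_restrict_iff' measurableSet_Ioo]
    filter_upwards [hv] with t ht hmem
    rw [hd.L_eq h.summable₁ hmem (ht hmem), EReal.toENNReal_coe]
  -- If the rates violate the mass bound on a set of positive measure, `L` is infinite there and the
  -- competitor's cost is infinite.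
  · set B : Set ℝ := Ioo t₁ (t₁ + varsig x₁ x₂) ∩ {t | SubVelocity (vel ζ t)}ᶜ with hB
    have hmB : MeasurableSet B := measurableSet_Ioo.inter (measurableSet_subVelocity ζ).compl
    have hB0 : volume B ≠ 0 := by
      intro h0
      refine hv ?_
      rw [ae_iff]
      convert h0 using 2
      ext t
      simp [hB, and_assoc]
    have htop : ∫⁻ t in B, (L (ζ t) (vel ζ t)).toENNReal = ⊤ := by
      rw [setLIntegral_congr_fun (g := fun _ => ⊤) hmB fun t ht => by
        simp [L_eq_top (x := ζ t) ht.2]]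
      simp [hB0]
    have : ∫⁻ t in B, (L (ζ t) (vel ζ t)).toENNReal ≤
        ∫⁻ t in Ioo t₁ (t₁ + varsig x₁ x₂), (L (ζ t) (vel ζ t)).toENNReal :=
      lintegral_mono_set inter_subset_left
    rw [htop, top_le_iff] at this
    rw [this]
    exact le_top

end Endpoints

/-! ### First moment and conclusion -/

theorem summable_mul_of_moment {p : ℕ → ℝ} (hp : ∀ k, 0 ≤ p k) {ε : ℝ} (hε : 0 < ε)
    (hs : Summable fun k : ℕ => p k * (k : ℝ) ^ (1 + ε)) : Summable fun k : ℕ => (k : ℝ) * p k := by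
  refine hs.of_nonneg_of_le (fun k => mul_nonneg (Nat.cast_nonneg k) (hp k)) fun k => ?_
  rw [mul_comm]
  refine mul_le_mul_of_nonneg_left ?_ (hp k)
  rcases Nat.eq_zero_or_pos k with rfl | hk
  · simpa using Real.rpow_nonneg le_rfl (1 + ε)
  · have h1 : (1 : ℝ) ≤ k := by exact_mod_cast hk
    simpa using Real.rpow_le_rpow_of_exponent_le h1 (by linarith : (1 : ℝ) ≤ 1 + ε)

end ConfigModel

end

theorem mainTheorem8
    -- the limiting degree distribution `p` on `{1, 2, …}` (extended by `p 0 = 0`)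
    (p : ℕ → ℝ) (hp_nonneg : ∀ k, 0 ≤ p k) (hp_zero : p 0 = 0) (hp_sum : HasSum p 1)
    (hp_moment : ∃ ε : ℝ, 0 < ε ∧ Summable (fun k : ℕ => p k * (k : ℝ) ^ (1 + ε)))
    -- the two endpoints, `0 ≤ p⁽²⁾ ≤ p⁽¹⁾ ≤ p`
    (x₁ x₂ : ℕ → ℝ) (hx₁_zero : 0 ≤ x₁ 0) (hx₂_zero : 0 ≤ x₂ 0)
    (hx₂ : ∀ k : ℕ, 1 ≤ k → 0 ≤ x₂ k) (hx₂₁ : ∀ k : ℕ, 1 ≤ k → x₂ k ≤ x₁ k)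
    (hx₁p : ∀ k : ℕ, 1 ≤ k → x₁ k ≤ p k)
    (hς : 0 ≤ varsig x₁ x₂)
    (hz : 2 * ∑' k : ℕ, (x₁ (k + 1) - x₂ (k + 1)) <
      (∑' k : ℕ, ((k : ℝ) + 1) * (x₁ (k + 1) - x₂ (k + 1))) + (x₁ 0 - x₂ 0))
    (t₁ : ℝ) (ht₁ : 0 ≤ t₁)
    -- a path of finite cost from `(0, p)` at time `0` to `x₁` at time `t₁`
    (ζs : ℝ → ℕ → ℝ) (ψs : ℝ → ℝ) (hs : (ζs, ψs) ∈ J0 p 0 t₁ p x₁)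
    (hs_cost : pathCost p 0 t₁ ζs ψs < ⊤) :
    (∃! β : ℝ, IsBeta x₁ x₂ β) ∧
    ∀ β : ℝ, IsBeta x₁ x₂ β →
      (tildeζ t₁ x₁ x₂ β ζs, tildeψ t₁ x₁ x₂ β ψs) ∈ J2 p t₁ (t₁ + varsig x₁ x₂) x₁ x₂ ∧
      (I2 p t₁ (t₁ + varsig x₁ x₂) x₁ x₂ : EReal) =
        (⨅ w ∈ J2 p t₁ (t₁ + varsig x₁ x₂) x₁ x₂, LCost t₁ (t₁ + varsig x₁ x₂) w.1) ∧
      (⨅ w ∈ J2 p t₁ (t₁ + varsig x₁ x₂) x₁ x₂, LCost t₁ (t₁ + varsig x₁ x₂) w.1) =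
        LCost t₁ (t₁ + varsig x₁ x₂) (tildeζ t₁ x₁ x₂ β ζs) := by
  obtain ⟨ε, hε, hmom⟩ := hp_moment
  have hp := summable_mul_of_moment hp_nonneg hε hmom
  have hx₁ : ∀ k : ℕ, 1 ≤ k → 0 ≤ x₁ k := fun k hk => (hx₂ k hk).trans (hx₂₁ k hk)
  have hs₁ := summable_mul_of_le hp hx₁ hx₁p
  have hs₂ := summable_mul_of_le hs₁ hx₂ hx₂₁
  have hsum : Summable fun k : ℕ => ((k : ℝ) + 1) * (x₁ (k + 1) - x₂ (k + 1)) := by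
    have h1 := (summable_nat_add_iff 1).2 (hs₁.sub hs₂)
    refine h1.congr fun k => ?_
    push_cast
    ring
  refine ⟨existsUnique_isBeta hx₁_zero hx₂_zero hx₂₁ hsum hz, fun β hβ => ?_⟩
  have h : Endpoints p x₁ x₂ β := ⟨hp, hx₁_zero, hx₂_zero, hx₂, hx₂₁, hx₁p, hz, hβ⟩
  have hlt : t₁ < t₁ + varsig x₁ x₂ := by linarith [h.varsig_pos]
  have hmem := h.tilde_mem_J2 ht₁ hs
  have hinf : (⨅ w ∈ J2 p t₁ (t₁ + varsig x₁ x₂) x₁ x₂, LCost t₁ (t₁ + varsig x₁ x₂) w.1) =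
      LCost t₁ (t₁ + varsig x₁ x₂) (tildeζ t₁ x₁ x₂ β ζs) := by
    refine le_antisymm (iInf₂_le _ hmem) (le_iInf₂ fun w hw => ?_)
    rw [h.LCost_tilde ht₁ hs]
    exact h.LCost_expl_le (DescentPath.of_mem_J2 hp ht₁ hlt hw)
  refine ⟨hmem, ?_, hinf⟩
  rw [hinf, h.LCost_tilde ht₁ hs]
  -- Both directions come from the chain `I2 ≤ pathCost ζ̃ ≤ ∫ L(ζ̃) ≤ ∫ L(ζ) ≤ pathCost ζ`, valid
  -- for every competitor `ζ`.
  apply le_antisymm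
  · refine le_trans ?_ (h.pathCost_tilde_le ht₁ hs hs_cost)
    rw [EReal.coe_ennreal_le_coe_ennreal_iff]
    exact iInf₂_le _ hmem
  · rw [h.LCost_expl, EReal.coe_ennreal_le_coe_ennreal_iff]
    refine le_iInf₂ fun w hw => ?_
    rw [← EReal.coe_ennreal_le_coe_ennreal_iff, ← h.LCost_expl]
    exact (h.LCost_expl_le (DescentPath.of_mem_J2 hp ht₁ hlt hw)).trans
      (LCost_le_pathCost hp ht₁ hlt hw)
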